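/- Work in the complex-analytic category and consider the KdV equation $u_t=u_3+u\,u_1$, where $u_k=\partial^k u/\partial x^k$. *Zero-curvature representations.* A (translation-invariant) zero-curvature representation (ZCR) of the KdV equation with values in a complex Lie algebra $\mathfrak g$ is a pair of analytic $\mathfrak g$-valued functions $A(u)$, $B(u,u_1,u_2)$ on a connected open domain with $[D_x+A,\,D_t+B]=D_xB-D_tA+[A,B]=0$, where $D_x,D_t$ are the total derivatives determined by the KdV equation. (Analyticity and derivatives of $\mathfrak g$-valued functions are understood through a separating family of linear functionals on $\mathfrak g$.) The Wahlquist–Estabrook algebra $\mathfrak{we}$ of the KdV equation is the Lie algebra with the universal such ZCR: every ZCR with values in a Lie algebra $\mathfrak g$ is the image of the universal one under a unique homomorphism $\mathfrak{we}\to\mathfrak g$. With $A(u)$ the $x$-part of the universal ZCR, put $\mathfrak{we}^0=0$; let $\mathfrak{we}^1$ be the subalgebra generated by all $A(u)-A(u')$; let $\mathfrak{we}^{k+1}$ ($k\ge1$) be the subalgebra generated by $\mathfrak{we}^k$ and $[\mathfrak{we}^k,A(u)]$ for all $u$; and put $\widetilde{\mathfrak{we}}=\bigcup_{k\ge 0}\mathfrak{we}^k$.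 *Miura type transformations.* A Miura type transformation (MT) over the KdV equation is a substitution $u=S(x,t,v,v_1,\dots,v_m)$ together with an evolution equation $v_t=R(x,t,v,v_1,\dots,v_m)$ ($m$ arbitrary, $R,S$ analytic on an open set $\Omega$ of the space of $(x,t,v,\dots,v_m)$) such that $u=S$ satisfies the KdV equation by virtue of $v_t=R$, i.e. such that $$\frac{\partial S}{\partial t}+\sum_{j\ge0}D^j(R)\,\frac{\partial S}{\partial v_j}=D^3(S)+S\,D(S),\qquad D=\frac{\partial}{\partial x}+\sum_{j\ge0}v_{j+1}\frac{\partial}{\partial v_j},$$ holds identically at all jets whose $(x,t,v,\dots,v_m)$ lies in $\Omega$. Its order is the maximal $n$ such that $S$ depends nontrivially on $v_n$, that is, $\partial S/\partial v_n\not\equiv0$ on $\Omega$. **Theorem.** 1. The Wahlquist–Estabrook algebra of the KdV equation is $$\mathfrak{we}=H\oplus\bigl(\mathfrak{sl}_2(\mathbb C)\otimes_{\mathbb C}\mathbb C[\lambda]\bigr),$$ where $H$ is the $5$-dimensional Heisenberg algebra with basis $r_{-2},r_{-1},r_0,r_1,r_2$ and brackets $[r_{-1},r_1]=[r_2,r_{-2}]=r_0$,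 $[r_i,r_j]=0$ for $i+j\ne0$, and the bracket on the second summand is $[g_1\otimes f_1,g_2\otimes f_2]=[g_1,g_2]\otimes f_1f_2$. The $x$-part of the universal ZCR is $$A(u)=X_1+\tfrac13uX_2+\tfrac16u^2X_3,\quad X_1=r_1-\tfrac12y+\tfrac12z\lambda,\quad X_2=r_{-1}+z,\quad X_3=r_{-2},$$ where $h,y,z$ is the basis of $\mathfrak{sl}_2$ with $[h,y]=2y$, $[h,z]=-2z$, $[y,z]=h$. 2. $\mathfrak{we}^3=\widetilde{\mathfrak{we}}$. 3. Every MT over the KdV equation, translation-invariant (i.e. with $R,S$ not depending on $x,t$) or not, has order at most $3$. -/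

import Mathlib

universe w

namespace KdVMiura

open scoped Polynomial TensorProduct

/-! ### Jets in one dependent variable

A function on the jet space depends on `x`, `t` and on `v 0, v 1, v 2, …`, where `v j` stands for
`∂ʲv/∂xʲ`. -/

/-- Functions of `x`, `t` and the jet coordinates `v 0, v 1, …`. -/
abbrev JetFun : Type := ℂ → ℂ → (ℕ → ℂ) → ℂ

/-- A function of `x, t, v₀, …, vₘ` regarded as a function on the full jet space. -/
def ofFinite {m : ℕ} (f : ℂ × ℂ × (Fin (m + 1) → ℂ) → ℂ) : JetFun :=
  fun x t v => f (x, t, fun i => v i)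

/-- The partial derivative `∂F/∂vⱼ`. -/
noncomputable def partialV (j : ℕ) (F : JetFun) : JetFun :=
  fun x t v => deriv (fun s => F x t (Function.update v j s)) (v j)

/-- The total derivative `D_x = ∂/∂x + ∑ⱼ vⱼ₊₁ ∂/∂vⱼ`. The sum is finite on functions that depend
on finitely many `vⱼ`, the only ones it is applied to. -/
noncomputable def totalDx (F : JetFun) : JetFun :=
  fun x t v => deriv (fun s => F s t v) x + ∑ᶠ j : ℕ, v (j + 1) * partialV j F x t v

/-- The total derivative `D_t = ∂/∂t + ∑ⱼ D_xʲ(R) ∂/∂vⱼ` along the evolution equation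
`v_t = R(x, t, v₀, v₁, …)`. -/
noncomputable def totalDt (R F : JetFun) : JetFun :=
  fun x t v => deriv (fun s => F x s v) t + ∑ᶠ j : ℕ, (totalDx^[j] R) x t v * partialV j F x t v

/-- The right-hand side of the KdV equation `u_t = u₃ + u u₁`. -/
def kdv (u : ℕ → ℂ) : ℂ := u 3 + u 0 * u 1

/-- On an open set `Ω` of the space of `(x, t, v₀, …, vₘ)`, the analytic substitution
`u = S(x, t, v₀, …, vₘ)` is a Miura type transformation from `v_t = R(x, t, v₀, …, vₘ)` to
`u_t = P(u, u₁, …)`: by virtue of `v_t = R`, the function `u = S`, whose `x`-derivatives are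
`u_k = D_xᵏ S`, satisfies `u_t = P(u, u₁, …)`. The number `m` is only a common bound for the orders
of `R` and `S`. -/
structure IsMiuraTransformation (P : (ℕ → ℂ) → ℂ) {m : ℕ}
    (Ω : Set (ℂ × ℂ × (Fin (m + 1) → ℂ))) (R S : ℂ × ℂ × (Fin (m + 1) → ℂ) → ℂ) : Prop where
  isOpen : IsOpen Ω
  analytic_R : AnalyticOnNhd ℂ R Ω
  analytic_S : AnalyticOnNhd ℂ S Ω
  transforms : ∀ (x t : ℂ) (v : ℕ → ℂ), (x, t, fun i : Fin (m + 1) => v i) ∈ Ω →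
    totalDt (ofFinite R) (ofFinite S) x t v = P (fun k => (totalDx^[k] (ofFinite S)) x t v)

/-- The order of the substitution `u = S` on `Ω` is `n`: the maximal `n` such that `S` depends
nontrivially on `vₙ`. -/
def HasOrder {m : ℕ} (Ω : Set (ℂ × ℂ × (Fin (m + 1) → ℂ)))
    (S : ℂ × ℂ × (Fin (m + 1) → ℂ) → ℂ) (n : ℕ) : Prop :=
  IsGreatest {k : ℕ | ∃ (x t : ℂ) (v : ℕ → ℂ), (x, t, fun i : Fin (m + 1) => v i) ∈ Ω ∧
    partialV k (ofFinite S) x t v ≠ 0} n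

/-! ### Zero-curvature representations and the Wahlquist-Estabrook algebra -/

section ZCR

variable {L : Type*} [LieRing L] [LieAlgebra ℂ L]

/-- The functions `A(u)` and `B(u, u₁, …, u_{p-1})`, for `(u, …, u_{p-1}) ∈ D`, with values in the
complex Lie algebra `L` form a zero-curvature representation of `u_t = P(u, …, u_p)`:
`[D_x + A, D_t + B] = D_x B - D_t A + [A, B] = 0`.
Analyticity and derivatives of `L`-valued functions are understood through the linear functionals
`ℓ ∈ Λ`. For an abstract Lie algebra `Λ` can be the set of all linear functionals; for the Lie
algebra of vector fields on a domain `W ⊆ ℂⁿ` it can be the set of functionals that send a vector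
field to one of its components at a point of `W`. -/
structure IsZCR (p : ℕ) [NeZero p] (P : (ℕ → ℂ) → ℂ) (Λ : Set (Module.Dual ℂ L))
    (D : Set (Fin p → ℂ)) (A : ℂ → L) (B : (Fin p → ℂ) → L) : Prop where
  analytic_A : ∀ ℓ ∈ Λ, AnalyticOnNhd ℂ (fun s => ℓ (A s)) ((fun b : Fin p → ℂ => b 0) '' D)
  analytic_B : ∀ ℓ ∈ Λ, AnalyticOnNhd ℂ (fun b => ℓ (B b)) D
  zero_curvature : ∀ ℓ ∈ Λ, ∀ u : ℕ → ℂ, (fun i : Fin p => u i) ∈ D →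
    (∑ i : Fin p, u (i + 1) *
        deriv (fun s => ℓ (B (Function.update (fun i : Fin p => u i) i s))) (u i))
      - P u * deriv (fun s => ℓ (A s)) (u 0)
      + ℓ ⁅A (u 0), B (fun i : Fin p => u i)⁆ = 0

/-- `L`, with the zero-curvature representation `A, B`, is the Wahlquist-Estabrook algebra of
`u_t = P(u, …, u_p)` (`P` defined for all values of the variables): `A, B` is the universal
translation-invariant zero-curvature representation, that is, every zero-curvature representation
`A', B'` with values in any complex Lie algebra and over any domain `D` arises from `A, B` by a
unique homomorphism. So `L` is generated by the coefficients of `A, B` and its relations are exactly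
those that the zero-curvature equation imposes on the coefficients. -/
def IsWahlquistEstabrook (p : ℕ) [NeZero p] (P : (ℕ → ℂ) → ℂ)
    (A : ℂ → L) (B : (Fin p → ℂ) → L) : Prop :=
  IsZCR p P Set.univ Set.univ A B ∧
  ∀ (𝔤 : Type w) [LieRing 𝔤] [LieAlgebra ℂ 𝔤] (Λ : Set (Module.Dual ℂ 𝔤)),
    (∀ X : 𝔤, (∀ ℓ ∈ Λ, ℓ X = 0) → X = 0) →
    ∀ D : Set (Fin p → ℂ), IsOpen D → IsConnected D →
    ∀ (A' : ℂ → 𝔤) (B' : (Fin p → ℂ) → 𝔤), IsZCR p P Λ D A' B' →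
      ∃! φ : L →ₗ⁅ℂ⁆ 𝔤, ∀ b ∈ D, A' (b 0) = φ (A (b 0)) ∧ B' b = φ (B b)

/-- The chain of subalgebras `𝔤⁰ ⊆ 𝔤¹ ⊆ 𝔤² ⊆ …` attached to the `x`-part `M` of a zero-curvature
representation (`ι` is the set of admissible values of the variables in `M`): `𝔤⁰ = 0`, the
subalgebra `𝔤¹` is generated by all differences of values of `M`, and `𝔤ᵏ⁺¹` is generated by `𝔤ᵏ`
and `[𝔤ᵏ, M]`. -/
def zcrSubalgebra {ι : Type*} (M : ι → L) : ℕ → LieSubalgebra ℂ L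
  | 0 => ⊥
  | 1 => LieSubalgebra.lieSpan ℂ L {X | ∃ a b, X = M a - M b}
  | k + 2 => LieSubalgebra.lieSpan ℂ L
      ((zcrSubalgebra M (k + 1) : Set L) ∪ {X | ∃ Y ∈ zcrSubalgebra M (k + 1), ∃ a, X = ⁅Y, M a⁆})

/-- `𝔤~ = ⋃ₖ 𝔤ᵏ`. -/
def zcrUnion {ι : Type*} (M : ι → L) : Set L := ⋃ k : ℕ, (zcrSubalgebra M k : Set L)

end ZCR

/-! ### The algebra `H ⊕ sl₂ ⊗ ℂ[λ]` -/

/-- The `5`-dimensional Heisenberg algebra `H` with the basis `r₋₂, r₋₁, r₀, r₁, r₂`; the element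
`a` has the coordinates `a 0, …, a 4` in this basis. -/
def Heis : Type := Fin 5 → ℂ

namespace Heis

noncomputable instance : AddCommGroup Heis := inferInstanceAs (AddCommGroup (Fin 5 → ℂ))

noncomputable instance : Module ℂ Heis := inferInstanceAs (Module ℂ (Fin 5 → ℂ))

/-- The basis element `r_{i-2}`. -/
noncomputable def basisElt (i : Fin 5) : Heis := (Pi.single i 1 : Fin 5 → ℂ)

/-- `[r₋₁, r₁] = [r₂, r₋₂] = r₀`, and `[rᵢ, rⱼ] = 0` for `i + j ≠ 0`. -/
noncomputable instance : Bracket Heis Heis where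
  bracket a b := (a 1 * b 3 - a 3 * b 1 + (a 4 * b 0 - a 0 * b 4)) • basisElt 2

theorem bracket_apply (a b : Heis) (i : Fin 5) :
    ⁅a, b⁆ i = (a 1 * b 3 - a 3 * b 1 + (a 4 * b 0 - a 0 * b 4)) *
      (Pi.single 2 1 : Fin 5 → ℂ) i := rfl

theorem add_apply (a b : Heis) (i : Fin 5) : (a + b) i = a i + b i := rfl

theorem smul_apply (c : ℂ) (a : Heis) (i : Fin 5) : (c • a) i = c * a i := rfl

theorem zero_apply (i : Fin 5) : (0 : Heis) i = 0 := rfl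

noncomputable instance : LieRing Heis where
  add_lie a b c := by
    funext i; simp only [bracket_apply, add_apply]; ring
  lie_add a b c := by
    funext i; simp only [bracket_apply, add_apply]; ring
  lie_self a := by
    funext i; simp only [bracket_apply, zero_apply]; ring
  leibniz_lie a b c := by
    funext i; simp [bracket_apply, add_apply]

noncomputable instance : LieAlgebra ℂ Heis where
  lie_smul c a b := by
    funext i; simp only [bracket_apply, smul_apply]; ring

end Heis

/-- The Lie algebra `sl₂(ℂ)`. -/
abbrev Sl2 : Type := LieAlgebra.SpecialLinear.sl (Fin 2) ℂ

/-- The basis `h, y, z` of `sl₂` has the relations `[h, y] = 2y`, `[h, z] = -2z`, `[y, z] = h`. -/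
noncomputable def ySl2 : Sl2 := LieAlgebra.SpecialLinear.single 0 1 (by decide) 1

/-- See `ySl2`. -/
noncomputable def zSl2 : Sl2 := LieAlgebra.SpecialLinear.single 1 0 (by decide) 1

/-- The Lie algebra `H ⊕ sl₂ ⊗ ℂ[λ]`, with the bracket
`[g₁ ⊗ f₁, g₂ ⊗ f₂] = [g₁, g₂] ⊗ f₁ f₂` on the second summand (the two tensor factors are written
in the opposite order). -/
abbrev KdVAlgebra : Type := Heis × (ℂ[X] ⊗[ℂ] Sl2)

/-- `X₁ = r₁ - ½ y + ½ z λ`. -/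
noncomputable def X₁ : KdVAlgebra :=
  (Heis.basisElt 3,
    -((1 / 2 : ℂ) • ((1 : ℂ[X]) ⊗ₜ[ℂ] ySl2)) + (1 / 2 : ℂ) • ((Polynomial.X : ℂ[X]) ⊗ₜ[ℂ] zSl2))

/-- `X₂ = r₋₁ + z`. -/
noncomputable def X₂ : KdVAlgebra := (Heis.basisElt 1, (1 : ℂ[X]) ⊗ₜ[ℂ] zSl2)

/-- `X₃ = r₋₂`. -/
noncomputable def X₃ : KdVAlgebra := (Heis.basisElt 0, 0)

/-- The `x`-part `A(u) = X₁ + ⅓ u X₂ + ⅙ u² X₃` of the universal zero-curvature representation of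
the KdV equation. -/
noncomputable def kdvA (u : ℂ) : KdVAlgebra :=
  X₁ + (u / 3) • X₂ + (u ^ 2 / 6) • X₃

end KdVMiura

/-!
The three parts rest on one computation: solving the zero-curvature equation of the KdV equation
in an arbitrary complex Lie algebra.

*The equation.* On a polydisc, comparison of the powers of `u₃`, `u₂`, `u₁` forces `B` to be
affine in `u₂` and quadratic in `u₁`, and then `A = a + u b + ½ u² c`, with `B` a polynomial in
`u, u₁, u₂` that is determined by `a, b, c` and its constant term `d` (`zcr_box`). What remains of
the equation is a list of relations between `a, b, c, d` (`KdVRelations`), and conversely these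
relations suffice (`KdVRelations.isZCR`). By the identity theorem, the polynomial form extends
from a ball to a connected domain.

*The algebra.* `KdVRelations` is a presentation of `H ⊕ sl₂ ⊗ ℂ[λ]`. From `a, b, c, d` one
extracts elements with the brackets of `r₋₂, …, r₂` and others with those of `y, z, λ z`, such
that the former commute with the latter (`KdVRelations.decomposition`); `h = ⁅y, z⁆` acts with
integral weights, and several brackets vanish as components of different weights of an element
that is zero. The converse is `KdVRelations.of_decomposition`. Finitely many brackets of
`y, z, λ z` determine all the brackets of `sl₂ ⊗ ℂ[λ]`: bracketing with `λ h` shifts the degree,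
which allows an induction on the degree (`CurrentTriple.exists_sequences`). Hence elements with
`KdVRelations` are the images of `X₁, X₂, X₃` and the constant term `X₀` under a homomorphism
(`KdVRelations.exists_lieHom`), unique because these elements generate the algebra (`lieHom_ext`).

*The chain of subalgebras.* The elements without components along `r₁` and `r₂` form an ideal
`kdvCore` that contains all `A(u) - A(u')`, hence the whole chain. Conversely, two brackets with
`A(0) = X₁` give `y`, `z`, `λ z`, `r₋₁`, `r₀`, `r₋₂`, which generate `kdvCore`.

*Miura type transformations.* Comparison of the leading terms shows that `R` has order at most `3`
(`Jet.IsMiura.dep_four`). If `S` has order `n`, then `x, t, v₀, …, v_{n-1}, u, u₁, u₂, …` are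
local coordinates on the jet space, and in these `D_x` and `D_t`, acting on functions of
`x, t, v₀, …, v_{n-1}`, become vector fields `X(u)` and `Y(u, u₁, u₂)` with parameters. They form
a zero-curvature representation with values in the linear operators on analytic functions, with
the values of such functions at points as the separating functionals (`Jet.IsUChart.isZCR`). So
`X` is quadratic in `u`, with coefficients that satisfy `KdVRelations`. Put `m = ⁅a, b⁆` and
`κ = ⁅a, m⁆`. In `H ⊕ sl₂ ⊗ ℂ[λ]` one has `⁅a, κ⁆ = -9 ⁅⁅m, κ⁆, κ⁆`. But `X(u)` differs from the
shift `vᵢ ↦ vᵢ₊₁` only on `v_{n-1}`, so that `b`, `m`, `κ` kill the functions of `x, t` and of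
`v₀, …, v_{n-2}`, `v₀, …, v_{n-3}`, `v₀, …, v_{n-4}`, respectively. For `n ≥ 4` the relation
applied to `v_{n-4}` shows that `X(u)` does not depend on `u`, although `X(u) v_{n-1} = vₙ` does
(`Jet.IsMiura.order_le_three`).
-/

namespace KdVMiura

/-! ### The relations of the zero-curvature equation -/

section Relations

variable {L : Type*} [LieRing L]

theorem lie_lie_eq_zero_of_commute {x y z : L} (hy : ⁅x, y⁆ = 0) (hz : ⁅x, z⁆ = 0) :
    ⁅x, ⁅y, z⁆⁆ = 0 := by
  rw [leibniz_lie, hy, hz, zero_lie, lie_zero, add_zero]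

theorem lie_eq_neg_of_lie_eq {x y z : L} (h : ⁅x, y⁆ = z) : ⁅y, x⁆ = -z := by
  rw [← h, lie_skew]

variable [LieAlgebra ℂ L]

/-- Elements of different weights for `h` are linearly independent: the case of two opposite
non-zero weights. -/
theorem eq_zero_of_add_eq_zero_of_weight {h x y : L} {c : ℂ} (hc : c ≠ 0)
    (hx : ⁅h, x⁆ = c • x) (hy : ⁅h, y⁆ = -(c • y)) (hxy : x + y = 0) : x = 0 ∧ y = 0 := by
  have h1 : c • x - c • y = 0 := by
    have := congrArg (fun t => ⁅h, t⁆) hxy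
    simpa [hx, hy, sub_eq_add_neg] using this
  have h2 : c • (x - y) = 0 := by rw [smul_sub, h1]
  have h3 : x - y = 0 := (smul_eq_zero.mp h2).resolve_left hc
  constructor
  · linear_combination (norm := module) (1 / 2 : ℂ) • hxy + (1 / 2 : ℂ) • h3
  · linear_combination (norm := module) (1 / 2 : ℂ) • hxy - (1 / 2 : ℂ) • h3

/-- The relations that the zero-curvature equation of the KdV equation imposes on the coefficients
of `A = a + u b + ½ u² c` and on the constant term `d` of `B`. The field names list the letters of
the left-hand sides, with `m` for `⁅a, b⁆`. -/
structure KdVRelations (a b c d : L) : Prop where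
  ac : ⁅a, c⁆ = 0
  bc : ⁅b, c⁆ = 0
  ad : ⁅a, d⁆ = 0
  bd : ⁅b, d⁆ = -⁅a, ⁅a, ⁅a, b⁆⁆⁆
  cd : ⁅c, d⁆ = -((3 : ℂ) • ⁅a, ⁅b, ⁅a, b⁆⁆⁆) - ⁅a, b⁆
  bbm : ⁅b, ⁅b, ⁅a, b⁆⁆⁆ = 0

/-- A presentation of the current algebra `sl₂ ⊗ ℂ[λ]`: `y, h, z` stand for themselves, `z₁` for
`λ z`, and `h₁, y₁, z₂` for `λ h, λ y, λ² z`. -/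
structure CurrentTriple (h y z h₁ z₁ y₁ z₂ : L) : Prop where
  hy : ⁅h, y⁆ = (2 : ℂ) • y
  hz : ⁅h, z⁆ = -((2 : ℂ) • z)
  yz : ⁅y, z⁆ = h
  hz₁ : ⁅h, z₁⁆ = -((2 : ℂ) • z₁)
  zz₁ : ⁅z, z₁⁆ = 0
  yz₁ : ⁅y, z₁⁆ = h₁
  h₁y : ⁅h₁, y⁆ = (2 : ℂ) • y₁
  h₁z₁ : ⁅h₁, z₁⁆ = -((2 : ℂ) • z₂)
  yy₁ : ⁅y, y₁⁆ = 0
  z₁z₂ : ⁅z₁, z₂⁆ = 0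

theorem smul_eq_zero_of_ne {c : ℂ} (hc : c ≠ 0) {x : L} (h : c • x = 0) : x = 0 :=
  (smul_eq_zero.mp h).resolve_left hc

/-- Four elements of the weights `2, -2, 4, -4` are linearly independent. -/
theorem eq_zero_of_add_eq_zero_of_four_weights {h P Q U V : L}
    (hP : ⁅h, P⁆ = (2 : ℂ) • P) (hQ : ⁅h, Q⁆ = -((2 : ℂ) • Q)) (hU : ⁅h, U⁆ = (4 : ℂ) • U)
    (hV : ⁅h, V⁆ = -((4 : ℂ) • V)) (hs : P + Q - U + V = 0) :
    P = 0 ∧ Q = 0 ∧ U = 0 ∧ V = 0 := by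
  have h1 : (2 : ℂ) • P - (2 : ℂ) • Q - (4 : ℂ) • U - (4 : ℂ) • V = 0 := by
    have := congrArg (fun t => ⁅h, t⁆) hs
    simp only [lie_add, lie_sub, hP, hQ, hU, hV, lie_zero] at this
    linear_combination (norm := module) this
  have h2 : (4 : ℂ) • P + (4 : ℂ) • Q - (16 : ℂ) • U + (16 : ℂ) • V = 0 := by
    have := congrArg (fun t => ⁅h, t⁆) h1
    simp only [lie_sub, lie_smul, hP, hQ, hU, hV, lie_zero] at this
    linear_combination (norm := module) this
  have h3 : (8 : ℂ) • P - (8 : ℂ) • Q - (64 : ℂ) • U - (64 : ℂ) • V = 0 := by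
    have := congrArg (fun t => ⁅h, t⁆) h2
    simp only [lie_add, lie_sub, lie_smul, hP, hQ, hU, hV, lie_zero] at this
    linear_combination (norm := module) this
  refine ⟨?_, ?_, ?_, ?_⟩
  · linear_combination (norm := module) (2 / 3 : ℂ) • hs + (1 / 3 : ℂ) • h1 -
      (1 / 24 : ℂ) • h2 - (1 / 48 : ℂ) • h3
  · linear_combination (norm := module) (2 / 3 : ℂ) • hs - (1 / 3 : ℂ) • h1
      - (1 / 24 : ℂ) • h2 + (1 / 48 : ℂ) • h3
  · linear_combination (norm := module) (1 / 6 : ℂ) • hs +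
      (1 / 24 : ℂ) • h1 - (1 / 24 : ℂ) • h2 - (1 / 96 : ℂ) • h3
  · linear_combination (norm := module) (-1 / 6 : ℂ) • hs + (1 / 24 : ℂ) • h1 +
      (1 / 24 : ℂ) • h2 - (1 / 96 : ℂ) • h3

/-- The element `s = ⁅c, d⁆` commutes with `a` and `b`, hence with everything they generate. This
closes the brackets of `p = ⁅b, ⁅a, b⁆⁆`, `q = ⁅a, p⁆`, `x₁ = ⁅a, q⁆` and `v = ⁅q, x₁⁆`: up to
scaling, `q, p` and `x₁ ± 9 v` satisfy the relations of `h, z, y, λ z`. The combination `b + 3 p`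
commutes with `p` and `q`, and `⁅b + 3 p, a⁆ = s`. -/
theorem KdVRelations.basic_brackets {a b c d m p q s x₁ x₂ v w : L} (H : KdVRelations a b c d)
    (ab : ⁅a, b⁆ = m) (bm : ⁅b, m⁆ = p) (ap : ⁅a, p⁆ = q) (hs : s = -((3 : ℂ) • q) - m)
    (aq : ⁅a, q⁆ = x₁) (ax₁ : ⁅a, x₁⁆ = x₂) (qx₁ : ⁅q, x₁⁆ = v) (av : ⁅a, v⁆ = w) :
    (⁅s, a⁆ = 0 ∧ ⁅s, b⁆ = 0 ∧ ⁅c, d⁆ = s ∧ ⁅c, p⁆ = 0 ∧ ⁅a, m⁆ = -((3 : ℂ) • x₁)) ∧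
    (⁅q, p⁆ = -((1 / 9 : ℂ) • p) ∧ ⁅p, x₁⁆ = (1 / 9 : ℂ) • q ∧ ⁅q, w⁆ = 0 ∧
      ⁅p, v⁆ = (1 / 81 : ℂ) • q ∧ ⁅q, v⁆ = (1 / 81 : ℂ) • x₁) ∧
    (⁅b + (3 : ℂ) • p, p⁆ = 0 ∧ ⁅b + (3 : ℂ) • p, q⁆ = 0 ∧ ⁅b + (3 : ℂ) • p, a⁆ = s ∧
      ⁅b + (3 : ℂ) • p, d⁆ = (81 : ℂ) • w) ∧
    ⁅d, p⁆ = x₂ - (27 : ℂ) • w := by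
  obtain ⟨ac, bc, ad, bd, cd, bbm⟩ := H
  rw [ab] at bd cd bbm
  rw [bm] at cd bbm
  rw [ap] at cd
  have cds : ⁅c, d⁆ = s := by rw [hs, cd]
  have ca : ⁅c, a⁆ = 0 := by rw [lie_eq_neg_of_lie_eq ac, neg_zero]
  have cb : ⁅c, b⁆ = 0 := by rw [lie_eq_neg_of_lie_eq bc, neg_zero]
  have cm : ⁅c, m⁆ = 0 := ab ▸ lie_lie_eq_zero_of_commute ca cb
  have cp : ⁅c, p⁆ = 0 := bm ▸ lie_lie_eq_zero_of_commute cb cm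
  have as : ⁅a, s⁆ = 0 := cds ▸ lie_lie_eq_zero_of_commute ac ad
  have bs : ⁅b, s⁆ = 0 := by
    rw [← cds, leibniz_lie, bc, zero_lie, zero_add, bd, lie_neg,
      lie_lie_eq_zero_of_commute ca (lie_lie_eq_zero_of_commute ca cm), neg_zero]
  have sa : ⁅s, a⁆ = 0 := by rw [lie_eq_neg_of_lie_eq as, neg_zero]
  have sb : ⁅s, b⁆ = 0 := by rw [lie_eq_neg_of_lie_eq bs, neg_zero]
  have sm : ⁅s, m⁆ = 0 := ab ▸ lie_lie_eq_zero_of_commute sa sb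
  have sp : ⁅s, p⁆ = 0 := bm ▸ lie_lie_eq_zero_of_commute sb sm
  have sq : ⁅s, q⁆ = 0 := ap ▸ lie_lie_eq_zero_of_commute sa sp
  have sx₁ : ⁅s, x₁⁆ = 0 := aq ▸ lie_lie_eq_zero_of_commute sa sq
  have sx₂ : ⁅s, x₂⁆ = 0 := ax₁ ▸ lie_lie_eq_zero_of_commute sa sx₁
  have sv : ⁅s, v⁆ = 0 := qx₁ ▸ lie_lie_eq_zero_of_commute sq sx₁
  have sw : ⁅s, w⁆ = 0 := av ▸ lie_lie_eq_zero_of_commute sa sv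
  -- modulo the central element `s`, bracketing with `m` is `-3` times bracketing with `q`
  have mX : ∀ X : L, ⁅s, X⁆ = 0 → ⁅m, X⁆ = -((3 : ℂ) • ⁅q, X⁆) := fun X hX => by
    rw [hs, sub_lie, neg_lie, smul_lie] at hX
    linear_combination (norm := module) -hX
  have bX : ∀ X : L, ⁅s, X⁆ = 0 → ⁅b, ⁅a, X⁆⁆ = ⁅a, ⁅b, X⁆⁆ + (3 : ℂ) • ⁅q, X⁆ := fun X hX => by
    rw [leibniz_lie, lie_eq_neg_of_lie_eq ab, neg_lie, mX X hX]; abel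
  have am : ⁅a, m⁆ = -((3 : ℂ) • x₁) := by
    rw [hs, lie_sub, lie_neg, lie_smul, aq] at as
    linear_combination (norm := module) -as
  have bq : ⁅b, q⁆ = -((1 / 3 : ℂ) • p) := by
    have h := bs
    rw [hs, lie_sub, lie_neg, lie_smul, bm] at h
    linear_combination (norm := module) (-1 / 3 : ℂ) • h
  have qp : ⁅q, p⁆ = -((1 / 9 : ℂ) • p) := by
    have h1 : ⁅m, p⁆ = (1 / 3 : ℂ) • p := by
      rw [← ab, lie_lie, bbm, ap, bq, lie_zero]; abel
    have h2 := mX p sp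
    rw [h1] at h2
    linear_combination (norm := module) (1 / 3 : ℂ) • h2
  have pa : ⁅p, a⁆ = -q := lie_eq_neg_of_lie_eq ap
  have pq : ⁅p, q⁆ = (1 / 9 : ℂ) • p := by rw [lie_eq_neg_of_lie_eq qp, neg_neg]
  have px₁ : ⁅p, x₁⁆ = (1 / 9 : ℂ) • q := by
    rw [← aq, leibniz_lie, pa, pq, neg_lie, lie_self, neg_zero, zero_add, lie_smul, ap]
  have qx₂ : ⁅q, x₂⁆ = w := by
    rw [← ax₁, leibniz_lie, lie_eq_neg_of_lie_eq aq, qx₁, av, neg_lie, lie_self, neg_zero, zero_add]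
  have pv : ⁅p, v⁆ = (1 / 81 : ℂ) • q := by
    rw [← qx₁, leibniz_lie, pq, px₁, smul_lie, px₁, lie_smul, lie_self]
    module
  have bx₁ : ⁅b, x₁⁆ = -((1 / 3 : ℂ) • q) := by
    rw [← aq, bX q sq, bq, lie_self, lie_neg, lie_smul, ap]; module
  have bx₂ : ⁅b, x₂⁆ = (3 : ℂ) • v - (1 / 3 : ℂ) • x₁ := by
    rw [← ax₁, bX x₁ sx₁, bx₁, qx₁, lie_neg, lie_smul, aq]; module
  have bx₃ : ⁅b, ⁅a, x₂⁆⁆ = (6 : ℂ) • w - (1 / 3 : ℂ) • x₂ := by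
    rw [bX x₂ sx₂, bx₂, qx₂, lie_sub, lie_smul, lie_smul, av, ax₁]; module
  have da : ⁅d, a⁆ = 0 := by rw [lie_eq_neg_of_lie_eq ad, neg_zero]
  rw [am, lie_neg, lie_smul, ax₁] at bd
  have db : ⁅d, b⁆ = -((3 : ℂ) • x₂) := by rw [lie_eq_neg_of_lie_eq bd]; abel
  have dm : ⁅d, m⁆ = -((3 : ℂ) • ⁅a, x₂⁆) := by
    rw [← ab, leibniz_lie, da, zero_lie, zero_add, db, lie_neg, lie_smul]
  have dp : ⁅d, p⁆ = x₂ - (27 : ℂ) • w := by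
    have h := mX x₂ sx₂
    rw [qx₂] at h
    rw [← bm, leibniz_lie, dm, db, lie_neg, lie_smul, bx₃, neg_lie, smul_lie,
      lie_eq_neg_of_lie_eq h]
    module
  have βp : ⁅b + (3 : ℂ) • p, p⁆ = 0 := by rw [add_lie, smul_lie, bbm, lie_self]; module
  have βq : ⁅b + (3 : ℂ) • p, q⁆ = 0 := by rw [add_lie, smul_lie, bq, pq]; module
  have βa : ⁅b + (3 : ℂ) • p, a⁆ = s := by
    rw [add_lie, smul_lie, pa, lie_eq_neg_of_lie_eq ab, hs]; module
  have βX : ∀ X : L, ⁅s, X⁆ = 0 → ⁅b + (3 : ℂ) • p, X⁆ = 0 → ⁅b + (3 : ℂ) • p, ⁅a, X⁆⁆ = 0 :=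
    fun X hX h => by rw [leibniz_lie, βa, hX, h, lie_zero, add_zero]
  have βx₁ : ⁅b + (3 : ℂ) • p, x₁⁆ = 0 := aq ▸ βX q sq βq
  have βx₂ : ⁅b + (3 : ℂ) • p, x₂⁆ = 0 := ax₁ ▸ βX x₁ sx₁ βx₁
  have βw : ⁅b + (3 : ℂ) • p, w⁆ = 0 :=
    av ▸ βX v sv (qx₁ ▸ lie_lie_eq_zero_of_commute βq βx₁)
  have βD : ⁅b + (3 : ℂ) • p, x₂ - (27 : ℂ) • w⁆ = 0 := by
    rw [lie_sub, lie_smul, βx₂, βw, smul_zero, sub_zero]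
  have βd : ⁅b + (3 : ℂ) • p, d⁆ = (81 : ℂ) • w := by
    rw [add_lie, smul_lie, bd, lie_eq_neg_of_lie_eq dp]; module
  -- `b + 3p` commutes with `[d, p]` and `[d, q]`, so its bracket with `d` commutes with `p` and `q`
  have wp : ⁅w, p⁆ = 0 := by
    have h := leibniz_lie (b + (3 : ℂ) • p) d p
    rw [dp, βD, βd, βp, lie_zero, add_zero, smul_lie] at h
    exact smul_eq_zero_of_ne (by norm_num) h.symm
  have wq : ⁅w, q⁆ = 0 := by
    have h := leibniz_lie (b + (3 : ℂ) • p) d q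
    have dq : ⁅d, q⁆ = ⁅a, x₂ - (27 : ℂ) • w⁆ := by
      rw [← ap, leibniz_lie, da, zero_lie, zero_add, dp]
    rw [dq, βX _ (by rw [lie_sub, lie_smul, sx₂, sw, smul_zero, sub_zero]) βD, βd, βq, lie_zero,
      add_zero, smul_lie] at h
    exact smul_eq_zero_of_ne (by norm_num) h.symm
  have qv : ⁅q, v⁆ = (1 / 81 : ℂ) • x₁ := by
    have h := leibniz_lie p a v
    rw [av, pa, pv, lie_smul, aq, lie_eq_neg_of_lie_eq wp, neg_lie] at h
    linear_combination (norm := module) h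
  exact ⟨⟨sa, sb, cds, cp, am⟩, ⟨qp, px₁, by rw [lie_eq_neg_of_lie_eq wq, neg_zero], pv, qv⟩,
    ⟨βp, βq, βa, βd⟩, dp⟩

/-- The brackets in `sl₂ ⊗ ℂ[λ]` that follow from those defining `h₁ = λ h`, `y₁ = λ y` and
`z₂ = λ² z`. The relations `⁅y, y₁⁆ = 0` and `⁅z₁, z₂⁆ = 0` of `CurrentTriple` are not needed for
them, which allows their use before these two are known. -/
theorem CurrentTriple.derived_brackets {h y z h₁ z₁ y₁ z₂ : L}
    (hy : ⁅h, y⁆ = (2 : ℂ) • y) (yz : ⁅y, z⁆ = h)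
    (hz₁ : ⁅h, z₁⁆ = -((2 : ℂ) • z₁)) (zz₁ : ⁅z, z₁⁆ = 0) (yz₁ : ⁅y, z₁⁆ = h₁)
    (h₁y : ⁅h₁, y⁆ = (2 : ℂ) • y₁) (h₁z₁ : ⁅h₁, z₁⁆ = -((2 : ℂ) • z₂)) :
    ⁅h, h₁⁆ = 0 ∧ ⁅h₁, z⁆ = -((2 : ℂ) • z₁) ∧ ⁅y₁, z⁆ = h₁ ∧ ⁅z, z₂⁆ = 0 ∧
      ⁅h, y₁⁆ = (2 : ℂ) • y₁ ∧ ⁅h, z₂⁆ = -((2 : ℂ) • z₂) := by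
  have hh₁ : ⁅h, h₁⁆ = 0 := by
    rw [← yz₁, leibniz_lie, hy, hz₁, smul_lie, lie_neg, lie_smul, add_neg_cancel]
  have h₁z : ⁅h₁, z⁆ = -((2 : ℂ) • z₁) := by
    rw [← yz₁, lie_lie, yz, lie_eq_neg_of_lie_eq zz₁, lie_eq_neg_of_lie_eq hz₁, neg_zero, lie_zero,
      neg_neg, zero_sub]
  have hy₁ : ⁅h, y₁⁆ = (2 : ℂ) • y₁ := by
    have h0 := leibniz_lie h h₁ y
    rw [h₁y, hh₁, hy, lie_smul, lie_smul, h₁y, zero_lie] at h0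
    linear_combination (norm := module) (1 / 2 : ℂ) • h0
  have hz₂ : ⁅h, z₂⁆ = -((2 : ℂ) • z₂) := by
    have h0 := leibniz_lie h h₁ z₁
    rw [h₁z₁, hh₁, hz₁, lie_neg, lie_neg, lie_smul, lie_smul, h₁z₁, zero_lie] at h0
    linear_combination (norm := module) (-1 / 2 : ℂ) • h0
  have y₁z : ⁅y₁, z⁆ = h₁ := by
    have h0 := leibniz_lie h₁ y z
    rw [yz, h₁y, h₁z, lie_eq_neg_of_lie_eq hh₁, lie_neg, lie_smul, yz₁, smul_lie] at h0
    linear_combination (norm := module) (-1 / 2 : ℂ) • h0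
  have zz₂ : ⁅z, z₂⁆ = 0 := by
    have h0 := leibniz_lie h₁ z z₁
    rw [zz₁, h₁z, h₁z₁, lie_neg, lie_smul, neg_lie, smul_lie, lie_self, lie_zero] at h0
    linear_combination (norm := module) (1 / 2 : ℂ) • h0
  exact ⟨hh₁, h₁z, y₁z, zz₂, hy₁, hz₂⟩

/-- The brackets of the Heisenberg algebra, for five elements `r₋₂, …, r₂` indexed by `0, …, 4`. -/
structure HeisenbergRelations (r : Fin 5 → L) : Prop where
  r01 : ⁅r 0, r 1⁆ = 0
  r02 : ⁅r 0, r 2⁆ = 0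
  r03 : ⁅r 0, r 3⁆ = 0
  r04 : ⁅r 0, r 4⁆ = -r 2
  r12 : ⁅r 1, r 2⁆ = 0
  r13 : ⁅r 1, r 3⁆ = r 2
  r14 : ⁅r 1, r 4⁆ = 0
  r23 : ⁅r 2, r 3⁆ = 0
  r24 : ⁅r 2, r 4⁆ = 0
  r34 : ⁅r 3, r 4⁆ = 0

/-- The relations of the zero-curvature equation force the coefficients `a, 3b, 3c, d` to have the
form `r₁ - ½ y + ½ λ z`, `r₋₁ + z`, `r₋₂`, `-r₂ + ½ (λ y - λ² z)`. The last conjunct, a relation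
between `a` and `b` alone, bounds the order of Miura type transformations. -/
theorem KdVRelations.decomposition {a b c d : L} (H : KdVRelations a b c d) :
    ∃ (r : Fin 5 → L) (h y z h₁ z₁ y₁ z₂ : L), CurrentTriple h y z h₁ z₁ y₁ z₂ ∧
      HeisenbergRelations r ∧
      (∀ i, ⁅r i, y⁆ = 0 ∧ ⁅r i, z⁆ = 0 ∧ ⁅r i, z₁⁆ = 0) ∧
      a = r 3 - (1 / 2 : ℂ) • y + (1 / 2 : ℂ) • z₁ ∧ (3 : ℂ) • b = r 1 + z ∧ (3 : ℂ) • c = r 0 ∧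
      d = -r 4 + (1 / 2 : ℂ) • (y₁ - z₂) ∧
      ⁅a, ⁅a, ⁅a, b⁆⁆⁆ = -((9 : ℂ) • ⁅⁅⁅a, b⁆, ⁅a, ⁅a, b⁆⁆⁆, ⁅a, ⁅a, b⁆⁆⁆) := by
  obtain ⟨m, ab⟩ : ∃ m, ⁅a, b⁆ = m := ⟨_, rfl⟩
  obtain ⟨p, bm⟩ : ∃ p, ⁅b, m⁆ = p := ⟨_, rfl⟩
  obtain ⟨q, ap⟩ : ∃ q, ⁅a, p⁆ = q := ⟨_, rfl⟩
  obtain ⟨x₁, aq⟩ : ∃ x, ⁅a, q⁆ = x := ⟨_, rfl⟩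
  obtain ⟨x₂, ax₁⟩ : ∃ x, ⁅a, x₁⁆ = x := ⟨_, rfl⟩
  obtain ⟨v, qx₁⟩ : ∃ v, ⁅q, x₁⁆ = v := ⟨_, rfl⟩
  obtain ⟨w, av⟩ : ∃ w, ⁅a, v⁆ = w := ⟨_, rfl⟩
  obtain ⟨s, hs⟩ : ∃ s, s = -((3 : ℂ) • q) - m := ⟨_, rfl⟩
  obtain ⟨⟨sa, sb, cds, cp, am⟩, ⟨qp, px₁, qw, pv, qv⟩, ⟨βp, βq, βa, βd⟩, dp⟩ :=
    H.basic_brackets ab bm ap hs aq ax₁ qx₁ av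
  obtain ⟨ac, bc, ad, -, -, -⟩ := H
  have ca : ⁅c, a⁆ = 0 := by rw [lie_eq_neg_of_lie_eq ac, neg_zero]
  have cb : ⁅c, b⁆ = 0 := by rw [lie_eq_neg_of_lie_eq bc, neg_zero]
  have da : ⁅d, a⁆ = 0 := by rw [lie_eq_neg_of_lie_eq ad, neg_zero]
  -- the triple `h, y, z, λ z` in terms of `q, p, x₁, v`
  obtain ⟨h, hh⟩ : ∃ h, h = (18 : ℂ) • q := ⟨_, rfl⟩
  obtain ⟨z, hzd⟩ : ∃ z, z = -((9 : ℂ) • p) := ⟨_, rfl⟩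
  obtain ⟨y, hyd⟩ : ∃ y, y = (9 : ℂ) • x₁ + (81 : ℂ) • v := ⟨_, rfl⟩
  obtain ⟨z₁, hz₁d⟩ : ∃ z₁, z₁ = (9 : ℂ) • x₁ - (81 : ℂ) • v := ⟨_, rfl⟩
  have hy : ⁅h, y⁆ = (2 : ℂ) • y := by
    rw [hh, hyd, lie_add, lie_smul, lie_smul, smul_lie, smul_lie, qx₁, qv]; module
  have hz₁ : ⁅h, z₁⁆ = -((2 : ℂ) • z₁) := by
    rw [hh, hz₁d, lie_sub, lie_smul, lie_smul, smul_lie, smul_lie, qx₁, qv]; module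
  have hz : ⁅h, z⁆ = -((2 : ℂ) • z) := by
    rw [hh, hzd, lie_neg, lie_smul, smul_lie, qp]; module
  have zz₁ : ⁅z, z₁⁆ = 0 := by
    rw [hzd, hz₁d, neg_lie, lie_sub, lie_smul, lie_smul, smul_lie, smul_lie, px₁, pv]; module
  have yz : ⁅y, z⁆ = h := by
    rw [← lie_skew, hzd, hyd, neg_lie, lie_add, lie_smul, lie_smul, smul_lie, smul_lie, px₁, pv, hh]
    module
  -- `ρ = a + 81 v` commutes with `z` and `h`; as `⁅ρ, y - z₁⁆` is a multiple of `w`, which commutes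
  -- with `h`, the two weight components `⁅ρ, y⁆` and `⁅ρ, z₁⁆` vanish, and so does `w`
  obtain ⟨ρ, hρ⟩ : ∃ ρ, ρ = a + (81 : ℂ) • v := ⟨_, rfl⟩
  have ρz : ⁅ρ, z⁆ = 0 := by
    rw [hρ, hzd, lie_neg, lie_smul, add_lie, smul_lie, ap, lie_eq_neg_of_lie_eq pv]; module
  have ρh : ⁅ρ, h⁆ = 0 := by
    rw [hρ, hh, lie_smul, add_lie, smul_lie, aq, lie_eq_neg_of_lie_eq qv]; module
  have hρ0 : ⁅h, ρ⁆ = 0 := by rw [lie_eq_neg_of_lie_eq ρh, neg_zero]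
  have ρw : ⁅ρ, v⁆ = w := by rw [hρ, add_lie, smul_lie, lie_self, smul_zero, add_zero, av]
  obtain ⟨ρy, ρz₁⟩ : ⁅ρ, y⁆ = 0 ∧ ⁅ρ, z₁⁆ = 0 := by
    refine eq_zero_of_add_eq_zero_of_weight (h := h) (c := 2) two_ne_zero ?_ ?_ ?_
    · rw [leibniz_lie, hρ0, zero_lie, zero_add, hy, lie_smul]
    · rw [leibniz_lie, hρ0, zero_lie, zero_add, hz₁, lie_neg, lie_smul]
    · have e1 : ⁅h, ⁅ρ, y - z₁⁆⁆ = 0 := by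
        rw [hyd, hz₁d, hh, show (9 : ℂ) • x₁ + (81 : ℂ) • v - ((9 : ℂ) • x₁ - (81 : ℂ) • v)
          = (162 : ℂ) • v by module, lie_smul, ρw, lie_smul, smul_lie, qw, smul_zero, smul_zero]
      rw [leibniz_lie, hρ0, zero_lie, zero_add, lie_sub h y, hy, hz₁, lie_sub, lie_neg, lie_smul,
        lie_smul] at e1
      linear_combination (norm := module) (1 / 2 : ℂ) • e1
  have w0 : w = 0 := by
    have h1 : ⁅ρ, y - z₁⁆ = (162 : ℂ) • w := by
      rw [hyd, hz₁d, show (9 : ℂ) • x₁ + (81 : ℂ) • v - ((9 : ℂ) • x₁ - (81 : ℂ) • v)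
        = (162 : ℂ) • v by module, lie_smul, ρw]
    rw [lie_sub, ρy, ρz₁, sub_zero] at h1
    exact smul_eq_zero_of_ne (by norm_num) h1.symm
  subst w0
  rw [smul_zero] at βd
  rw [smul_zero, sub_zero] at dp
  obtain ⟨h₁, yz₁⟩ : ∃ h₁, ⁅y, z₁⁆ = h₁ := ⟨_, rfl⟩
  obtain ⟨y₁, h₁y⟩ : ∃ y₁, ⁅h₁, y⁆ = (2 : ℂ) • y₁ := ⟨(1 / 2 : ℂ) • ⁅h₁, y⁆, by module⟩
  obtain ⟨z₂, h₁z₁⟩ : ∃ z₂, ⁅h₁, z₁⁆ = -((2 : ℂ) • z₂) := ⟨-((1 / 2 : ℂ) • ⁅h₁, z₁⁆), by module⟩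
  obtain ⟨-, -, y₁z, zz₂, hy₁, hz₂⟩ := CurrentTriple.derived_brackets hy yz hz₁ zz₁ yz₁ h₁y h₁z₁
  have key : ∀ {g : L}, ⁅g, y⁆ = 0 → ⁅g, z₁⁆ = 0 → ⁅g, h₁⁆ = 0 ∧ ⁅g, y₁⁆ = 0 ∧ ⁅g, z₂⁆ = 0 := by
    intro g gy gz₁
    have gh₁ : ⁅g, h₁⁆ = 0 := yz₁ ▸ lie_lie_eq_zero_of_commute gy gz₁
    refine ⟨gh₁, ?_, ?_⟩
    · have h0 := lie_lie_eq_zero_of_commute gh₁ gy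
      rw [h₁y, lie_smul] at h0
      exact smul_eq_zero_of_ne two_ne_zero h0
    · have h0 := lie_lie_eq_zero_of_commute gh₁ gz₁
      rw [h₁z₁, lie_neg, lie_smul, neg_eq_zero] at h0
      exact smul_eq_zero_of_ne two_ne_zero h0
  obtain ⟨ρh₁, ρy₁, ρz₂⟩ := key ρy ρz₁
  have ha : a = ρ - (1 / 2 : ℂ) • y + (1 / 2 : ℂ) • z₁ := by rw [hρ, hyd, hz₁d]; module
  have aX : ∀ X : L, ⁅ρ, X⁆ = 0 → ⁅a, X⁆ = (1 / 2 : ℂ) • ⁅z₁, X⁆ - (1 / 2 : ℂ) • ⁅y, X⁆ := by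
    intro X hX
    rw [ha, add_lie, sub_lie, smul_lie, smul_lie, hX]; abel
  have h18 : (18 : ℂ) • x₁ = y + z₁ := by rw [hyd, hz₁d]; module
  have h18' : (18 : ℂ) • x₂ = -h₁ := by
    rw [← ax₁, ← lie_smul, h18, aX _ (by rw [lie_add, ρy, ρz₁, add_zero]), lie_add, lie_add,
      lie_self, lie_self, yz₁, lie_eq_neg_of_lie_eq yz₁]
    module
  have dz : ⁅d, z⁆ = (1 / 2 : ℂ) • h₁ := by
    rw [hzd, lie_neg, lie_smul, dp]
    linear_combination (norm := module) (-1 / 2 : ℂ) • h18'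
  have dh : ⁅d, h⁆ = -y₁ - z₂ := by
    rw [hh, lie_smul, ← ap, leibniz_lie, da, zero_lie, zero_add, dp, ← lie_smul, h18', lie_neg,
      aX _ ρh₁, lie_eq_neg_of_lie_eq h₁y, lie_eq_neg_of_lie_eq h₁z₁]
    module
  have dyz : ⁅d, y + z₁⁆ = -((1 / 2 : ℂ) • ⁅z₁, y₁ + z₂⁆) + (1 / 2 : ℂ) • ⁅y, y₁ + z₂⁆ := by
    have e : y + z₁ = ⁅a, h⁆ := by rw [hh, lie_smul, aq, h18]
    rw [e, leibniz_lie, da, zero_lie, zero_add, dh, show -y₁ - z₂ = -(y₁ + z₂) by abel, lie_neg,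
      aX _ (by rw [lie_add, ρy₁, ρz₂, add_zero])]
    module
  -- `τ = d - ½ (y₁ - z₂)` commutes with `z` and `h`; the components of weights `±2, ±4` of
  -- the formula for `⁅d, y + z₁⁆` give its brackets with `y, z₁` and the last two relations
  obtain ⟨τ, hτ⟩ : ∃ τ, τ = d - (1 / 2 : ℂ) • (y₁ - z₂) := ⟨_, rfl⟩
  have τz : ⁅τ, z⁆ = 0 := by
    rw [hτ, sub_lie, smul_lie, sub_lie, dz, y₁z, lie_eq_neg_of_lie_eq zz₂]; module
  have τh : ⁅τ, h⁆ = 0 := by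
    rw [hτ, sub_lie, smul_lie, sub_lie, dh, lie_eq_neg_of_lie_eq hy₁, lie_eq_neg_of_lie_eq hz₂]
    module
  have hτ0 : ⁅h, τ⁆ = 0 := by rw [lie_eq_neg_of_lie_eq τh, neg_zero]
  obtain ⟨τy, τz₁, yy₁, z₁z₂⟩ : ⁅τ, y⁆ = 0 ∧ ⁅τ, z₁⁆ = 0 ∧ ⁅y, y₁⁆ = 0 ∧ ⁅z₁, z₂⁆ = 0 := by
    refine eq_zero_of_add_eq_zero_of_four_weights (h := h) ?_ ?_ ?_ ?_ ?_
    · rw [leibniz_lie, hτ0, zero_lie, zero_add, hy, lie_smul]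
    · rw [leibniz_lie, hτ0, zero_lie, zero_add, hz₁, lie_neg, lie_smul]
    · rw [leibniz_lie, hy, hy₁, smul_lie, lie_smul]; module
    · rw [leibniz_lie, hz₁, hz₂, neg_lie, lie_neg, smul_lie, lie_smul]; module
    · have e : ⁅τ, y⁆ + ⁅τ, z₁⁆ = ⁅τ, y + z₁⁆ := (lie_add _ _ _).symm
      rw [e, hτ, sub_lie, dyz]
      simp only [lie_add, smul_lie, sub_lie]
      rw [← lie_skew y y₁, ← lie_skew y z₂, ← lie_skew z₁ y₁, ← lie_skew z₁ z₂]
      module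
  -- the remaining brackets with `c`, `β = b + 3p` and `s`
  have comm : ∀ {g : L}, ⁅g, a⁆ = 0 → ⁅g, p⁆ = 0 → ⁅g, y⁆ = 0 ∧ ⁅g, z⁆ = 0 ∧ ⁅g, z₁⁆ = 0 := by
    intro g ga gp
    have gq : ⁅g, q⁆ = 0 := ap ▸ lie_lie_eq_zero_of_commute ga gp
    have gx₁ : ⁅g, x₁⁆ = 0 := aq ▸ lie_lie_eq_zero_of_commute ga gq
    have gv : ⁅g, v⁆ = 0 := qx₁ ▸ lie_lie_eq_zero_of_commute gq gx₁
    refine ⟨?_, ?_, ?_⟩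
    · rw [hyd, lie_add, lie_smul, lie_smul, gx₁, gv, smul_zero, smul_zero, add_zero]
    · rw [hzd, lie_neg, lie_smul, gp, smul_zero, neg_zero]
    · rw [hz₁d, lie_sub, lie_smul, lie_smul, gx₁, gv, smul_zero, smul_zero, sub_zero]
  have sm : ⁅s, m⁆ = 0 := ab ▸ lie_lie_eq_zero_of_commute sa sb
  have sp : ⁅s, p⁆ = 0 := bm ▸ lie_lie_eq_zero_of_commute sb sm
  obtain ⟨sy, sz, sz₁⟩ := comm sa sp
  obtain ⟨cy, cz, cz₁⟩ := comm ca cp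
  have sq : ⁅s, q⁆ = 0 := ap ▸ lie_lie_eq_zero_of_commute sa sp
  have βx₁ : ⁅b + (3 : ℂ) • p, x₁⁆ = 0 := by
    rw [← aq, leibniz_lie, βa, sq, βq, lie_zero, add_zero]
  have βv : ⁅b + (3 : ℂ) • p, v⁆ = 0 := qx₁ ▸ lie_lie_eq_zero_of_commute βq βx₁
  have βy : ⁅b + (3 : ℂ) • p, y⁆ = 0 := by
    rw [hyd, lie_add, lie_smul, lie_smul, βx₁, βv, smul_zero, smul_zero, add_zero]
  have βz₁ : ⁅b + (3 : ℂ) • p, z₁⁆ = 0 := by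
    rw [hz₁d, lie_sub, lie_smul, lie_smul, βx₁, βv, smul_zero, smul_zero, sub_zero]
  have βz : ⁅b + (3 : ℂ) • p, z⁆ = 0 := by rw [hzd, lie_neg, lie_smul, βp, smul_zero, neg_zero]
  have βc : ⁅c, b + (3 : ℂ) • p⁆ = 0 := by rw [lie_add, lie_smul, cb, cp, smul_zero, add_zero]
  have βs : ⁅s, b + (3 : ℂ) • p⁆ = 0 := by rw [lie_add, lie_smul, sb, sp, smul_zero, add_zero]
  have sc : ⁅c, s⁆ = 0 := by
    have cq : ⁅c, q⁆ = 0 := ap ▸ lie_lie_eq_zero_of_commute ca cp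
    have cm : ⁅c, m⁆ = 0 := ab ▸ lie_lie_eq_zero_of_commute ca cb
    rw [hs, lie_sub, lie_neg, lie_smul, cq, cm, smul_zero, neg_zero, sub_zero]
  have sd : ⁅s, d⁆ = 0 := by
    rw [← βa, lie_lie, ad, βd, lie_zero, lie_zero, sub_zero]
  have eτ : ∀ {g : L}, ⁅g, y⁆ = 0 → ⁅g, z₁⁆ = 0 → ⁅g, τ⁆ = ⁅g, d⁆ := by
    intro g gy gz₁
    obtain ⟨-, gy₁, gz₂⟩ := key gy gz₁
    rw [hτ, lie_sub, lie_smul, lie_sub, gy₁, gz₂, sub_zero, smul_zero, sub_zero]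
  have eρ : ∀ {g : L}, ⁅g, y⁆ = 0 → ⁅g, z₁⁆ = 0 → ⁅g, ρ⁆ = ⁅g, a⁆ := by
    intro g gy gz₁
    rw [ha, lie_add, lie_sub, lie_smul, lie_smul, gy, gz₁, smul_zero, sub_zero, add_zero]
  have ρτ : ⁅ρ, τ⁆ = 0 := by
    have h2 : ⁅a, τ⁆ = -⁅τ, ρ⁆ := by rw [eρ τy τz₁, lie_skew]
    rw [hτ, lie_sub, ad, lie_smul, aX _ (by rw [lie_sub, ρy₁, ρz₂, sub_zero]), lie_sub, lie_sub,
      yy₁, z₁z₂, lie_skew] at h2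
    have h3 : ⁅z₁, y₁⁆ = -⁅y, z₂⁆ := by
      have h4 := leibniz_lie h₁ y z₁
      rw [yz₁, lie_self, h₁y, h₁z₁, smul_lie, lie_neg, lie_smul, ← lie_skew] at h4
      linear_combination (norm := module) (1 / 2 : ℂ) • h4
    rw [hτ, ← h2, h3]
    module
  refine ⟨![(3 : ℂ) • c, (3 : ℂ) • (b + (3 : ℂ) • p), (3 : ℂ) • s, ρ, -τ], h, y, z, h₁, z₁, y₁, z₂,
    ⟨hy, hz, yz, hz₁, zz₁, yz₁, h₁y, h₁z₁, yy₁, z₁z₂⟩, ⟨?_, ?_, ?_, ?_, ?_, ?_, ?_, ?_, ?_, ?_⟩,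
    ?_, ha, ?_, rfl, ?_, ?_⟩
  · show ⁅(3 : ℂ) • c, (3 : ℂ) • (b + (3 : ℂ) • p)⁆ = 0
    rw [lie_smul, smul_lie, βc, smul_zero, smul_zero]
  · show ⁅(3 : ℂ) • c, (3 : ℂ) • s⁆ = 0
    rw [lie_smul, smul_lie, sc, smul_zero, smul_zero]
  · show ⁅(3 : ℂ) • c, ρ⁆ = 0
    rw [smul_lie, eρ cy cz₁, ca, smul_zero]
  · show ⁅(3 : ℂ) • c, -τ⁆ = -((3 : ℂ) • s)
    rw [smul_lie, lie_neg, eτ cy cz₁, cds, smul_neg]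
  · show ⁅(3 : ℂ) • (b + (3 : ℂ) • p), (3 : ℂ) • s⁆ = 0
    rw [lie_smul, smul_lie, lie_eq_neg_of_lie_eq βs, neg_zero, smul_zero, smul_zero]
  · show ⁅(3 : ℂ) • (b + (3 : ℂ) • p), ρ⁆ = (3 : ℂ) • s
    rw [smul_lie, eρ βy βz₁, βa]
  · show ⁅(3 : ℂ) • (b + (3 : ℂ) • p), -τ⁆ = 0
    rw [smul_lie, lie_neg, eτ βy βz₁, βd, neg_zero, smul_zero]
  · show ⁅(3 : ℂ) • s, ρ⁆ = 0
    rw [smul_lie, eρ sy sz₁, sa, smul_zero]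
  · show ⁅(3 : ℂ) • s, -τ⁆ = 0
    rw [smul_lie, lie_neg, eτ sy sz₁, sd, neg_zero, smul_zero]
  · show ⁅ρ, -τ⁆ = 0
    rw [lie_neg, ρτ, neg_zero]
  · intro i
    fin_cases i
    · exact ⟨by simp [cy], by simp [cz], by simp [cz₁]⟩
    · exact ⟨by simp only [Fin.mk_one, Matrix.cons_val_one, Matrix.cons_val_zero,
          smul_lie, βy, smul_zero],
        by simp only [Fin.mk_one, Matrix.cons_val_one, Matrix.cons_val_zero,
          smul_lie, βz, smul_zero],
        by simp only [Fin.mk_one, Matrix.cons_val_one, Matrix.cons_val_zero,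
          smul_lie, βz₁, smul_zero]⟩
    · exact ⟨by simp [sy], by simp [sz], by simp [sz₁]⟩
    · exact ⟨by simp [ρy], by simp [ρz], by simp [ρz₁]⟩
    · exact ⟨by simp [τy], by simp [τz], by simp [τz₁]⟩
  · show (3 : ℂ) • b = (3 : ℂ) • (b + (3 : ℂ) • p) + z
    rw [hzd]; module
  · show d = - -τ + (1 / 2 : ℂ) • (y₁ - z₂)
    rw [hτ]; module
  · have h1 : ⁅ρ, x₁⁆ = 0 := by
      have h2 := congrArg (fun t => ⁅ρ, t⁆) h18
      simp only [lie_smul, lie_add, ρy, ρz₁, add_zero] at h2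
      exact smul_eq_zero_of_ne (by norm_num) h2
    have h3 : ⁅a, x₁⁆ = -((81 : ℂ) • ⁅v, x₁⁆) := by
      rw [hρ, add_lie, smul_lie] at h1
      linear_combination (norm := module) h1
    have mx : ⁅m, x₁⁆ = -((3 : ℂ) • v) := by
      have h4 : m = -((3 : ℂ) • q) - s := by rw [hs]; abel
      rw [h4, sub_lie, neg_lie, smul_lie, qx₁, ← aq, lie_lie_eq_zero_of_commute sa sq, sub_zero]
    rw [ab, am, lie_neg, lie_neg, lie_smul, lie_smul, lie_neg, lie_smul, neg_lie, smul_lie, mx, h3,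
      neg_lie, smul_lie]
    module

end Relations
end KdVMiura

namespace KdVMiura

/-! ### The presentation of the current algebra -/

section Current

variable {L : Type*} [LieRing L] [LieAlgebra ℂ L]

/-- The brackets of `sl₂ ⊗ ℂ[λ]`, for elements `Y n, Z n, K n` that stand for
`λⁿ y, λⁿ z, λⁿ h`. -/
structure CurrentRelations (Y Z K : ℕ → L) : Prop where
  yz : ∀ a b, ⁅Y a, Z b⁆ = K (a + b)
  ky : ∀ a b, ⁅K a, Y b⁆ = (2 : ℂ) • Y (a + b)
  kz : ∀ a b, ⁅K a, Z b⁆ = -((2 : ℂ) • Z (a + b))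
  kk : ∀ a b, ⁅K a, K b⁆ = 0
  yy : ∀ a b, ⁅Y a, Y b⁆ = 0
  zz : ∀ a b, ⁅Z a, Z b⁆ = 0

/-- If `k` shifts the sequence `Y` and commutes with `g`, then the action of `g` on `Y` is
determined by its action on `Y 0`. -/
theorem lie_shift_of_commute {k g : L} {Y : ℕ → L} {c e : ℂ} (hc : c ≠ 0)
    (hY : ∀ n, ⁅k, Y n⁆ = c • Y (n + 1)) (hg : ⁅k, g⁆ = 0) {m : ℕ}
    (h0 : ⁅g, Y 0⁆ = e • Y m) (n : ℕ) : ⁅g, Y n⁆ = e • Y (m + n) := by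
  induction n with
  | zero => simpa using h0
  | succ n ih =>
    have h1 := leibniz_lie k g (Y n)
    rw [ih, hg, zero_lie, zero_add, hY, lie_smul, lie_smul, hY] at h1
    have h2 : c • (⁅g, Y (n + 1)⁆ - e • Y (m + (n + 1))) = 0 := by
      rw [smul_sub, ← h1, ← add_assoc, smul_comm, sub_self]
    exact sub_eq_zero.mp (smul_eq_zero_of_ne hc h2)

/-- If `k` and `k₂` act on `Y` as the shift and its square, all `Y n` commute: in each degree, the
shift determines all brackets up to sign by one of them, which vanishes by antisymmetry in even
degrees; in odd degrees the square of the shift gives an opposite sign. -/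
theorem commute_of_shift {k k₂ : L} {Y : ℕ → L} {c : ℂ} (hc : c ≠ 0)
    (hY : ∀ n, ⁅k, Y n⁆ = c • Y (n + 1)) (hY₂ : ∀ n, ⁅k₂, Y n⁆ = c • Y (n + 2))
    (h01 : ⁅Y 0, Y 1⁆ = 0) : ∀ N a b, a + b = N → ⁅Y a, Y b⁆ = 0 := by
  have step : ∀ N, (∀ a b, a + b = N → ⁅Y a, Y b⁆ = 0) →
      ∀ a b, a + b = N → ⁅Y (a + 1), Y b⁆ = -⁅Y a, Y (b + 1)⁆ := by
    intro N hN a b hab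
    have h1 := leibniz_lie k (Y a) (Y b)
    rw [hN a b hab, lie_zero, hY, hY, smul_lie, lie_smul, ← smul_add] at h1
    exact eq_neg_of_add_eq_zero_left (smul_eq_zero_of_ne hc h1.symm)
  have step₂ : ∀ N, (∀ a b, a + b = N → ⁅Y a, Y b⁆ = 0) →
      ∀ a b, a + b = N → ⁅Y (a + 2), Y b⁆ = -⁅Y a, Y (b + 2)⁆ := by
    intro N hN a b hab
    have h1 := leibniz_lie k₂ (Y a) (Y b)
    rw [hN a b hab, lie_zero, hY₂, hY₂, smul_lie, lie_smul, ← smul_add] at h1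
    exact eq_neg_of_add_eq_zero_left (smul_eq_zero_of_ne hc h1.symm)
  intro N
  induction N using Nat.strong_induction_on with
  | _ N ih =>
    match N, ih with
    | 0, _ =>
      intro a b hab
      obtain ⟨rfl, rfl⟩ : a = 0 ∧ b = 0 := by omega
      exact lie_self _
    | 1, _ =>
      intro a b hab
      obtain ⟨rfl, rfl⟩ | ⟨rfl, rfl⟩ : (a = 0 ∧ b = 1) ∨ (a = 1 ∧ b = 0) := by omega
      · exact h01
      · rw [← lie_skew, h01, neg_zero]
    | N + 2, ih =>
      have s1 := step (N + 1) (ih (N + 1) (by omega))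
      have s2 := step₂ N (ih N (by omega))
      have e0 : ∀ b, b = N → ⁅Y 0, Y (b + 2)⁆ = 0 := by
        intro b hb
        have h1 := s1 1 b (by omega)
        have h2 := s1 0 (b + 1) (by omega)
        have h3 := s2 0 b (by omega)
        simp only [zero_add, add_assoc, Nat.reduceAdd] at h1 h2 h3
        rw [h1, h2] at h3
        have h4 : (2 : ℂ) • ⁅Y 0, Y (b + 2)⁆ = 0 := by
          linear_combination (norm := module) h3
        exact smul_eq_zero_of_ne two_ne_zero h4
      intro a
      induction a with
      | zero =>
        intro b hab
        obtain rfl : b = N + 2 := by omega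
        exact e0 N rfl
      | succ a iha =>
        intro b hab
        rw [s1 a b (by omega), iha (b + 1) (by omega), neg_zero]

/-- In one degree `N`: the elements `⁅Y a, Z (N - a)⁆` coincide for all `a` if `⁅k, K⁆ = 0` for
their analogue `K` in the previous degree. -/
theorem lie_eq_of_shift {k : L} {Y Z : ℕ → L} (hY : ∀ n, ⁅k, Y n⁆ = (2 : ℂ) • Y (n + 1))
    (hZ : ∀ n, ⁅k, Z n⁆ = -((2 : ℂ) • Z (n + 1))) {N : ℕ} {K : L} (hk : ⁅k, K⁆ = 0)
    (hN : ∀ a b, a + b = N → ⁅Y a, Z b⁆ = K) :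
    ∀ b a, a + b = N + 1 → ⁅Y a, Z b⁆ = ⁅Y (N + 1), Z 0⁆ := by
  intro b
  induction b with
  | zero => intro a hab; rw [show a = N + 1 by omega]
  | succ b ih =>
    intro a hab
    have h1 := leibniz_lie k (Y a) (Z b)
    rw [hN a b (by omega), hk, hY, hZ, smul_lie, lie_neg, lie_smul,
      ih (a + 1) (by omega)] at h1
    have h2 : (2 : ℂ) • (⁅Y a, Z (b + 1)⁆ - ⁅Y (N + 1), Z 0⁆) = 0 := by
      linear_combination (norm := module) h1
    exact sub_eq_zero.mp (smul_eq_zero_of_ne two_ne_zero h2)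

/-- `λ h` commutes with `K = λᴺ h`: if `Δ` is their bracket, the elements `⁅Y a, Z (N + 1 - a)⁆`
form an arithmetic progression with difference `½ Δ`, and the bracket computed from
`λ h = ⁅λ y, z⁆` gives `-Δ = N Δ`. -/
theorem lie_shift_eq_zero {k : L} {Y Z : ℕ → L} (hY : ∀ n, ⁅k, Y n⁆ = (2 : ℂ) • Y (n + 1))
    (hZ : ∀ n, ⁅k, Z n⁆ = -((2 : ℂ) • Z (n + 1))) (hk : ⁅Y 1, Z 0⁆ = k) {N : ℕ} {K : L}
    (hN : ∀ a b, a + b = N → ⁅Y a, Z b⁆ = K)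
    (hKY : ⁅K, Y 1⁆ = (2 : ℂ) • Y (N + 1)) (hKZ : ⁅K, Z 0⁆ = -((2 : ℂ) • Z N)) :
    ⁅k, K⁆ = 0 := by
  have h1 : ∀ a b, a + b = N →
      ⁅k, K⁆ = (2 : ℂ) • ⁅Y (a + 1), Z b⁆ - (2 : ℂ) • ⁅Y a, Z (b + 1)⁆ := by
    intro a b hab
    rw [← hN a b hab, leibniz_lie, hY, hZ, smul_lie, lie_neg, lie_smul, sub_eq_add_neg]
  have h2 : ∀ a b, a + b = N + 1 →
      ⁅Y a, Z b⁆ = ⁅Y 0, Z (N + 1)⁆ + ((a : ℂ) / 2) • ⁅k, K⁆ := by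
    intro a
    induction a with
    | zero => intro b hb; rw [show b = N + 1 by omega]; simp
    | succ a ih =>
      intro b hb
      have h3 := h1 a b (by omega)
      rw [ih (b + 1) (by omega)] at h3
      push_cast
      linear_combination (norm := module) (-1 / 2 : ℂ) • h3
  have h3 : ⁅K, k⁆ = (2 : ℂ) • ⁅Y (N + 1), Z 0⁆ - (2 : ℂ) • ⁅Y 1, Z N⁆ := by
    rw [← hk, leibniz_lie, hKY, hKZ, smul_lie, lie_neg, lie_smul, sub_eq_add_neg]
  rw [h2 (N + 1) 0 (by omega), h2 1 N (by omega), ← lie_skew] at h3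
  have h4 : ((N : ℂ) + 1) • ⁅k, K⁆ = 0 := by
    push_cast at h3
    linear_combination (norm := module) -h3
  exact smul_eq_zero_of_ne (Nat.cast_add_one_ne_zero N) h4

/-- The sequences `λⁿ y, λⁿ z, λⁿ h` generated by a triple, as orbits of the shift `½ ad (λ h)`. -/
theorem CurrentTriple.exists_sequences {h y z h₁ z₁ y₁ z₂ : L}
    (T : CurrentTriple h y z h₁ z₁ y₁ z₂) : ∃ Y Z K : ℕ → L, CurrentRelations Y Z K ∧
      Y 0 = y ∧ Y 1 = y₁ ∧ Z 0 = z ∧ Z 1 = z₁ ∧ Z 2 = z₂ ∧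
      (∀ n, ⁅h₁, Y n⁆ = (2 : ℂ) • Y (n + 1)) ∧ (∀ n, ⁅h₁, Z n⁆ = -((2 : ℂ) • Z (n + 1))) := by
  obtain ⟨hh₁, h₁z, y₁z, zz₂, -, -⟩ :=
    CurrentTriple.derived_brackets T.hy T.yz T.hz₁ T.zz₁ T.yz₁ T.h₁y T.h₁z₁
  obtain ⟨Y, hY0, hY⟩ : ∃ Y : ℕ → L, Y 0 = y ∧ ∀ n, ⁅h₁, Y n⁆ = (2 : ℂ) • Y (n + 1) := by
    refine ⟨fun n => (fun t => (1 / 2 : ℂ) • ⁅h₁, t⁆)^[n] y, rfl, fun n => ?_⟩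
    simp only [Function.iterate_succ_apply']
    module
  obtain ⟨Z, hZ0, hZ⟩ : ∃ Z : ℕ → L, Z 0 = z ∧ ∀ n, ⁅h₁, Z n⁆ = -((2 : ℂ) • Z (n + 1)) := by
    refine ⟨fun n => (fun t => (-1 / 2 : ℂ) • ⁅h₁, t⁆)^[n] z, rfl, fun n => ?_⟩
    simp only [Function.iterate_succ_apply']
    module
  have hZ' : ∀ n, ⁅h₁, Z n⁆ = (-2 : ℂ) • Z (n + 1) := fun n => by rw [hZ]; module
  have hY1 : Y 1 = y₁ := by
    have h0 := hY 0
    rw [hY0, T.h₁y] at h0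
    linear_combination (norm := module) (-1 / 2 : ℂ) • h0
  have hZ1 : Z 1 = z₁ := by
    have h0 := hZ 0
    rw [hZ0, h₁z] at h0
    linear_combination (norm := module) (1 / 2 : ℂ) • h0
  have hZ2 : Z 2 = z₂ := by
    have h0 := hZ 1
    rw [hZ1, T.h₁z₁] at h0
    linear_combination (norm := module) (1 / 2 : ℂ) • h0
  have h10 : ⁅Y 1, Z 0⁆ = h₁ := by rw [hY1, hZ0, y₁z]
  have h₁h : ⁅h₁, h⁆ = 0 := by rw [lie_eq_neg_of_lie_eq hh₁, neg_zero]
  have hYn : ∀ n, ⁅h, Y n⁆ = (2 : ℂ) • Y n := fun n => by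
    simpa using lie_shift_of_commute (m := 0) two_ne_zero hY h₁h (by rw [hY0, T.hy]) n
  have hZn : ∀ n, ⁅h, Z n⁆ = (-2 : ℂ) • Z n := fun n => by
    simpa using lie_shift_of_commute (m := 0) (e := -2) (by norm_num) hZ' h₁h
      (by rw [hZ0, T.hz]; module) n
  -- the brackets in the degrees `1` and `2`
  have d1 : ∀ a b, a + b = 1 → ⁅Y a, Z b⁆ = h₁ := by
    intro a b hab
    obtain ⟨rfl, rfl⟩ | ⟨rfl, rfl⟩ : (a = 0 ∧ b = 1) ∨ (a = 1 ∧ b = 0) := by omega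
    · rw [hY0, hZ1, T.yz₁]
    · exact h10
  have d2 := lie_eq_of_shift hY hZ (lie_self h₁) d1
  have y01 : ⁅Y 0, Y 1⁆ = 0 := by rw [hY0, hY1, T.yy₁]
  have z01 : ⁅Z 0, Z 1⁆ = 0 := by rw [hZ0, hZ1, T.zz₁]
  have y02 : ⁅Y 0, Y 2⁆ = 0 := by
    have h0 := leibniz_lie h₁ (Y 0) (Y 1)
    rw [y01, lie_zero, hY, hY, smul_lie, lie_self, smul_zero, zero_add, lie_smul] at h0
    exact smul_eq_zero_of_ne two_ne_zero h0.symm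
  have z02 : ⁅Z 0, Z 2⁆ = 0 := by rw [hZ0, hZ2, zz₂]
  obtain ⟨K₂, hK₂⟩ : ∃ K, ⁅Y 2, Z 0⁆ = K := ⟨_, rfl⟩
  have d2' : ∀ a b, a + b = 2 → ⁅Y a, Z b⁆ = K₂ := fun a b hab => by rw [d2 b a hab, hK₂]
  have actY : ∀ {N j : ℕ} {K : L}, ⁅Y N, Z 0⁆ = K → ⁅Y j, Z 0⁆ = h₁ ∧ j = 1 ∨ j = 0 →
      ⁅Y N, Y j⁆ = 0 → ⁅K, Y j⁆ = (2 : ℂ) • Y (N + j) := by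
    intro N j K hK hj hN
    rw [← hK, lie_lie, hN, lie_zero, sub_zero]
    rcases hj with ⟨hj, rfl⟩ | rfl
    · rw [lie_eq_neg_of_lie_eq hj, lie_neg, lie_skew, hY]
    · rw [hY0, hZ0, lie_eq_neg_of_lie_eq T.yz, lie_neg, lie_skew, hYn, add_zero]
  have actZ : ∀ {N : ℕ} {K : L}, ⁅Y 0, Z N⁆ = K → ⁅Z 0, Z N⁆ = 0 →
      ⁅K, Z 0⁆ = -((2 : ℂ) • Z N) := by
    intro N K hK hN
    rw [← hK, lie_lie, lie_eq_neg_of_lie_eq hN, neg_zero, lie_zero, zero_sub, hY0, hZ0, T.yz,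
      lie_skew, hZn]
    module
  have K₂y : ⁅K₂, Y 0⁆ = (2 : ℂ) • Y 2 :=
    actY hK₂ (Or.inr rfl) (by rw [lie_eq_neg_of_lie_eq y02, neg_zero])
  have K₂z : ⁅K₂, Z 0⁆ = -((2 : ℂ) • Z 2) := actZ (d2' 0 2 rfl) z02
  -- `[λ y, λ² y] = 0` is the image of `[λ z, λ² z] = 0` under `(ad y)⁴`
  have y12 : ⁅Y 1, Y 2⁆ = 0 := by
    have A1 : ⁅Y 0, Z 1⁆ = h₁ := d1 0 1 rfl
    have A2 : ⁅Y 0, Z 2⁆ = K₂ := d2' 0 2 rfl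
    have A3 : ⁅Y 0, h₁⁆ = -((2 : ℂ) • Y 1) := lie_eq_neg_of_lie_eq (hY 0)
    have A4 : ⁅Y 0, K₂⁆ = -((2 : ℂ) • Y 2) := lie_eq_neg_of_lie_eq K₂y
    have e0 : ⁅Z 1, Z 2⁆ = 0 := by rw [hZ1, hZ2, T.z₁z₂]
    have e1 : ⁅h₁, Z 2⁆ + ⁅Z 1, K₂⁆ = 0 := by
      have := congrArg (fun t => ⁅Y 0, t⁆) e0
      simpa only [leibniz_lie (Y 0) (Z 1) (Z 2), A1, A2, lie_zero] using this
    have e2 : (2 : ℂ) • ⁅h₁, K₂⁆ - (2 : ℂ) • ⁅Y 1, Z 2⁆ - (2 : ℂ) • ⁅Z 1, Y 2⁆ = 0 := by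
      have := congrArg (fun t => ⁅Y 0, t⁆) e1
      simp only [lie_add, leibniz_lie (Y 0) h₁ (Z 2), leibniz_lie (Y 0) (Z 1) K₂, A1, A2, A3, A4,
        lie_zero, neg_lie, smul_lie, lie_neg, lie_smul] at this
      linear_combination (norm := module) this
    have e3 : (-6 : ℂ) • ⁅Y 1, K₂⁆ - (6 : ℂ) • ⁅h₁, Y 2⁆ = 0 := by
      have := congrArg (fun t => ⁅Y 0, t⁆) e2
      simp only [lie_sub, lie_smul, leibniz_lie (Y 0) h₁ K₂, leibniz_lie (Y 0) (Y 1) (Z 2),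
        leibniz_lie (Y 0) (Z 1) (Y 2), y01, y02, A1, A2, A3, A4, lie_zero, zero_lie, neg_lie,
        smul_lie, lie_neg] at this
      linear_combination (norm := module) this
    have e4 : (24 : ℂ) • ⁅Y 1, Y 2⁆ = 0 := by
      have := congrArg (fun t => ⁅Y 0, t⁆) e3
      simp only [lie_sub, lie_smul, leibniz_lie (Y 0) h₁ (Y 2), leibniz_lie (Y 0) (Y 1) K₂, y01,
        y02, A3, A4, lie_zero, zero_lie, neg_lie, smul_lie, lie_neg] at this
      linear_combination (norm := module) this
    exact smul_eq_zero_of_ne (by norm_num) e4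
  have K₂y₁ : ⁅K₂, Y 1⁆ = (2 : ℂ) • Y 3 :=
    actY hK₂ (Or.inl ⟨h10, rfl⟩) (by rw [lie_eq_neg_of_lie_eq y12, neg_zero])
  have h₁K₂ : ⁅h₁, K₂⁆ = 0 := lie_shift_eq_zero hY hZ h10 d2' K₂y₁ K₂z
  have yy : ∀ a b, ⁅Y a, Y b⁆ = 0 := fun a b =>
    commute_of_shift (k₂ := K₂) two_ne_zero hY
      (fun n => by rw [lie_shift_of_commute two_ne_zero hY h₁K₂ K₂y n, add_comm 2 n]) y01 _ a b rfl
  have zz : ∀ a b, ⁅Z a, Z b⁆ = 0 := fun a b =>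
    commute_of_shift (k₂ := K₂) (c := -2) (by norm_num) hZ'
      (fun n => by
        rw [lie_shift_of_commute (m := 2) (e := -2) (by norm_num) hZ' h₁K₂
          (by rw [K₂z]; module) n, add_comm 2 n]) z01 _ a b rfl
  -- by induction on `N = a + b`, `⁅Y a, Z b⁆` depends on `N` only and commutes with `λ h`
  have main : ∀ N, (∀ a b, a + b = N → ⁅Y a, Z b⁆ = ⁅Y N, Z 0⁆) ∧ ⁅h₁, ⁅Y N, Z 0⁆⁆ = 0 := by
    intro N
    induction N with
    | zero =>
      refine ⟨fun a b hab => ?_, by rw [hY0, hZ0, T.yz, h₁h]⟩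
      obtain ⟨rfl, rfl⟩ : a = 0 ∧ b = 0 := by omega
      rfl
    | succ N ih =>
      have h1 : ∀ a b, a + b = N + 1 → ⁅Y a, Z b⁆ = ⁅Y (N + 1), Z 0⁆ :=
        fun a b => lie_eq_of_shift hY hZ ih.2 ih.1 b a
      exact ⟨h1, lie_shift_eq_zero hY hZ h10 h1 (actY rfl (Or.inl ⟨h10, rfl⟩) (yy _ _))
        (actZ (h1 0 (N + 1) (by omega)) (zz _ _))⟩
  have ky : ∀ a b, ⁅⁅Y a, Z 0⁆, Y b⁆ = (2 : ℂ) • Y (a + b) := fun a =>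
    lie_shift_of_commute two_ne_zero hY (main a).2 (actY rfl (Or.inr rfl) (yy _ _))
  have kz : ∀ a b, ⁅⁅Y a, Z 0⁆, Z b⁆ = -((2 : ℂ) • Z (a + b)) := fun a b => by
    rw [lie_shift_of_commute (e := -2) (by norm_num) hZ' (main a).2
      (by rw [actZ ((main a).1 0 a (by omega)) (zz _ _)]; module)]
    module
  refine ⟨Y, Z, fun n => ⁅Y n, Z 0⁆, ⟨fun a b => (main _).1 a b rfl, ky, kz, fun a b => ?_, yy, zz⟩,
    hY0, hY1, hZ0, hZ1, hZ2, hY, hZ⟩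
  show ⁅⁅Y a, Z 0⁆, ⁅Y b, Z 0⁆⁆ = 0
  rw [leibniz_lie, ky, kz, smul_lie, lie_neg, lie_smul, (main _).1 b (a + 0) rfl, Nat.add_zero,
    add_comm a b, add_neg_cancel]

end Current
end KdVMiura

namespace KdVMiura
open scoped Polynomial TensorProduct

/-! ### The algebra `H ⊕ sl₂ ⊗ ℂ[λ]` -/

section Model

/-- The element `h = [y, z]` of `sl₂`. -/
noncomputable def hSl2 : Sl2 := ⁅ySl2, zSl2⁆

theorem hSl2_lie_ySl2 : ⁅hSl2, ySl2⁆ = (2 : ℂ) • ySl2 := by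
  ext i j
  simp only [hSl2, ySl2, zSl2, LieSubalgebra.coe_bracket, LieAlgebra.SpecialLinear.val_single,
    LieRing.of_associative_ring_bracket]
  fin_cases i <;> fin_cases j <;>
    simp [Matrix.mul_apply, Matrix.single_apply, LieAlgebra.SpecialLinear.val_single]
  norm_num

theorem hSl2_lie_zSl2 : ⁅hSl2, zSl2⁆ = -((2 : ℂ) • zSl2) := by
  ext i j
  simp only [hSl2, ySl2, zSl2, LieSubalgebra.coe_bracket, LieAlgebra.SpecialLinear.val_single,
    LieRing.of_associative_ring_bracket]
  fin_cases i <;> fin_cases j <;>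
    simp [Matrix.mul_apply, Matrix.single_apply, LieAlgebra.SpecialLinear.val_single]
  norm_num

theorem sl2_trace (g : Sl2) : g.1 0 0 + g.1 1 1 = 0 := by
  have h : Matrix.trace g.1 = 0 := g.2
  rwa [Matrix.trace_fin_two] at h

theorem sl2_eq (g : Sl2) : g = g.1 0 1 • ySl2 + g.1 1 0 • zSl2 + g.1 0 0 • hSl2 := by
  have ht := sl2_trace g
  ext i j
  simp only [hSl2, ySl2, zSl2]
  fin_cases i <;> fin_cases j <;>
    simp [LieAlgebra.SpecialLinear.val_single, LieRing.of_associative_ring_bracket]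
  linear_combination ht

/-- The element `g ⊗ f` of the second summand. -/
noncomputable def cur (f : ℂ[X]) (g : Sl2) : KdVAlgebra := (0, f ⊗ₜ[ℂ] g)

/-- The basis element `r_{i-2}` of the first summand. -/
noncomputable def heis (i : Fin 5) : KdVAlgebra := (Heis.basisElt i, 0)

theorem lie_cur (f₁ f₂ : ℂ[X]) (g₁ g₂ : Sl2) :
    ⁅cur f₁ g₁, cur f₂ g₂⁆ = cur (f₁ * f₂) ⁅g₁, g₂⁆ :=
  Prod.ext (lie_self _) (LieAlgebra.ExtendScalars.bracket_tmul ..)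

theorem heis_lie_cur (i : Fin 5) (f : ℂ[X]) (g : Sl2) : ⁅heis i, cur f g⁆ = 0 :=
  Prod.ext (lie_zero _) (zero_lie _)

theorem heis_lie_heis (i j : Fin 5) :
    ⁅heis i, heis j⁆ = ((⁅Heis.basisElt i, Heis.basisElt j⁆ : Heis), 0) :=
  Prod.ext rfl (lie_self _)

theorem smul_cur (c : ℂ) (f : ℂ[X]) (g : Sl2) : c • cur f g = cur f (c • g) :=
  Prod.ext (smul_zero _) (by simp [cur])

theorem cur_neg (f : ℂ[X]) (g : Sl2) : cur f (-g) = -cur f g :=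
  Prod.ext (by simp [cur]) (by simp [cur, TensorProduct.tmul_neg])

theorem cur_zero (f : ℂ[X]) : cur f 0 = 0 :=
  Prod.ext rfl (by simp [cur])

theorem cur_triple : CurrentTriple (cur 1 hSl2) (cur 1 ySl2) (cur 1 zSl2)
    (cur Polynomial.X hSl2) (cur Polynomial.X zSl2) (cur Polynomial.X ySl2)
    (cur (Polynomial.X ^ 2) zSl2) := by
  have yz : ⁅ySl2, zSl2⁆ = hSl2 := rfl
  constructor <;>
    simp only [lie_cur, smul_cur, hSl2_lie_ySl2, hSl2_lie_zSl2, one_mul, mul_one, cur_neg, lie_self,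
      cur_zero, yz, sq]

theorem heis_relations : HeisenbergRelations heis := by
  have h2 : ∀ c : ℂ, ((c • Heis.basisElt 2 : Heis), (0 : ℂ[X] ⊗[ℂ] Sl2)) = c • heis 2 := fun c =>
    Prod.ext rfl (smul_zero _).symm
  have h : ∀ i j : Fin 5, ⁅heis i, heis j⁆ =
      ((Pi.single i 1 : Fin 5 → ℂ) 1 * (Pi.single j 1 : Fin 5 → ℂ) 3
        - (Pi.single i 1 : Fin 5 → ℂ) 3 * (Pi.single j 1 : Fin 5 → ℂ) 1
        + ((Pi.single i 1 : Fin 5 → ℂ) 4 * (Pi.single j 1 : Fin 5 → ℂ) 0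
        - (Pi.single i 1 : Fin 5 → ℂ) 0 * (Pi.single j 1 : Fin 5 → ℂ) 4)) • heis 2 := fun i j => by
    rw [heis_lie_heis, ← h2]; rfl
  constructor <;> rw [h] <;> simp
  exact neg_one_smul ℂ (heis 2)

theorem heis_eq (a : Heis) : a = ∑ i, a i • Heis.basisElt i := by
  have h : ∀ v : Fin 5 → ℂ, v = ∑ i, v i • (Pi.single i 1 : Fin 5 → ℂ) := fun v => by
    ext j; simp [Finset.sum_apply, Pi.single_apply]
  exact h a

theorem X₁_eq : X₁ = heis 3 - (1 / 2 : ℂ) • cur 1 ySl2 + (1 / 2 : ℂ) • cur Polynomial.X zSl2 :=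
  Prod.ext (by simp [X₁, heis, cur]) (by simp [X₁, heis, cur])

theorem X₂_eq : X₂ = heis 1 + cur 1 zSl2 :=
  Prod.ext (by simp [X₂, heis, cur]) (by simp [X₂, heis, cur])

theorem X₃_eq : X₃ = heis 0 := rfl

/-- The constant term of the `t`-part of the universal zero-curvature representation. -/
noncomputable def X₀ : KdVAlgebra :=
  -heis 4 + (1 / 2 : ℂ) • (cur Polynomial.X ySl2 - cur (Polynomial.X ^ 2) zSl2)

end Model

section Hom

/-- This and the next lemmas restate the bilinearity of the bracket for `ℂ[λ] ⊗ sl₂`, whose bracket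
is found through the extension of scalars to `ℂ[λ]`, so that they apply by syntactic matching. -/
theorem tensor_lie_add (s t t' : ℂ[X] ⊗[ℂ] Sl2) : ⁅s, t + t'⁆ = ⁅s, t⁆ + ⁅s, t'⁆ := lie_add s t t'

theorem tensor_add_lie (s s' t : ℂ[X] ⊗[ℂ] Sl2) : ⁅s + s', t⁆ = ⁅s, t⁆ + ⁅s', t⁆ := add_lie s s' t

theorem tensor_lie_smul (c : ℂ) (s t : ℂ[X] ⊗[ℂ] Sl2) : ⁅s, c • t⁆ = c • ⁅s, t⁆ := lie_smul c s t

theorem tensor_smul_lie (c : ℂ) (s t : ℂ[X] ⊗[ℂ] Sl2) : ⁅c • s, t⁆ = c • ⁅s, t⁆ := smul_lie c s t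

theorem tensor_lie_zero (s : ℂ[X] ⊗[ℂ] Sl2) : ⁅s, (0 : ℂ[X] ⊗[ℂ] Sl2)⁆ = 0 := lie_zero s

theorem tensor_zero_lie (s : ℂ[X] ⊗[ℂ] Sl2) : ⁅(0 : ℂ[X] ⊗[ℂ] Sl2), s⁆ = 0 := zero_lie s

variable {L : Type*} [LieRing L] [LieAlgebra ℂ L]

theorem tensor_monomial_induction {p : ℂ[X] ⊗[ℂ] Sl2 → Prop}
    (padd : ∀ s t, p s → p t → p (s + t)) (p0 : p 0)
    (pm : ∀ (c : ℂ) n g, p (c • ((Polynomial.X ^ n : ℂ[X]) ⊗ₜ[ℂ] g))) (t : ℂ[X] ⊗[ℂ] Sl2) :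
    p t := by
  induction t using TensorProduct.induction_on with
  | zero => exact p0
  | add s t hs ht => exact padd s t hs ht
  | tmul f g =>
    induction f using Polynomial.induction_on' with
    | add f f' hf hf' => rw [TensorProduct.add_tmul]; exact padd _ _ hf hf'
    | monomial n c =>
      rw [← Polynomial.C_mul_X_pow_eq_monomial, ← Polynomial.smul_eq_C_mul,
        ← TensorProduct.smul_tmul']
      exact pm c n g

/-- The elements `λⁿ y, λⁿ z, λⁿ h` span `sl₂ ⊗ ℂ[λ]`. -/
theorem tensor_span_induction {p : ℂ[X] ⊗[ℂ] Sl2 → Prop} (padd : ∀ s t, p s → p t → p (s + t))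
    (psmul : ∀ (c : ℂ) t, p t → p (c • t)) (hy : ∀ n : ℕ, p ((Polynomial.X ^ n : ℂ[X]) ⊗ₜ[ℂ] ySl2))
    (hz : ∀ n : ℕ, p ((Polynomial.X ^ n : ℂ[X]) ⊗ₜ[ℂ] zSl2))
    (hh : ∀ n : ℕ, p ((Polynomial.X ^ n : ℂ[X]) ⊗ₜ[ℂ] hSl2)) (t : ℂ[X] ⊗[ℂ] Sl2) : p t := by
  refine tensor_monomial_induction padd ?_ (fun c n g => psmul c _ ?_) t
  · have h := psmul 0 _ (hy 0)
    rwa [zero_smul] at h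
  · rw [sl2_eq g, TensorProduct.tmul_add, TensorProduct.tmul_add, TensorProduct.tmul_smul,
      TensorProduct.tmul_smul, TensorProduct.tmul_smul]
    exact padd _ _ (padd _ _ (psmul _ _ (hy n)) (psmul _ _ (hz n))) (psmul _ _ (hh n))

/-- Elements with the brackets of `sl₂ ⊗ ℂ[λ]` define a linear map from it that preserves the
brackets. -/
theorem exists_tensor_hom {Y Z K : ℕ → L} (C : CurrentRelations Y Z K) :
    ∃ T : (ℂ[X] ⊗[ℂ] Sl2) →ₗ[ℂ] L,
      (∀ n, T ((Polynomial.X ^ n : ℂ[X]) ⊗ₜ[ℂ] ySl2) = Y n ∧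
        T ((Polynomial.X ^ n : ℂ[X]) ⊗ₜ[ℂ] zSl2) = Z n ∧
        T ((Polynomial.X ^ n : ℂ[X]) ⊗ₜ[ℂ] hSl2) = K n) ∧
      ∀ s t, T ⁅s, t⁆ = ⁅T s, T t⁆ := by
  let P : (ℕ → L) → (ℂ[X] →ₗ[ℂ] L) := fun Y => (Polynomial.basisMonomials ℂ).constr ℂ Y
  have hP : ∀ (Y : ℕ → L) n, P Y (Polynomial.X ^ n) = Y n := fun Y n => by
    have h := (Polynomial.basisMonomials ℂ).constr_basis ℂ Y n
    rw [Polynomial.coe_basisMonomials] at h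
    simpa only [Polynomial.monomial_one_right_eq_X_pow] using h
  let M : Fin 2 → Fin 2 → (Sl2 →ₗ[ℂ] ℂ) := fun i j =>
    { toFun := fun g => g.1 i j, map_add' := fun _ _ => rfl, map_smul' := fun _ _ => rfl }
  let T : (ℂ[X] ⊗[ℂ] Sl2) →ₗ[ℂ] L := TensorProduct.lift
    (LinearMap.mk₂ ℂ (fun f g => M 0 1 g • P Y f + M 1 0 g • P Z f + M 0 0 g • P K f)
      (fun f f' g => by simp only [map_add]; module)
      (fun c f g => by simp only [map_smul]; module)
      (fun f g g' => by simp only [map_add]; module)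
      (fun c f g => by simp only [map_smul, smul_eq_mul]; module))
  have hT : ∀ (n : ℕ) (g : Sl2), T ((Polynomial.X ^ n : ℂ[X]) ⊗ₜ[ℂ] g) =
      g.1 0 1 • Y n + g.1 1 0 • Z n + g.1 0 0 • K n := fun n g => by
    simp only [T, TensorProduct.lift.tmul, LinearMap.mk₂_apply, hP]; rfl
  refine ⟨T, fun n => ⟨?_, ?_, ?_⟩, ?_⟩
  · rw [hT]; simp [ySl2, LieAlgebra.SpecialLinear.val_single]
  · rw [hT]; simp [zSl2, LieAlgebra.SpecialLinear.val_single]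
  · rw [hT]; simp [hSl2, ySl2, zSl2, LieAlgebra.SpecialLinear.val_single,
      LieRing.of_associative_ring_bracket]
  · have hb : ∀ (m n : ℕ) (g g' : Sl2),
        T ⁅(Polynomial.X ^ m : ℂ[X]) ⊗ₜ[ℂ] g, (Polynomial.X ^ n : ℂ[X]) ⊗ₜ[ℂ] g'⁆ =
          ⁅T ((Polynomial.X ^ m : ℂ[X]) ⊗ₜ[ℂ] g), T ((Polynomial.X ^ n : ℂ[X]) ⊗ₜ[ℂ] g')⁆ := by
      intro m n g g'
      have zy : ⁅Z m, Y n⁆ = -K (m + n) := by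
        rw [← lie_skew, C.yz, add_comm]
      have yk : ⁅Y m, K n⁆ = -((2 : ℂ) • Y (m + n)) := by rw [← lie_skew, C.ky, add_comm]
      have zk : ⁅Z m, K n⁆ = (2 : ℂ) • Z (m + n) := by rw [← lie_skew, C.kz, add_comm, neg_neg]
      have tr : ∀ g : Sl2, g.1 1 1 = - g.1 0 0 := fun g => by
        linear_combination sl2_trace g
      rw [LieAlgebra.ExtendScalars.bracket_tmul, ← pow_add, hT, hT, hT]
      simp only [lie_add, add_lie, smul_lie, lie_smul, C.yz, C.ky, C.kz, C.kk, C.yy, C.zz, zy, yk,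
        zk, LieSubalgebra.coe_bracket, LieRing.of_associative_ring_bracket, Matrix.sub_apply,
        Matrix.mul_apply, Fin.sum_univ_two, tr]
      module
    intro s
    refine tensor_monomial_induction (fun t t' ht ht' => ?_) ?_ (fun c n g => ?_)
    · rw [tensor_lie_add, map_add, ht, ht', map_add, lie_add]
    · rw [tensor_lie_zero, map_zero, lie_zero]
    · revert s
      refine tensor_monomial_induction (fun t t' ht ht' => ?_) ?_ (fun c' n' g' => ?_)
      · rw [tensor_add_lie, map_add, ht, ht', map_add, add_lie]
      · rw [tensor_zero_lie, map_zero, zero_lie]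
      · rw [tensor_lie_smul, tensor_smul_lie, map_smul, map_smul, map_smul, map_smul, hb, lie_smul,
          smul_lie]

end Hom
end KdVMiura

namespace KdVMiura
open scoped Polynomial TensorProduct

/-! ### Homomorphisms from `H ⊕ sl₂ ⊗ ℂ[λ]` -/

section Abstract

variable {L : Type*} [LieRing L] [LieAlgebra ℂ L]

/-- What commutes with the generators `y, z, λ z` commutes with `h, λ h, λ y, λ² z`. -/
theorem CurrentTriple.commute {h y z h₁ z₁ y₁ z₂ g : L} (T : CurrentTriple h y z h₁ z₁ y₁ z₂)
    (gy : ⁅g, y⁆ = 0) (gz : ⁅g, z⁆ = 0) (gz₁ : ⁅g, z₁⁆ = 0) :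
    ⁅g, h⁆ = 0 ∧ ⁅g, h₁⁆ = 0 ∧ ⁅g, y₁⁆ = 0 ∧ ⁅g, z₂⁆ = 0 := by
  have gh₁ : ⁅g, h₁⁆ = 0 := T.yz₁ ▸ lie_lie_eq_zero_of_commute gy gz₁
  refine ⟨T.yz ▸ lie_lie_eq_zero_of_commute gy gz, gh₁, ?_, ?_⟩
  · have h0 := lie_lie_eq_zero_of_commute gh₁ gy
    rw [T.h₁y, lie_smul] at h0
    exact smul_eq_zero_of_ne two_ne_zero h0
  · have h0 := lie_lie_eq_zero_of_commute gh₁ gz₁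
    rw [T.h₁z₁, lie_neg, lie_smul, neg_eq_zero] at h0
    exact smul_eq_zero_of_ne two_ne_zero h0

/-- The converse of `KdVRelations.decomposition`: the coefficients built from `H` and `sl₂ ⊗ ℂ[λ]`
have the relations of the zero-curvature equation. -/
theorem KdVRelations.of_decomposition {r : Fin 5 → L} {h y z h₁ z₁ y₁ z₂ : L}
    (T : CurrentTriple h y z h₁ z₁ y₁ z₂) (R : HeisenbergRelations r)
    (hr : ∀ i, ⁅r i, y⁆ = 0 ∧ ⁅r i, z⁆ = 0 ∧ ⁅r i, z₁⁆ = 0) :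
    KdVRelations (r 3 - (1 / 2 : ℂ) • y + (1 / 2 : ℂ) • z₁) ((1 / 3 : ℂ) • (r 1 + z))
      ((1 / 3 : ℂ) • r 0) (-r 4 + (1 / 2 : ℂ) • (y₁ - z₂)) := by
  obtain ⟨-, -, y₁z, zz₂, -, -⟩ :=
    CurrentTriple.derived_brackets T.hy T.yz T.hz₁ T.zz₁ T.yz₁ T.h₁y T.h₁z₁
  have q : ∀ i, ⁅r i, y⁆ = 0 ∧ ⁅r i, z⁆ = 0 ∧ ⁅r i, z₁⁆ = 0 ∧ ⁅r i, h⁆ = 0 ∧ ⁅r i, h₁⁆ = 0 ∧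
      ⁅r i, y₁⁆ = 0 ∧ ⁅r i, z₂⁆ = 0 := fun i =>
    ⟨(hr i).1, (hr i).2.1, (hr i).2.2, T.commute (hr i).1 (hr i).2.1 (hr i).2.2⟩
  have sw : ∀ {u v : L}, ⁅u, v⁆ = 0 → ⁅v, u⁆ = 0 := fun h => by
    rw [lie_eq_neg_of_lie_eq h, neg_zero]
  have qy := fun i => (q i).1
  have qz := fun i => (q i).2.1
  have qz₁ := fun i => (q i).2.2.1
  have qh := fun i => (q i).2.2.2.1
  have qy₁ := fun i => (q i).2.2.2.2.2.1
  have qz₂ := fun i => (q i).2.2.2.2.2.2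
  have yq := fun i => sw (qy i)
  have zq := fun i => sw (qz i)
  have z₁q := fun i => sw (qz₁ i)
  have r30 := sw R.r03
  have r31 := lie_eq_neg_of_lie_eq R.r13
  have r32 := sw R.r23
  have r10 := sw R.r01
  have zh : ⁅z, h⁆ = (2 : ℂ) • z := by rw [lie_eq_neg_of_lie_eq T.hz, neg_neg]
  have yh : ⁅y, h⁆ = -((2 : ℂ) • y) := lie_eq_neg_of_lie_eq T.hy
  have z₁h : ⁅z₁, h⁆ = (2 : ℂ) • z₁ := by rw [lie_eq_neg_of_lie_eq T.hz₁, neg_neg]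
  have z₁z := sw T.zz₁
  have z₁y := lie_eq_neg_of_lie_eq T.yz₁
  have zy₁ := lie_eq_neg_of_lie_eq y₁z
  have z₁y₁ : ⁅z₁, y₁⁆ = -⁅y, z₂⁆ := by
    have h4 := leibniz_lie h₁ y z₁
    rw [T.yz₁, lie_self, T.h₁y, T.h₁z₁, smul_lie, lie_neg, lie_smul, ← lie_skew] at h4
    linear_combination (norm := module) (1 / 2 : ℂ) • h4
  have ab : ⁅r 3 - (1 / 2 : ℂ) • y + (1 / 2 : ℂ) • z₁, (1 / 3 : ℂ) • (r 1 + z)⁆ =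
      -((1 / 3 : ℂ) • r 2) - (1 / 6 : ℂ) • h := by
    simp only [lie_smul, lie_add, add_lie, sub_lie, smul_lie, r31, qz, yq, z₁q, T.yz, z₁z]
    module
  have bm : ⁅(1 / 3 : ℂ) • (r 1 + z), -((1 / 3 : ℂ) • r 2) - (1 / 6 : ℂ) • h⁆ =
      -((1 / 9 : ℂ) • z) := by
    simp only [lie_sub, lie_neg, lie_smul, add_lie, smul_lie, R.r12, qh, zq, zh]
    module
  constructor
  · simp only [lie_smul, add_lie, sub_lie, smul_lie, r30, yq, z₁q]
    module
  · simp only [lie_smul, add_lie, smul_lie, r10, zq]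
    module
  · simp only [lie_add, lie_sub, lie_neg, lie_smul, add_lie, sub_lie, smul_lie, R.r34, qy₁, qz₂,
      yq, z₁q, T.yy₁, T.z₁z₂, z₁y₁]
    module
  · rw [ab]
    simp only [lie_add, lie_sub, lie_neg, lie_smul, add_lie, sub_lie, smul_lie, R.r14, r32, qh, qy,
      qz₁, yq, zq, z₁q, qy₁, qz₂, zy₁, zz₂, yh, z₁h, T.yz₁, z₁y, lie_self, lie_zero]
    module
  · rw [ab, bm]
    simp only [lie_add, lie_sub, lie_neg, lie_smul, add_lie, sub_lie, smul_lie, R.r04, qz, qy₁, qz₂,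
      T.yz, z₁z]
    module
  · rw [ab, bm]
    simp only [lie_neg, lie_smul, add_lie, smul_lie, qz, lie_self]
    module

/-- A subalgebra that contains `y, z, λ z` contains all `λⁿ y, λⁿ z`. -/
theorem CurrentTriple.mem_of_mem {h y z h₁ z₁ y₁ z₂ : L} (T : CurrentTriple h y z h₁ z₁ y₁ z₂)
    (S : LieSubalgebra ℂ L) (hy : y ∈ S) (hz : z ∈ S) (hz₁ : z₁ ∈ S) {Y Z : ℕ → L} (hY0 : Y 0 = y)
    (hZ0 : Z 0 = z) (hY : ∀ n, ⁅h₁, Y n⁆ = (2 : ℂ) • Y (n + 1))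
    (hZ : ∀ n, ⁅h₁, Z n⁆ = -((2 : ℂ) • Z (n + 1))) (n : ℕ) : Y n ∈ S ∧ Z n ∈ S := by
  have hh₁ : h₁ ∈ S := T.yz₁ ▸ S.lie_mem hy hz₁
  induction n with
  | zero => exact ⟨hY0 ▸ hy, hZ0 ▸ hz⟩
  | succ n ih =>
    constructor
    · have h0 := S.smul_mem (1 / 2 : ℂ) (S.lie_mem hh₁ ih.1)
      rwa [hY, smul_smul, show (1 / 2 : ℂ) * 2 = 1 by norm_num, one_smul] at h0
    · have h0 := S.smul_mem (-1 / 2 : ℂ) (S.lie_mem hh₁ ih.2)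
      rwa [hZ, smul_neg, smul_smul, ← neg_smul, show -((-1 / 2 : ℂ) * 2) = 1 by norm_num,
        one_smul] at h0

/-- From `r₋₁ + z`, `r₀ + ½ h` and `[r₁ - ½ y + ½ λ z, r₀ + ½ h] = ½ (y + λ z)` a subalgebra obtains
`z`, `y` and `λ z`. -/
theorem CurrentTriple.mem_of_mem_of_commute {r : Fin 5 → L} {h y z h₁ z₁ y₁ z₂ : L}
    (T : CurrentTriple h y z h₁ z₁ y₁ z₂) (R : HeisenbergRelations r)
    (hr : ∀ i, ⁅r i, y⁆ = 0 ∧ ⁅r i, z⁆ = 0 ∧ ⁅r i, z₁⁆ = 0) (S : LieSubalgebra ℂ L)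
    (h1 : r 1 + z ∈ S) (h2 : r 2 + (1 / 2 : ℂ) • h ∈ S) (h3 : y + z₁ ∈ S) :
    r 1 ∈ S ∧ r 2 ∈ S ∧ y ∈ S ∧ z ∈ S ∧ z₁ ∈ S := by
  have q := fun i => T.commute (hr i).1 (hr i).2.1 (hr i).2.2
  have hz : z ∈ S := by
    have h0 : ⁅r 2 + (1 / 2 : ℂ) • h, r 1 + z⁆ = -z := by
      simp only [lie_add, add_lie, smul_lie, lie_eq_neg_of_lie_eq R.r12,
        lie_eq_neg_of_lie_eq (q 1).1, (hr 2).2.1, T.hz]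
      module
    have h4 := S.lie_mem h2 h1
    rw [h0] at h4
    simpa using h4
  have hh : h ∈ S := by
    have h0 : ⁅y + z₁, z⁆ = h := by
      rw [add_lie, T.yz, lie_eq_neg_of_lie_eq T.zz₁, neg_zero, add_zero]
    exact h0 ▸ S.lie_mem h3 hz
  have h5 : y - z₁ ∈ S := by
    have h0 : (1 / 2 : ℂ) • ⁅h, y + z₁⁆ = y - z₁ := by
      rw [lie_add, T.hy, T.hz₁]; module
    exact h0 ▸ S.smul_mem _ (S.lie_mem hh h3)
  refine ⟨?_, ?_, ?_, hz, ?_⟩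
  · simpa using S.sub_mem h1 hz
  · simpa using S.sub_mem h2 (S.smul_mem (1 / 2 : ℂ) hh)
  · have h0 : (1 / 2 : ℂ) • ((y + z₁) + (y - z₁)) = y := by module
    exact h0 ▸ S.smul_mem _ (S.add_mem h3 h5)
  · have h0 : (1 / 2 : ℂ) • ((y + z₁) - (y - z₁)) = z₁ := by module
    exact h0 ▸ S.smul_mem _ (S.sub_mem h3 h5)

theorem mem_of_neg_half_smul_mem {S : LieSubalgebra ℂ L} {x : L}
    (h : -((1 / 2 : ℂ) • x) ∈ S) : x ∈ S := by
  have h0 : (-2 : ℂ) • -((1 / 2 : ℂ) • x) = x := by module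
  exact h0 ▸ S.smul_mem (-2 : ℂ) h

/-- The brackets by which `X₂` and `X₁` generate first `r₀ + ½ h` and then `y + λ z`. -/
theorem lie_coefficients {r : Fin 5 → L} {h y z h₁ z₁ y₁ z₂ : L}
    (T : CurrentTriple h y z h₁ z₁ y₁ z₂) (R : HeisenbergRelations r)
    (hr : ∀ i, ⁅r i, y⁆ = 0 ∧ ⁅r i, z⁆ = 0 ∧ ⁅r i, z₁⁆ = 0) :
    ⁅r 1 + z, r 3 - (1 / 2 : ℂ) • y + (1 / 2 : ℂ) • z₁⁆ = r 2 + (1 / 2 : ℂ) • h ∧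
    ⁅r 2 + (1 / 2 : ℂ) • h, r 3 - (1 / 2 : ℂ) • y + (1 / 2 : ℂ) • z₁⁆ =
      -((1 / 2 : ℂ) • (y + z₁)) := by
  have q := fun i => T.commute (hr i).1 (hr i).2.1 (hr i).2.2
  constructor
  · simp only [lie_add, lie_sub, lie_smul, add_lie, R.r13, (hr 1).1, (hr 1).2.2,
      lie_eq_neg_of_lie_eq (hr 3).2.1, lie_eq_neg_of_lie_eq T.yz, T.zz₁]
    module
  · simp only [lie_add, lie_sub, lie_smul, add_lie, smul_lie, R.r23, (hr 2).1, (hr 2).2.2,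
      lie_eq_neg_of_lie_eq (q 3).1, T.hy, T.hz₁]
    module

/-- The homomorphism `H ⊕ sl₂ ⊗ ℂ[λ] → L` given by elements of `L` with the corresponding
brackets. -/
theorem exists_lieHom {r : Fin 5 → L} {Y Z K : ℕ → L} (C : CurrentRelations Y Z K)
    (R : HeisenbergRelations r) (hr : ∀ i n, ⁅r i, Y n⁆ = 0 ∧ ⁅r i, Z n⁆ = 0 ∧ ⁅r i, K n⁆ = 0) :
    ∃ φ : KdVAlgebra →ₗ⁅ℂ⁆ L, (∀ i, φ (heis i) = r i) ∧
      ∀ n, φ (cur (Polynomial.X ^ n) ySl2) = Y n ∧ φ (cur (Polynomial.X ^ n) zSl2) = Z n := by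
  obtain ⟨T, hT, hTb⟩ := exists_tensor_hom C
  have hrT : ∀ i t, ⁅r i, T t⁆ = 0 := fun i => by
    refine tensor_span_induction (fun s t hs ht => ?_) (fun c t ht => ?_) (fun n => ?_)
      (fun n => ?_) (fun n => ?_)
    · rw [map_add, lie_add, hs, ht, add_zero]
    · rw [map_smul, lie_smul, ht, smul_zero]
    · rw [(hT n).1, (hr i n).1]
    · rw [(hT n).2.1, (hr i n).2.1]
    · rw [(hT n).2.2, (hr i n).2.2]
  have hTr : ∀ i t, ⁅T t, r i⁆ = 0 := fun i t => by rw [lie_eq_neg_of_lie_eq (hrT i t), neg_zero]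
  have sw : ∀ {u v : L}, ⁅u, v⁆ = 0 → ⁅v, u⁆ = 0 := fun h => by
    rw [lie_eq_neg_of_lie_eq h, neg_zero]
  have r40 := lie_eq_neg_of_lie_eq R.r04
  have r31 := lie_eq_neg_of_lie_eq R.r13
  let φ : KdVAlgebra →ₗ⁅ℂ⁆ L :=
    { toFun := fun x => ∑ i, x.1 i • r i + T x.2
      map_add' := fun x x' => by
        simp only [Prod.fst_add, Prod.snd_add, Heis.add_apply, map_add, add_smul,
          Finset.sum_add_distrib]
        abel
      map_smul' := fun c x => by
        simp only [Prod.smul_fst, Prod.smul_snd, Heis.smul_apply, map_smul, mul_smul,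
          RingHom.id_apply, smul_add, Finset.smul_sum]
      map_lie' := fun {x x'} => by
        show ∑ i, (⁅x.1, x'.1⁆ : Heis) i • r i + T ⁅x.2, x'.2⁆ = _
        have h1 : ∑ i, (⁅x.1, x'.1⁆ : Heis) i • r i =
            (x.1 1 * x'.1 3 - x.1 3 * x'.1 1 + (x.1 4 * x'.1 0 - x.1 0 * x'.1 4)) • r 2 := by
          simp [Heis.bracket_apply, Fin.sum_univ_five]
        rw [h1, hTb]
        simp only [Fin.sum_univ_five, lie_add, add_lie, smul_lie, lie_smul, hrT, hTr, R.r01, R.r02,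
          R.r03, R.r04, R.r12, R.r13, R.r14, R.r23, R.r24, R.r34, sw R.r01, sw R.r02, sw R.r03, r40,
          sw R.r12, r31, sw R.r14, sw R.r23, sw R.r24, sw R.r34, lie_self]
        module }
  refine ⟨φ, fun i => ?_, fun n => ⟨?_, ?_⟩⟩
  · show ∑ j, (Pi.single i 1 : Fin 5 → ℂ) j • r j + T 0 = r i
    simp [Pi.single_apply]
  · show ∑ j, (0 : Heis) j • r j + T _ = Y n
    simp only [Heis.zero_apply, zero_smul, Finset.sum_const_zero, zero_add, cur, (hT n).1]
  · show ∑ j, (0 : Heis) j • r j + T _ = Z n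
    simp only [Heis.zero_apply, zero_smul, Finset.sum_const_zero, zero_add, cur, (hT n).2.1]

/-- Elements with the relations of the zero-curvature equation are the images of the coefficients
of the universal representation. -/
theorem KdVRelations.exists_lieHom {a b c d : L} (H : KdVRelations a b c d) :
    ∃ φ : KdVAlgebra →ₗ⁅ℂ⁆ L, φ X₁ = a ∧ φ X₂ = (3 : ℂ) • b ∧ φ X₃ = (3 : ℂ) • c ∧ φ X₀ = d := by
  obtain ⟨r, h, y, z, h₁, z₁, y₁, z₂, T, R, hr, ha, hb, hc, hd, -⟩ := H.decomposition
  obtain ⟨Y, Z, K, C, hY0, hY1, hZ0, hZ1, hZ2, hY, hZ⟩ := T.exists_sequences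
  have hrYZ : ∀ i n, ⁅r i, Y n⁆ = 0 ∧ ⁅r i, Z n⁆ = 0 := fun i n => by
    have hrh : ⁅r i, h₁⁆ = 0 := (T.commute (hr i).1 (hr i).2.1 (hr i).2.2).2.1
    induction n with
    | zero => exact ⟨hY0 ▸ (hr i).1, hZ0 ▸ (hr i).2.1⟩
    | succ n ih =>
      have h1 := lie_lie_eq_zero_of_commute hrh ih.1
      have h2 := lie_lie_eq_zero_of_commute hrh ih.2
      rw [hY, lie_smul] at h1
      rw [hZ, lie_neg, lie_smul, neg_eq_zero] at h2
      exact ⟨smul_eq_zero_of_ne two_ne_zero h1, smul_eq_zero_of_ne two_ne_zero h2⟩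
  obtain ⟨φ, hφr, hφ⟩ := KdVMiura.exists_lieHom C R (fun i n => ⟨(hrYZ i n).1, (hrYZ i n).2, by
    rw [← zero_add n, ← C.yz 0 n]
    exact lie_lie_eq_zero_of_commute (hrYZ i 0).1 (hrYZ i n).2⟩)
  have e0 := hφ 0
  have e1 := hφ 1
  have e2 := hφ 2
  rw [pow_zero, hY0, hZ0] at e0
  rw [pow_one, hY1, hZ1] at e1
  rw [hZ2] at e2
  refine ⟨φ, ?_, ?_, ?_, ?_⟩
  · rw [X₁_eq, map_add, map_sub, map_smul, map_smul, hφr, e0.1, e1.2, ha]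
  · rw [X₂_eq, map_add, hφr, e0.2, hb]
  · rw [X₃_eq, hφr, hc]
  · rw [X₀, map_add, map_neg, map_smul, map_sub, hφr, e1.1, e2.2, hd]

end Abstract

section Concrete

theorem heis_commute (i : Fin 5) : ⁅heis i, cur 1 ySl2⁆ = 0 ∧ ⁅heis i, cur 1 zSl2⁆ = 0 ∧
    ⁅heis i, cur Polynomial.X zSl2⁆ = 0 :=
  ⟨heis_lie_cur _ _ _, heis_lie_cur _ _ _, heis_lie_cur _ _ _⟩

/-- The coefficients of the universal representation have the relations of the zero-curvature
equation. -/
theorem KdVRelations.model : KdVRelations X₁ ((1 / 3 : ℂ) • X₂) ((1 / 3 : ℂ) • X₃) X₀ := by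
  have h := KdVRelations.of_decomposition cur_triple heis_relations heis_commute
  rwa [← X₁_eq, ← X₂_eq, ← X₃_eq] at h

/-- A subalgebra that contains `y, z, λ z` contains `sl₂ ⊗ ℂ[λ]`. -/
theorem inr_mem_of_mem (S : LieSubalgebra ℂ KdVAlgebra) (hy : cur 1 ySl2 ∈ S) (hz : cur 1 zSl2 ∈ S)
    (hz₁ : cur Polynomial.X zSl2 ∈ S) (t : ℂ[X] ⊗[ℂ] Sl2) : ((0, t) : KdVAlgebra) ∈ S := by
  have h := cur_triple.mem_of_mem S hy hz hz₁ (Y := fun n => cur (Polynomial.X ^ n) ySl2)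
    (Z := fun n => cur (Polynomial.X ^ n) zSl2) (by simp) (by simp)
    (fun n => by rw [lie_cur, hSl2_lie_ySl2, smul_cur, pow_succ'])
    (fun n => by rw [lie_cur, hSl2_lie_zSl2, smul_cur, cur_neg, pow_succ'])
  refine tensor_span_induction (p := fun t => ((0, t) : KdVAlgebra) ∈ S) (fun s t hs ht => ?_)
    (fun c t ht => ?_) (fun n => (h n).1) (fun n => (h n).2) (fun n => ?_) t
  · have h1 := S.add_mem hs ht
    rwa [Prod.mk_add_mk, add_zero] at h1
  · have h1 := S.smul_mem c ht
    rwa [Prod.smul_mk, smul_zero] at h1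
  · have h1 := S.lie_mem hy (h n).2
    rwa [lie_cur, one_mul] at h1

theorem inl_mem_of_mem (S : LieSubalgebra ℂ KdVAlgebra) (a : Heis)
    (h : ∀ i, a i = 0 ∨ heis i ∈ S) : ((a, 0) : KdVAlgebra) ∈ S := by
  have h0 : ((a, 0) : KdVAlgebra) = ∑ i, a i • heis i := by
    refine Prod.ext ?_ ?_
    · rw [Prod.fst_sum]; exact heis_eq a
    · rw [Prod.snd_sum]; exact (Finset.sum_eq_zero fun i _ => smul_zero _).symm
  rw [h0]
  refine S.toSubmodule.sum_mem fun i _ => ?_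
  rcases h i with h | h
  · rw [h, zero_smul]; exact S.zero_mem
  · exact S.smul_mem _ h

/-- The coefficients of the universal zero-curvature representation generate the algebra. -/
theorem eq_top_of_mem (S : LieSubalgebra ℂ KdVAlgebra) (h₁ : X₁ ∈ S) (h₂ : X₂ ∈ S) (h₃ : X₃ ∈ S)
    (h₀ : X₀ ∈ S) (x : KdVAlgebra) : x ∈ S := by
  obtain ⟨e1, e2⟩ := lie_coefficients cur_triple heis_relations heis_commute
  rw [← X₁_eq, ← X₂_eq] at e1
  rw [← X₁_eq] at e2
  have m1 := e1 ▸ S.lie_mem h₂ h₁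
  have m2 := mem_of_neg_half_smul_mem (e2 ▸ S.lie_mem m1 h₁)
  obtain ⟨r1, r2, my, mz, mz₁⟩ := cur_triple.mem_of_mem_of_commute heis_relations heis_commute S
    (X₂_eq ▸ h₂) m1 m2
  have ht := inr_mem_of_mem S my mz mz₁
  have r3 : heis 3 ∈ S := by
    have h := S.add_mem (S.sub_mem h₁ (S.smul_mem (1 / 2 : ℂ) mz₁)) (S.smul_mem (1 / 2 : ℂ) my)
    rw [X₁_eq] at h
    convert h using 1
    abel
  have r4 : heis 4 ∈ S := by
    have my₁ : cur Polynomial.X ySl2 ∈ S := ht _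
    have mz₂ : cur (Polynomial.X ^ 2) zSl2 ∈ S := ht _
    have h := S.sub_mem (S.smul_mem (1 / 2 : ℂ) (S.sub_mem my₁ mz₂)) h₀
    rw [X₀] at h
    convert h using 1
    abel
  have hx : x = (x.1, 0) + (0, x.2) := by rw [Prod.mk_add_mk, add_zero, zero_add]
  rw [hx]
  refine S.add_mem (inl_mem_of_mem S _ fun i => Or.inr ?_) (ht _)
  fin_cases i
  exacts [X₃_eq ▸ h₃, r1, r2, r3, r4]

/-- The uniqueness in the universal property. -/
theorem lieHom_ext {L : Type*} [LieRing L] [LieAlgebra ℂ L] {φ ψ : KdVAlgebra →ₗ⁅ℂ⁆ L}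
    (h₁ : φ X₁ = ψ X₁) (h₂ : φ X₂ = ψ X₂) (h₃ : φ X₃ = ψ X₃) (h₀ : φ X₀ = ψ X₀) : φ = ψ := by
  let S : LieSubalgebra ℂ KdVAlgebra :=
    { LinearMap.eqLocus (φ : KdVAlgebra →ₗ[ℂ] L) (ψ : KdVAlgebra →ₗ[ℂ] L) with
      lie_mem' := fun {x y} hx hy => by
        have hx' : φ x = ψ x := hx
        have hy' : φ y = ψ y := hy
        show φ ⁅x, y⁆ = ψ ⁅x, y⁆
        rw [LieHom.map_lie, LieHom.map_lie, hx', hy'] }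
  exact LieHom.ext fun x => eq_top_of_mem S h₁ h₂ h₃ h₀ x

end Concrete
end KdVMiura

namespace KdVMiura
open scoped Polynomial TensorProduct

/-! ### The chain of subalgebras -/

section Chain

variable {L : Type*} [LieRing L] [LieAlgebra ℂ L] {ι : Type*}

theorem zcrSubalgebra_mono (M : ι → L) (k : ℕ) :
    zcrSubalgebra M (k + 1) ≤ zcrSubalgebra M (k + 2) :=
  fun _ hx => LieSubalgebra.subset_lieSpan (Or.inl hx)

theorem lie_mem_zcrSubalgebra {M : ι → L} {k : ℕ} {X : L} (hX : X ∈ zcrSubalgebra M (k + 1))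
    (a : ι) : ⁅X, M a⁆ ∈ zcrSubalgebra M (k + 2) :=
  LieSubalgebra.subset_lieSpan (Or.inr ⟨X, hX, a, rfl⟩)

theorem zcrSubalgebra_le {M : ι → L} {J : LieSubalgebra ℂ L} (h : ∀ a b, M a - M b ∈ J)
    (hl : ∀ Y ∈ J, ∀ a, ⁅Y, M a⁆ ∈ J) : ∀ k, zcrSubalgebra M k ≤ J
  | 0 => bot_le
  | 1 => LieSubalgebra.lieSpan_le.mpr (by rintro _ ⟨a, b, rfl⟩; exact h a b)
  | k + 2 => LieSubalgebra.lieSpan_le.mpr (by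
      rintro _ (hX | ⟨Y, hY, a, rfl⟩)
      · exact zcrSubalgebra_le h hl (k + 1) hX
      · exact hl Y (zcrSubalgebra_le h hl (k + 1) hY) a)

/-- For a quadratic polynomial `M u = a + (u / 3) b + (u² / 6) c`, the first subalgebra contains
`b` and `c`. -/
theorem mem_zcrSubalgebra_one {M : ℂ → L} {a b c : L}
    (hM : ∀ u, M u = a + (u / 3) • b + (u ^ 2 / 6) • c) :
    b ∈ zcrSubalgebra M 1 ∧ c ∈ zcrSubalgebra M 1 := by
  have h : ∀ u v, M u - M v ∈ zcrSubalgebra M 1 := fun u v =>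
    LieSubalgebra.subset_lieSpan ⟨u, v, rfl⟩
  have h1 : (3 / 2 : ℂ) • (M 1 - M (-1)) = b := by rw [hM, hM]; module
  have h2 : (3 : ℂ) • ((M 1 - M 0) + (M (-1) - M 0)) = c := by rw [hM, hM, hM]; module
  exact ⟨h1 ▸ LieSubalgebra.smul_mem _ _ (h _ _),
    h2 ▸ LieSubalgebra.smul_mem _ _ (add_mem (h _ _) (h _ _))⟩

end Chain

/-- The subalgebra of `H ⊕ sl₂ ⊗ ℂ[λ]` on which the coordinates of `r₁` and `r₂` vanish. -/
noncomputable def kdvCore : LieSubalgebra ℂ KdVAlgebra where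
  carrier := {x | x.1 3 = 0 ∧ x.1 4 = 0}
  add_mem' := fun {x y} hx hy => by
    refine ⟨?_, ?_⟩
    · show x.1 3 + y.1 3 = 0
      rw [hx.1, hy.1, add_zero]
    · show x.1 4 + y.1 4 = 0
      rw [hx.2, hy.2, add_zero]
  zero_mem' := ⟨rfl, rfl⟩
  smul_mem' := fun c x hx => by
    refine ⟨?_, ?_⟩
    · show c * x.1 3 = 0
      rw [hx.1, mul_zero]
    · show c * x.1 4 = 0
      rw [hx.2, mul_zero]
  lie_mem' := fun {x y} _ _ =>
    ⟨by show (⁅x.1, y.1⁆ : Heis) 3 = 0; simp [Heis.bracket_apply],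
      by show (⁅x.1, y.1⁆ : Heis) 4 = 0; simp [Heis.bracket_apply]⟩

theorem lie_mem_kdvCore (x y : KdVAlgebra) : ⁅x, y⁆ ∈ kdvCore :=
  ⟨by show (⁅x.1, y.1⁆ : Heis) 3 = 0; simp [Heis.bracket_apply],
    by show (⁅x.1, y.1⁆ : Heis) 4 = 0; simp [Heis.bracket_apply]⟩

theorem kdvA_sub_mem_kdvCore (u v : ℂ) : kdvA u - kdvA v ∈ kdvCore := by
  have hX₂ : X₂ ∈ kdvCore := ⟨by simp [X₂, Heis.basisElt], by simp [X₂, Heis.basisElt]⟩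
  have hX₃ : X₃ ∈ kdvCore := ⟨by simp [X₃, Heis.basisElt], by simp [X₃, Heis.basisElt]⟩
  have h : kdvA u - kdvA v = ((u / 3) • X₂ - (v / 3) • X₂) +
      ((u ^ 2 / 6) • X₃ - (v ^ 2 / 6) • X₃) := by
    rw [kdvA, kdvA]; abel
  rw [h]
  exact add_mem (sub_mem (kdvCore.smul_mem _ hX₂) (kdvCore.smul_mem _ hX₂))
    (sub_mem (kdvCore.smul_mem _ hX₃) (kdvCore.smul_mem _ hX₃))

/-- Two brackets with `A` suffice: `X₂` and `X₃` lie in the first subalgebra, `r₀ + ½ h` in the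
second one, and `y + λ z` in the third one. -/
theorem kdvCore_le : kdvCore ≤ zcrSubalgebra kdvA 3 := by
  obtain ⟨h2, h3⟩ := mem_zcrSubalgebra_one (M := kdvA) (fun u => rfl)
  have hA : kdvA 0 = X₁ := by
    have h : ∀ {L : Type} [LieRing L] [LieAlgebra ℂ L] (a b c : L),
      a + ((0 : ℂ) / 3) • b + ((0 : ℂ) ^ 2 / 6) • c = a := fun a b c => by module
    exact h X₁ X₂ X₃
  obtain ⟨e1, e2⟩ := lie_coefficients cur_triple heis_relations heis_commute
  rw [← X₁_eq, ← X₂_eq, ← hA] at e1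
  rw [← X₁_eq, ← hA] at e2
  have m1 := e1 ▸ lie_mem_zcrSubalgebra h2 0
  have m2 := mem_of_neg_half_smul_mem (e2 ▸ lie_mem_zcrSubalgebra m1 0)
  have m : ∀ x ∈ zcrSubalgebra kdvA 1, x ∈ zcrSubalgebra kdvA 3 := fun x hx =>
    zcrSubalgebra_mono _ _ (zcrSubalgebra_mono _ _ hx)
  obtain ⟨r1, r2, my, mz, mz₁⟩ := cur_triple.mem_of_mem_of_commute heis_relations heis_commute
    (zcrSubalgebra kdvA 3) (X₂_eq ▸ m _ h2) (zcrSubalgebra_mono _ _ m1) m2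
  intro x hx
  have hx0 : x = (x.1, 0) + (0, x.2) := by rw [Prod.mk_add_mk, add_zero, zero_add]
  rw [hx0]
  refine add_mem (inl_mem_of_mem _ _ fun i => ?_) (inr_mem_of_mem _ my mz mz₁ _)
  fin_cases i
  exacts [Or.inr (X₃_eq ▸ m _ h3), Or.inr r1, Or.inr r2, Or.inl hx.1, Or.inl hx.2]

/-- Since `kdvCore` is an ideal that contains all `A(u) - A(v)`, it contains the whole chain, and
the third subalgebra contains it. -/
theorem zcrSubalgebra_kdvA_three :
    (zcrSubalgebra kdvA 3 : Set KdVAlgebra) = zcrUnion kdvA := by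
  refine Set.Subset.antisymm (Set.subset_iUnion (fun k => (zcrSubalgebra kdvA k : Set KdVAlgebra)) 3)
    (Set.iUnion_subset fun k x hx => kdvCore_le ?_)
  exact zcrSubalgebra_le kdvA_sub_mem_kdvCore (fun Y _ a => lie_mem_kdvCore Y (kdvA a)) k hx

end KdVMiura

namespace KdVMiura

/-! ### Zero-curvature representations on a polydisc -/

section Weak

theorem sub_eq_sub_of_hasDerivAt {f g g' : ℂ → ℂ} {p : ℂ} {ε : ℝ}
    (hf : ∀ s ∈ Metric.ball p ε, HasDerivAt f (g' s) s)
    (hg : ∀ s ∈ Metric.ball p ε, HasDerivAt g (g' s) s) {s t : ℂ} (hs : s ∈ Metric.ball p ε)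
    (ht : t ∈ Metric.ball p ε) : f s - f t = g s - g t := by
  have h : ∀ x ∈ Metric.ball p ε, HasDerivAt (fun x => f x - g x) 0 x := fun x hx => by
    have := (hf x hx).sub (hg x hx)
    rwa [sub_self] at this
  have h1 := Metric.isOpen_ball.is_const_of_deriv_eq_zero (convex_ball p ε).isPreconnected
    (fun x hx => (h x hx).differentiableAt.differentiableWithinAt) (fun x hx => (h x hx).deriv) hs ht
  linear_combination h1

/-- A polynomial (of degree at most `5`, which covers all uses) that vanishes on a disc is zero. -/
theorem coeff_eq_zero_of_forall_mem_ball {p : ℂ} {ε : ℝ} (hε : 0 < ε) {c₀ c₁ c₂ c₃ c₄ c₅ : ℂ}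
    (h : ∀ u ∈ Metric.ball p ε,
      c₀ + u * c₁ + u ^ 2 * c₂ + u ^ 3 * c₃ + u ^ 4 * c₄ + u ^ 5 * c₅ = 0) :
    c₀ = 0 ∧ c₁ = 0 ∧ c₂ = 0 ∧ c₃ = 0 ∧ c₄ = 0 ∧ c₅ = 0 := by
  let P : Polynomial ℂ := Polynomial.C c₀ + Polynomial.C c₁ * Polynomial.X
    + Polynomial.C c₂ * Polynomial.X ^ 2 + Polynomial.C c₃ * Polynomial.X ^ 3
    + Polynomial.C c₄ * Polynomial.X ^ 4 + Polynomial.C c₅ * Polynomial.X ^ 5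
  have hinf : (Metric.ball p ε).Infinite := by
    refine infinite_of_mem_nhds p (Metric.ball_mem_nhds p hε)
  have hP : P = 0 := Polynomial.eq_zero_of_infinite_isRoot _ (hinf.mono fun u hu => by
    show P.eval u = 0
    simp only [P, Polynomial.eval_add, Polynomial.eval_mul, Polynomial.eval_C, Polynomial.eval_X,
      Polynomial.eval_pow]
    linear_combination h u hu)
  have hc : ∀ n, P.coeff n = 0 := fun n => by rw [hP, Polynomial.coeff_zero]
  have h0 := hc 0
  have h1 := hc 1
  have h2 := hc 2
  have h3 := hc 3
  have h4 := hc 4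
  have h5 := hc 5
  simp [P, Polynomial.coeff_X, Polynomial.coeff_C, Polynomial.coeff_X_pow] at h0 h1 h2 h3 h4 h5
  exact ⟨h0, h1, h2, h3, h4, h5⟩

variable {V : Type*} [AddCommGroup V] [Module ℂ V]

theorem smul_coeff_eq_zero_of_forall_mem_ball {p : ℂ} {ε : ℝ} (hε : 0 < ε)
    {c₀ c₁ c₂ c₃ c₄ c₅ : V} (h : ∀ u ∈ Metric.ball p ε,
      c₀ + u • c₁ + u ^ 2 • c₂ + u ^ 3 • c₃ + u ^ 4 • c₄ + u ^ 5 • c₅ = 0) :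
    c₀ = 0 ∧ c₁ = 0 ∧ c₂ = 0 ∧ c₃ = 0 ∧ c₄ = 0 ∧ c₅ = 0 := by
  have key : ∀ f : Module.Dual ℂ V,
      f c₀ = 0 ∧ f c₁ = 0 ∧ f c₂ = 0 ∧ f c₃ = 0 ∧ f c₄ = 0 ∧ f c₅ = 0 := fun f =>
    coeff_eq_zero_of_forall_mem_ball hε fun u hu => by
      simpa only [map_add, map_smul, map_zero, smul_eq_mul] using congrArg f (h u hu)
  simp only [← Module.forall_dual_apply_eq_zero_iff ℂ (_ : V)]
  exact ⟨fun f => (key f).1, fun f => (key f).2.1, fun f => (key f).2.2.1,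
    fun f => (key f).2.2.2.1, fun f => (key f).2.2.2.2.1, fun f => (key f).2.2.2.2.2⟩

variable {Λ : Set (Module.Dual ℂ V)}

theorem eq_of_separating (hΛ : ∀ X : V, (∀ ℓ ∈ Λ, ℓ X = 0) → X = 0) {x y : V}
    (h : ∀ ℓ ∈ Λ, ℓ x = ℓ y) : x = y :=
  sub_eq_zero.mp (hΛ _ fun ℓ hℓ => by rw [map_sub, h ℓ hℓ, sub_self])

/-- A vector-valued function whose weak derivative is a quadratic polynomial is a cubic
polynomial. -/
theorem exists_primitive (hΛ : ∀ X : V, (∀ ℓ ∈ Λ, ℓ X = 0) → X = 0) {p : ℂ} {ε : ℝ} (hε : 0 < ε)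
    {f : ℂ → V} {y₀ y₁ y₂ : V} (h : ∀ ℓ ∈ Λ, ∀ u ∈ Metric.ball p ε,
      HasDerivAt (fun s => ℓ (f s)) (ℓ (y₀ + u • y₁ + u ^ 2 • y₂)) u) :
    ∃ x, ∀ u ∈ Metric.ball p ε, f u = x + u • y₀ + (u ^ 2 / 2) • y₁ + (u ^ 3 / 3) • y₂ := by
  refine ⟨f p - p • y₀ - (p ^ 2 / 2) • y₁ - (p ^ 3 / 3) • y₂, fun u hu =>
    eq_of_separating hΛ fun ℓ hℓ => ?_⟩
  have h1 := sub_eq_sub_of_hasDerivAt (h ℓ hℓ)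
    (g := fun s => s * ℓ y₀ + s ^ 2 / 2 * ℓ y₁ + s ^ 3 / 3 * ℓ y₂) (fun s _ => by
      have h2 := (((hasDerivAt_id s).mul_const (ℓ y₀)).add
        ((((hasDerivAt_id s).pow 2).div_const 2).mul_const (ℓ y₁))).add
        ((((hasDerivAt_id s).pow 3).div_const 3).mul_const (ℓ y₂))
      refine h2.congr_deriv ?_
      simp only [map_add, map_smul, smul_eq_mul, id]
      push_cast
      ring) hu (Metric.mem_ball_self hε)
  simp only [map_add, map_sub, map_smul, smul_eq_mul]
  linear_combination h1

end Weak

section Local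

variable {L : Type*} [LieRing L] [LieAlgebra ℂ L]

/-- The `t`-part `B(u, u₁, u₂)` with the constant term `d` of a zero-curvature representation of
the KdV equation with the `x`-part `A = a + u b + ½ u² c`. -/
noncomputable def zcrB (a b c d : L) (q : Fin 3 → ℂ) : L :=
  (d + q 0 • ⁅a, ⁅a, b⁆⁆ + (q 0 ^ 2 / 2) • (b + ⁅b, ⁅a, b⁆⁆) + (q 0 ^ 3 / 3) • c)
    + q 2 • (b + q 0 • c) - (q 1 ^ 2 / 2) • c - q 1 • ⁅a, b⁆

/-- The `x`-part `A = a + u b + ½ u² c`. -/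
noncomputable def zcrA (a b c : L) (u : ℂ) : L := a + u • b + (u ^ 2 / 2) • c

/-- The part of the zero-curvature equation free of `u₁, u₂, u₃`, compared by powers of `u`. -/
theorem KdVRelations.of_lie_eq_zero {a b c d : L} (ac : ⁅a, c⁆ = 0) (bc : ⁅b, c⁆ = 0) {p : ℂ}
    {ε : ℝ} (hε : 0 < ε) (h : ∀ u ∈ Metric.ball p ε, ⁅zcrA a b c u,
      d + u • ⁅a, ⁅a, b⁆⁆ + (u ^ 2 / 2) • (b + ⁅b, ⁅a, b⁆⁆) + (u ^ 3 / 3) • c⁆ = 0) :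
    KdVRelations a b c d := by
  have ca : ⁅c, a⁆ = 0 := by rw [lie_eq_neg_of_lie_eq ac, neg_zero]
  have cb : ⁅c, b⁆ = 0 := by rw [lie_eq_neg_of_lie_eq bc, neg_zero]
  obtain ⟨m, hm⟩ : ∃ m, ⁅a, b⁆ = m := ⟨_, rfl⟩
  have cm : ⁅c, m⁆ = 0 := hm ▸ lie_lie_eq_zero_of_commute ca cb
  have cam : ⁅c, ⁅a, m⁆⁆ = 0 := lie_lie_eq_zero_of_commute ca cm
  have cbm : ⁅c, ⁅b, m⁆⁆ = 0 := lie_lie_eq_zero_of_commute cb cm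
  have ham : ⁅b, ⁅a, m⁆⁆ = ⁅a, ⁅b, m⁆⁆ := by
    rw [leibniz_lie a b m, hm, lie_self, zero_add]
  rw [hm] at h
  obtain ⟨h0, h1, h2, h3, -, -⟩ := smul_coeff_eq_zero_of_forall_mem_ball hε
    (c₀ := ⁅a, d⁆) (c₁ := ⁅b, d⁆ + ⁅a, ⁅a, m⁆⁆)
    (c₂ := (1 / 2 : ℂ) • ⁅c, d⁆ + (3 / 2 : ℂ) • ⁅a, ⁅b, m⁆⁆ + (1 / 2 : ℂ) • m)
    (c₃ := (1 / 2 : ℂ) • ⁅b, ⁅b, m⁆⁆) (c₄ := 0) (c₅ := 0) (fun u hu => by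
      refine Eq.trans ?_ (h u hu)
      rw [zcrA]
      simp only [lie_add, add_lie, smul_lie, lie_smul, hm, ham, ac, bc, cb, cam, cbm, lie_self,
        smul_zero, add_zero]
      module)
  refine ⟨ac, bc, h0, ?_, ?_, ?_⟩
  · rw [hm]; exact eq_neg_of_add_eq_zero_left h1
  · rw [hm]; linear_combination (norm := module) (2 : ℂ) • h2
  · rw [hm]; exact smul_eq_zero_of_ne (by norm_num) h3

/-- On a polydisc, the zero-curvature equation forces `A` and `B` to be polynomials whose
coefficients satisfy `KdVRelations`. Since `L` has no topology, a derivative of an `L`-valued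
function is known to be an element of `L` only once it is identified with a finite difference. -/
theorem zcr_box {Λ : Set (Module.Dual ℂ L)} (hΛ : ∀ X : L, (∀ ℓ ∈ Λ, ℓ X = 0) → X = 0)
    {p₀ p₁ p₂ : ℂ} {ε : ℝ} (hε : 0 < ε) {A : ℂ → L} {B : ℂ → ℂ → ℂ → L}
    (hA : ∀ ℓ ∈ Λ, ∀ u ∈ Metric.ball p₀ ε, DifferentiableAt ℂ (fun s => ℓ (A s)) u)
    (hB₀ : ∀ ℓ ∈ Λ, ∀ u ∈ Metric.ball p₀ ε, ∀ v ∈ Metric.ball p₁ ε, ∀ w ∈ Metric.ball p₂ ε,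
      DifferentiableAt ℂ (fun s => ℓ (B s v w)) u)
    (hB₁ : ∀ ℓ ∈ Λ, ∀ u ∈ Metric.ball p₀ ε, ∀ v ∈ Metric.ball p₁ ε, ∀ w ∈ Metric.ball p₂ ε,
      DifferentiableAt ℂ (fun s => ℓ (B u s w)) v)
    (hB₂ : ∀ ℓ ∈ Λ, ∀ u ∈ Metric.ball p₀ ε, ∀ v ∈ Metric.ball p₁ ε, ∀ w ∈ Metric.ball p₂ ε,
      DifferentiableAt ℂ (fun s => ℓ (B u v s)) w)
    (hZ : ∀ ℓ ∈ Λ, ∀ u ∈ Metric.ball p₀ ε, ∀ v ∈ Metric.ball p₁ ε, ∀ w ∈ Metric.ball p₂ ε, ∀ x : ℂ,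
      v * deriv (fun s => ℓ (B s v w)) u + w * deriv (fun s => ℓ (B u s w)) v
        + x * deriv (fun s => ℓ (B u v s)) w - (x + u * v) * deriv (fun s => ℓ (A s)) u
        + ℓ ⁅A u, B u v w⁆ = 0) :
    ∃ a b c d : L, KdVRelations a b c d ∧
      ∀ u ∈ Metric.ball p₀ ε, ∀ v ∈ Metric.ball p₁ ε, ∀ w ∈ Metric.ball p₂ ε,
        A u = zcrA a b c u ∧ B u v w = zcrB a b c d ![u, v, w] := by
  obtain ⟨δ, hδ0, hδ⟩ : ∃ δ : ℂ, δ ≠ 0 ∧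
      ∀ p : ℂ, p + δ ∈ Metric.ball p ε ∧ p - δ ∈ Metric.ball p ε := by
    refine ⟨((ε / 2 : ℝ) : ℂ), by exact_mod_cast (half_pos hε).ne', fun p => ?_⟩
    have h : ‖((ε / 2 : ℝ) : ℂ)‖ < ε := by
      rw [Complex.norm_real, Real.norm_of_nonneg (half_pos hε).le]; exact half_lt_self hε
    exact ⟨by simpa [Metric.mem_ball, dist_eq_norm] using h,
      by simpa [Metric.mem_ball, dist_eq_norm] using h⟩
  have m₁ := Metric.mem_ball_self (x := p₁) hε
  have m₂ := Metric.mem_ball_self (x := p₂) hε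
  -- `B` is affine in `w`, with the slope `C u = A'(u)`
  have a1 : ∀ ℓ ∈ Λ, ∀ u ∈ Metric.ball p₀ ε, ∀ v ∈ Metric.ball p₁ ε, ∀ w ∈ Metric.ball p₂ ε,
      deriv (fun s => ℓ (B u v s)) w = deriv (fun s => ℓ (A s)) u := fun ℓ hℓ u hu v hv w hw => by
    linear_combination hZ ℓ hℓ u hu v hv w hw 1 - hZ ℓ hℓ u hu v hv w hw 0
  have a2 : ∀ ℓ ∈ Λ, ∀ u ∈ Metric.ball p₀ ε, ∀ v ∈ Metric.ball p₁ ε, ∀ w ∈ Metric.ball p₂ ε,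
      ∀ w' ∈ Metric.ball p₂ ε,
      ℓ (B u v w) - ℓ (B u v w') = (w - w') * deriv (fun s => ℓ (A s)) u :=
    fun ℓ hℓ u hu v hv w hw w' hw' => by
      rw [sub_eq_sub_of_hasDerivAt (f := fun s => ℓ (B u v s))
        (g := fun s => s * deriv (fun s => ℓ (A s)) u)
        (g' := fun _ => deriv (fun s => ℓ (A s)) u)
        (fun s hs => a1 ℓ hℓ u hu v hv s hs ▸ (hB₂ ℓ hℓ u hu v hv s hs).hasDerivAt)
        (fun s _ => by simpa using (hasDerivAt_id s).mul_const _) hw hw']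
      ring
  obtain ⟨C, hC⟩ : ∃ C : ℂ → L, ∀ u, C u = δ⁻¹ • (B u p₁ (p₂ + δ) - B u p₁ p₂) := ⟨_, fun _ => rfl⟩
  have hCA : ∀ ℓ ∈ Λ, ∀ u ∈ Metric.ball p₀ ε, ℓ (C u) = deriv (fun s => ℓ (A s)) u :=
    fun ℓ hℓ u hu => by
      rw [hC, map_smul, map_sub, a2 ℓ hℓ u hu p₁ m₁ _ (hδ p₂).1 _ m₂, smul_eq_mul]
      field_simp
      ring
  have dC : ∀ ℓ ∈ Λ, ∀ u ∈ Metric.ball p₀ ε, DifferentiableAt ℂ (fun s => ℓ (C s)) u :=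
    fun ℓ hℓ u hu => by
      simp only [hC, map_smul, map_sub, smul_eq_mul]
      exact ((hB₀ ℓ hℓ u hu p₁ m₁ _ (hδ p₂).1).sub (hB₀ ℓ hℓ u hu p₁ m₁ _ m₂)).const_mul _
  obtain ⟨E, hE⟩ : ∃ E : ℂ → ℂ → L, ∀ u v, E u v = B u v p₂ - p₂ • C u := ⟨_, fun _ _ => rfl⟩
  have dE₀ : ∀ ℓ ∈ Λ, ∀ u ∈ Metric.ball p₀ ε, ∀ v ∈ Metric.ball p₁ ε,
      DifferentiableAt ℂ (fun s => ℓ (E s v)) u := fun ℓ hℓ u hu v hv => by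
    simp only [hE, map_smul, map_sub, smul_eq_mul]
    exact (hB₀ ℓ hℓ u hu v hv p₂ m₂).sub ((dC ℓ hℓ u hu).const_mul _)
  have dE₁ : ∀ ℓ ∈ Λ, ∀ u ∈ Metric.ball p₀ ε, ∀ v ∈ Metric.ball p₁ ε,
      DifferentiableAt ℂ (fun s => ℓ (E u s)) v := fun ℓ hℓ u hu v hv => by
    simp only [hE, map_smul, map_sub, smul_eq_mul]
    exact (hB₁ ℓ hℓ u hu v hv p₂ m₂).sub (differentiableAt_const _)
  have hBE : ∀ u ∈ Metric.ball p₀ ε, ∀ v ∈ Metric.ball p₁ ε, ∀ w ∈ Metric.ball p₂ ε,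
      B u v w = w • C u + E u v := fun u hu v hv w hw => eq_of_separating hΛ fun ℓ hℓ => by
    rw [hE, map_add, map_sub, map_smul, map_smul, smul_eq_mul, smul_eq_mul, hCA ℓ hℓ u hu]
    linear_combination a2 ℓ hℓ u hu v hv w hw p₂ m₂
  have near : ∀ {p u : ℂ}, u ∈ Metric.ball p ε → ∀ᶠ s in nhds u, s ∈ Metric.ball p ε := fun hu =>
    Metric.isOpen_ball.mem_nhds hu
  have b0 : ∀ ℓ ∈ Λ, ∀ u ∈ Metric.ball p₀ ε, ∀ v ∈ Metric.ball p₁ ε, ∀ w ∈ Metric.ball p₂ ε,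
      deriv (fun s => ℓ (B s v w)) u
        = w * deriv (fun s => ℓ (C s)) u + deriv (fun s => ℓ (E s v)) u :=
    fun ℓ hℓ u hu v hv w hw => by
      have h : (fun s => ℓ (B s v w)) =ᶠ[nhds u] fun s => w * ℓ (C s) + ℓ (E s v) := by
        filter_upwards [near hu] with s hs
        rw [hBE s hs v hv w hw, map_add, map_smul, smul_eq_mul]
      rw [h.deriv_eq]
      exact (((dC ℓ hℓ u hu).hasDerivAt.const_mul w).add (dE₀ ℓ hℓ u hu v hv).hasDerivAt).deriv
  have b1 : ∀ ℓ ∈ Λ, ∀ u ∈ Metric.ball p₀ ε, ∀ v ∈ Metric.ball p₁ ε, ∀ w ∈ Metric.ball p₂ ε,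
      deriv (fun s => ℓ (B u s w)) v = deriv (fun s => ℓ (E u s)) v :=
    fun ℓ hℓ u hu v hv w hw => by
      have h : (fun s => ℓ (B u s w)) =ᶠ[nhds v] fun s => w * ℓ (C u) + ℓ (E u s) := by
        filter_upwards [near hv] with s hs
        rw [hBE u hu s hs w hw, map_add, map_smul, smul_eq_mul]
      rw [h.deriv_eq]
      exact ((dE₁ ℓ hℓ u hu v hv).hasDerivAt.const_add (w * ℓ (C u))).deriv
  -- the parts of the equation of the degrees `1` and `0` in `w`
  have b2 : ∀ ℓ ∈ Λ, ∀ u ∈ Metric.ball p₀ ε, ∀ v ∈ Metric.ball p₁ ε,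
      v * deriv (fun s => ℓ (C s)) u + deriv (fun s => ℓ (E u s)) v + ℓ ⁅A u, C u⁆ = 0 ∧
      v * deriv (fun s => ℓ (E s v)) u - u * v * ℓ (C u) + ℓ ⁅A u, E u v⁆ = 0 := by
    intro ℓ hℓ u hu v hv
    have key : ∀ w ∈ Metric.ball p₂ ε,
        (v * deriv (fun s => ℓ (E s v)) u - u * v * ℓ (C u) + ℓ ⁅A u, E u v⁆) +
        w * (v * deriv (fun s => ℓ (C s)) u + deriv (fun s => ℓ (E u s)) v + ℓ ⁅A u, C u⁆)
          + w ^ 2 * 0 + w ^ 3 * 0 + w ^ 4 * 0 + w ^ 5 * 0 = 0 := fun w hw => by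
      have h := hZ ℓ hℓ u hu v hv w hw 0
      rw [b0 ℓ hℓ u hu v hv w hw, b1 ℓ hℓ u hu v hv w hw, hBE u hu v hv w hw, lie_add, lie_smul,
        map_add, map_smul, smul_eq_mul, ← hCA ℓ hℓ u hu] at h
      linear_combination h
    obtain ⟨h0, h1, -⟩ := coeff_eq_zero_of_forall_mem_ball hε key
    exact ⟨h1, h0⟩
  have c1 : ∀ ℓ ∈ Λ, ∀ u ∈ Metric.ball p₀ ε, ∀ v ∈ Metric.ball p₁ ε, ∀ v' ∈ Metric.ball p₁ ε,
      ℓ (E u v) - ℓ (E u v') = -((v ^ 2 - v' ^ 2) / 2) * deriv (fun s => ℓ (C s)) u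
        - (v - v') * ℓ ⁅A u, C u⁆ := fun ℓ hℓ u hu v hv v' hv' => by
    rw [sub_eq_sub_of_hasDerivAt (f := fun s => ℓ (E u s))
      (g := fun s => -(s ^ 2 / 2 * deriv (fun s => ℓ (C s)) u) - s * ℓ ⁅A u, C u⁆)
      (g' := fun s => -(s * deriv (fun s => ℓ (C s)) u) - ℓ ⁅A u, C u⁆)
      (fun s hs => (dE₁ ℓ hℓ u hu s hs).hasDerivAt.congr_deriv (by
        linear_combination (b2 ℓ hℓ u hu s hs).1))
      (fun s _ => by
        have h2 := ((((hasDerivAt_id s).pow 2).div_const 2).mul_const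
          (deriv (fun s => ℓ (C s)) u)).neg.sub ((hasDerivAt_id s).mul_const (ℓ ⁅A u, C u⁆))
        refine h2.congr_deriv ?_
        simp only [id]
        push_cast
        ring) hv hv']
    ring
  obtain ⟨C₂, hC₂⟩ : ∃ C₂ : ℂ → L, ∀ u, C₂ u =
      (-(δ ^ 2)⁻¹) • (E u (p₁ + δ) + E u (p₁ - δ) - (2 : ℂ) • E u p₁) := ⟨_, fun _ => rfl⟩
  have hCC : ∀ ℓ ∈ Λ, ∀ u ∈ Metric.ball p₀ ε, ℓ (C₂ u) = deriv (fun s => ℓ (C s)) u :=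
    fun ℓ hℓ u hu => by
      have h1 := c1 ℓ hℓ u hu _ (hδ p₁).1 p₁ m₁
      have h2 := c1 ℓ hℓ u hu _ (hδ p₁).2 p₁ m₁
      have h3 : ℓ (E u (p₁ + δ)) + ℓ (E u (p₁ - δ)) - 2 * ℓ (E u p₁) =
          -δ ^ 2 * deriv (fun s => ℓ (C s)) u := by linear_combination h1 + h2
      rw [hC₂, map_smul, map_sub, map_add, map_smul, smul_eq_mul, smul_eq_mul, h3]
      field_simp
  have dC₂ : ∀ ℓ ∈ Λ, ∀ u ∈ Metric.ball p₀ ε, DifferentiableAt ℂ (fun s => ℓ (C₂ s)) u :=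
    fun ℓ hℓ u hu => by
      simp only [hC₂, map_smul, map_sub, map_add, smul_eq_mul]
      exact (((dE₀ ℓ hℓ u hu _ (hδ p₁).1).add (dE₀ ℓ hℓ u hu _ (hδ p₁).2)).sub
        ((dE₀ ℓ hℓ u hu _ m₁).const_mul _)).const_mul _
  obtain ⟨F, hF⟩ : ∃ F : ℂ → L, ∀ u, F u = E u p₁ + (p₁ ^ 2 / 2) • C₂ u + p₁ • ⁅A u, C u⁆ :=
    ⟨_, fun _ => rfl⟩
  have hEF : ∀ u ∈ Metric.ball p₀ ε, ∀ v ∈ Metric.ball p₁ ε,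
      E u v = F u - (v ^ 2 / 2) • C₂ u - v • ⁅A u, C u⁆ := fun u hu v hv =>
    eq_of_separating hΛ fun ℓ hℓ => by
      rw [hF]
      simp only [map_add, map_sub, map_smul, smul_eq_mul, hCC ℓ hℓ u hu]
      linear_combination c1 ℓ hℓ u hu v hv p₁ m₁
  have dK : ∀ ℓ ∈ Λ, ∀ u ∈ Metric.ball p₀ ε, DifferentiableAt ℂ (fun s => ℓ ⁅A s, C s⁆) u :=
    fun ℓ hℓ u hu => by
      have h : (fun s => ℓ ⁅A s, C s⁆) =ᶠ[nhds u] fun s => δ⁻¹ * (ℓ (E s p₁) - ℓ (E s (p₁ + δ)) -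
          ((p₁ + δ) ^ 2 - p₁ ^ 2) / 2 * ℓ (C₂ s)) := by
        filter_upwards [near hu] with s hs
        have h1 := c1 ℓ hℓ s hs _ (hδ p₁).1 p₁ m₁
        rw [← hCC ℓ hℓ s hs] at h1
        field_simp
        linear_combination (2 : ℂ) * h1
      refine h.differentiableAt_iff.mpr ?_
      exact (((dE₀ ℓ hℓ u hu _ m₁).sub (dE₀ ℓ hℓ u hu _ (hδ p₁).1)).sub
        ((dC₂ ℓ hℓ u hu).const_mul _)).const_mul _
  have dF : ∀ ℓ ∈ Λ, ∀ u ∈ Metric.ball p₀ ε, DifferentiableAt ℂ (fun s => ℓ (F s)) u :=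
    fun ℓ hℓ u hu => by
      simp only [hF, map_smul, map_add, smul_eq_mul]
      exact ((dE₀ ℓ hℓ u hu _ m₁).add ((dC₂ ℓ hℓ u hu).const_mul _)).add
        ((dK ℓ hℓ u hu).const_mul _)
  -- the coefficients of the powers of `v`
  have e1 : ∀ ℓ ∈ Λ, ∀ u ∈ Metric.ball p₀ ε, deriv (fun s => ℓ (C₂ s)) u = 0 ∧
      deriv (fun s => ℓ ⁅A s, C s⁆) u + 1 / 2 * ℓ ⁅A u, C₂ u⁆ = 0 ∧
      deriv (fun s => ℓ (F s)) u - u * ℓ (C u) - ℓ ⁅A u, ⁅A u, C u⁆⁆ = 0 ∧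
      ℓ ⁅A u, F u⁆ = 0 := by
    intro ℓ hℓ u hu
    have key : ∀ v ∈ Metric.ball p₁ ε, ℓ ⁅A u, F u⁆ +
        v * (deriv (fun s => ℓ (F s)) u - u * ℓ (C u) - ℓ ⁅A u, ⁅A u, C u⁆⁆) +
        v ^ 2 * (-(deriv (fun s => ℓ ⁅A s, C s⁆) u + 1 / 2 * ℓ ⁅A u, C₂ u⁆)) +
        v ^ 3 * (-(1 / 2) * deriv (fun s => ℓ (C₂ s)) u) + v ^ 4 * 0 + v ^ 5 * 0 = 0 := by
      intro v hv
      have h1 : deriv (fun s => ℓ (E s v)) u = deriv (fun s => ℓ (F s)) u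
          - v ^ 2 / 2 * deriv (fun s => ℓ (C₂ s)) u - v * deriv (fun s => ℓ ⁅A s, C s⁆) u := by
        have h : (fun s => ℓ (E s v)) =ᶠ[nhds u]
            fun s => ℓ (F s) - v ^ 2 / 2 * ℓ (C₂ s) - v * ℓ ⁅A s, C s⁆ := by
          filter_upwards [near hu] with s hs
          rw [hEF s hs v hv]
          simp only [map_sub, map_smul, smul_eq_mul]
        rw [h.deriv_eq]
        exact (((dF ℓ hℓ u hu).hasDerivAt.sub ((dC₂ ℓ hℓ u hu).hasDerivAt.const_mul _)).sub
          ((dK ℓ hℓ u hu).hasDerivAt.const_mul _)).deriv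
      have h2 := (b2 ℓ hℓ u hu v hv).2
      rw [h1, hEF u hu v hv] at h2
      simp only [lie_sub, lie_smul, map_sub, map_smul, smul_eq_mul] at h2
      linear_combination h2
    obtain ⟨h0, h1, h2, h3, -⟩ := coeff_eq_zero_of_forall_mem_ball hε key
    refine ⟨?_, neg_eq_zero.mp h2, h1, h0⟩
    simpa using h3
  -- integration in `u`
  obtain ⟨c, hc⟩ := exists_primitive hΛ hε (f := C₂) (y₀ := 0) (y₁ := 0) (y₂ := 0)
    (fun ℓ hℓ u hu => by simpa [(e1 ℓ hℓ u hu).1] using (dC₂ ℓ hℓ u hu).hasDerivAt)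
  simp only [smul_zero, add_zero] at hc
  obtain ⟨b, hb⟩ := exists_primitive hΛ hε (f := C) (y₀ := c) (y₁ := 0) (y₂ := 0)
    (fun ℓ hℓ u hu => by
      simpa [← hCC ℓ hℓ u hu, hc u hu] using (dC ℓ hℓ u hu).hasDerivAt)
  simp only [smul_zero, add_zero] at hb
  obtain ⟨a, ha⟩ := exists_primitive hΛ hε (f := A) (y₀ := b) (y₁ := c) (y₂ := 0)
    (fun ℓ hℓ u hu => by
      rw [smul_zero, add_zero, ← hb u hu, hCA ℓ hℓ u hu]; exact (hA ℓ hℓ u hu).hasDerivAt)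
  simp only [smul_zero, add_zero] at ha
  obtain ⟨ac, bc⟩ : ⁅a, c⁆ = 0 ∧ ⁅b, c⁆ = 0 := by
    have h : ∀ u ∈ Metric.ball p₀ ε, ⁅a, c⁆ + u • ⁅b, c⁆ + u ^ 2 • (0 : L) + u ^ 3 • (0 : L)
        + u ^ 4 • (0 : L) + u ^ 5 • (0 : L) = 0 := fun u hu => by
      simp only [smul_zero, add_zero]
      refine hΛ _ fun ℓ hℓ => ?_
      have h1 := (e1 ℓ hℓ u hu).2.1
      have h2 : (fun s => ℓ ⁅A s, C s⁆) =ᶠ[nhds u]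
          fun s => ℓ ⁅a, b⁆ + s * ℓ ⁅a, c⁆ + s ^ 2 / 2 * ℓ ⁅b, c⁆ := by
        filter_upwards [near hu] with s hs
        have h3 : ⁅A s, C s⁆ = ⁅a, b⁆ + s • ⁅a, c⁆ + (s ^ 2 / 2) • ⁅b, c⁆ := by
          rw [ha s hs, hb s hs]
          simp only [lie_add, add_lie, smul_lie, lie_smul, lie_self]
          rw [← lie_skew b c]
          module
        rw [h3]
        simp only [map_add, map_smul, smul_eq_mul]
      have h4 : HasDerivAt (fun s => ℓ ⁅a, b⁆ + s * ℓ ⁅a, c⁆ + s ^ 2 / 2 * ℓ ⁅b, c⁆)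
          (ℓ ⁅a, c⁆ + u * ℓ ⁅b, c⁆) u := by
        have h5 := (((hasDerivAt_id u).mul_const (ℓ ⁅a, c⁆)).const_add (ℓ ⁅a, b⁆)).add
          ((((hasDerivAt_id u).pow 2).div_const 2).mul_const (ℓ ⁅b, c⁆))
        refine h5.congr_deriv ?_
        simp only [id]
        push_cast
        ring
      rw [h2.deriv_eq, h4.deriv, hc u hu, ha u hu] at h1
      simp only [add_lie, smul_lie, lie_self, map_add, map_smul, smul_eq_mul, smul_zero,
        map_zero] at h1
      simp only [map_add, map_smul, smul_eq_mul]
      linear_combination (2 / 3 : ℂ) * h1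
    obtain ⟨h0, h1, -⟩ := smul_coeff_eq_zero_of_forall_mem_ball hε h
    exact ⟨h0, h1⟩
  have ca : ⁅c, a⁆ = 0 := by rw [lie_eq_neg_of_lie_eq ac, neg_zero]
  have cb : ⁅c, b⁆ = 0 := by rw [lie_eq_neg_of_lie_eq bc, neg_zero]
  have hK : ∀ u ∈ Metric.ball p₀ ε, ⁅A u, C u⁆ = ⁅a, b⁆ := fun u hu => by
    rw [ha u hu, hb u hu]
    simp only [lie_add, add_lie, smul_lie, lie_smul, lie_self, ac, bc, cb]
    module
  obtain ⟨d, hd⟩ := exists_primitive hΛ hε (f := F) (y₀ := ⁅a, ⁅a, b⁆⁆)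
    (y₁ := b + ⁅b, ⁅a, b⁆⁆) (y₂ := c) (fun ℓ hℓ u hu => by
      refine (dF ℓ hℓ u hu).hasDerivAt.congr_deriv ?_
      have h := (e1 ℓ hℓ u hu).2.2.1
      rw [hK u hu, hb u hu, ha u hu] at h
      simp only [add_lie, smul_lie, lie_lie_eq_zero_of_commute ca cb, map_add, map_smul,
        smul_eq_mul, map_zero] at h
      simp only [map_add, map_smul, smul_eq_mul]
      linear_combination h)
  refine ⟨a, b, c, d, KdVRelations.of_lie_eq_zero (p := p₀) ac bc hε fun u hu => ?_,
    fun u hu v hv w hw => ⟨ha u hu, ?_⟩⟩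
  · have h : ⁅A u, F u⁆ = 0 := hΛ _ fun ℓ hℓ => (e1 ℓ hℓ u hu).2.2.2
    rwa [ha u hu, hd u hu] at h
  · rw [hBE u hu v hv w hw, hEF u hu v hv, hd u hu, hc u hu, hK u hu, hb u hu, zcrB]
    simp only [Matrix.cons_val_zero, Matrix.cons_val_one, Matrix.cons_val]
    module

end Local
end KdVMiura

namespace KdVMiura

/-! ### The universal property -/

section Universal

variable {L : Type*} [LieRing L] [LieAlgebra ℂ L]

theorem update_vec_zero (u v w s : ℂ) : Function.update ![u, v, w] 0 s = ![s, v, w] := by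
  ext i; fin_cases i <;> rfl

theorem update_vec_one (u v w s : ℂ) : Function.update ![u, v, w] 1 s = ![u, s, w] := by
  ext i; fin_cases i <;> rfl

theorem update_vec_two (u v w s : ℂ) : Function.update ![u, v, w] 2 s = ![u, v, s] := by
  ext i; fin_cases i <;> rfl

theorem update_mem_ball {p : Fin 3 → ℂ} {ε : ℝ} (hε : 0 < ε) {u : ℂ}
    (hu : u ∈ Metric.ball (p 0) ε) : Function.update p 0 u ∈ Metric.ball p ε := by
  rw [ball_pi _ hε]
  intro i _
  by_cases hi : i = 0
  · subst hi; simpa using hu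
  · rw [Function.update_of_ne hi]; exact Metric.mem_ball_self hε

/-- The zero-curvature equation of the KdV equation, with the summation written out. -/
theorem zeroCurvature_iff {A : ℂ → L} {B : (Fin 3 → ℂ) → L} {D : Set (Fin 3 → ℂ)}
    {ℓ : Module.Dual ℂ L} : (∀ u : ℕ → ℂ, (fun i : Fin 3 => u i) ∈ D →
      (∑ i : Fin 3, u (i + 1) *
        deriv (fun s => ℓ (B (Function.update (fun i : Fin 3 => u i) i s))) (u i))
      - kdv u * deriv (fun s => ℓ (A s)) (u 0) + ℓ ⁅A (u 0), B (fun i : Fin 3 => u i)⁆ = 0) ↔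
    ∀ u v w x : ℂ, ![u, v, w] ∈ D →
      v * deriv (fun s => ℓ (B ![s, v, w])) u + w * deriv (fun s => ℓ (B ![u, s, w])) v
        + x * deriv (fun s => ℓ (B ![u, v, s])) w - (x + u * v) * deriv (fun s => ℓ (A s)) u
        + ℓ ⁅A u, B ![u, v, w]⁆ = 0 := by
  have hv : ∀ u : ℕ → ℂ, (fun i : Fin 3 => u i) = ![u 0, u 1, u 2] := fun u => by
    ext i; fin_cases i <;> rfl
  have hs : ∀ u : ℕ → ℂ, (∑ i : Fin 3, u (i + 1) *
      deriv (fun s => ℓ (B (Function.update (fun i : Fin 3 => u i) i s))) (u i)) =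
      u 1 * deriv (fun s => ℓ (B ![s, u 1, u 2])) (u 0)
        + u 2 * deriv (fun s => ℓ (B ![u 0, s, u 2])) (u 1)
        + u 3 * deriv (fun s => ℓ (B ![u 0, u 1, s])) (u 2) := fun u => by
    rw [Fin.sum_univ_three]
    simp only [hv, update_vec_zero, update_vec_one, update_vec_two]
    rfl
  constructor
  · intro h u v w x hD
    obtain ⟨U, h0, h1, h2, h3⟩ : ∃ U : ℕ → ℂ, U 0 = u ∧ U 1 = v ∧ U 2 = w ∧ U 3 = x :=
      ⟨fun k => if k = 0 then u else if k = 1 then v else if k = 2 then w else x,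
        rfl, rfl, rfl, rfl⟩
    have h' := h U (by rw [hv, h0, h1, h2]; exact hD)
    rw [hs, hv, kdv, h0, h1, h2, h3] at h'
    exact h'
  · intro h u hD
    rw [hv] at hD
    rw [hs, hv]
    exact h (u 0) (u 1) (u 2) (u 3) hD

/-- Near a point of its domain, a zero-curvature representation of the KdV equation is a
polynomial whose coefficients satisfy `KdVRelations`. -/
theorem IsZCR.exists_relations {Λ : Set (Module.Dual ℂ L)}
    (hΛ : ∀ X : L, (∀ ℓ ∈ Λ, ℓ X = 0) → X = 0) {D : Set (Fin 3 → ℂ)} (hD : IsOpen D) {A : ℂ → L}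
    {B : (Fin 3 → ℂ) → L} (H : IsZCR 3 kdv Λ D A B) {p : Fin 3 → ℂ} (hp : p ∈ D) :
    ∃ ε > 0, Metric.ball p ε ⊆ D ∧ ∃ a b c d : L, KdVRelations a b c d ∧
      (∀ u ∈ Metric.ball (p 0) ε, A u = zcrA a b c u) ∧
      ∀ q ∈ Metric.ball p ε, B q = zcrB a b c d q := by
  obtain ⟨ε, hε, hball⟩ := Metric.isOpen_iff.mp hD p hp
  have hbox : ∀ u ∈ Metric.ball (p 0) ε, ∀ v ∈ Metric.ball (p 1) ε, ∀ w ∈ Metric.ball (p 2) ε,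
      ![u, v, w] ∈ D := fun u hu v hv w hw => hball (by
    rw [ball_pi _ hε]
    intro i _
    fin_cases i
    exacts [hu, hv, hw])
  have hd : ∀ ℓ ∈ Λ, ∀ u v w, ![u, v, w] ∈ D → ∀ i : Fin 3, DifferentiableAt ℂ
      (fun s => ℓ (B (Function.update ![u, v, w] i s))) (![u, v, w] i) := fun ℓ hℓ u v w h i => by
    have h1 : DifferentiableAt ℂ (fun b => ℓ (B b))
        (Function.update ![u, v, w] i (![u, v, w] i)) := by
      rw [Function.update_eq_self]
      exact (H.analytic_B ℓ hℓ _ h).differentiableAt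
    exact h1.comp (![u, v, w] i) (hasFDerivAt_update ![u, v, w] (![u, v, w] i)).differentiableAt
  have hA : ∀ ℓ ∈ Λ, ∀ u ∈ Metric.ball (p 0) ε, DifferentiableAt ℂ (fun s => ℓ (A s)) u :=
    fun ℓ hℓ u hu => (H.analytic_A ℓ hℓ u ⟨_, hbox u hu _ (Metric.mem_ball_self hε) _
      (Metric.mem_ball_self hε), rfl⟩).differentiableAt
  obtain ⟨a, b, c, d, hR, hAB⟩ := zcr_box (A := A) (B := fun u v w => B ![u, v, w]) hΛ hε hA
    (fun ℓ hℓ u hu v hv w hw => by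
      have h := hd ℓ hℓ u v w (hbox u hu v hv w hw) 0
      simp only [update_vec_zero] at h
      exact h)
    (fun ℓ hℓ u hu v hv w hw => by
      have h := hd ℓ hℓ u v w (hbox u hu v hv w hw) 1
      simp only [update_vec_one] at h
      exact h)
    (fun ℓ hℓ u hu v hv w hw => by
      have h := hd ℓ hℓ u v w (hbox u hu v hv w hw) 2
      simp only [update_vec_two] at h
      exact h)
    (fun ℓ hℓ u hu v hv w hw x => zeroCurvature_iff.mp (H.zero_curvature ℓ hℓ) u v w x
      (hbox u hu v hv w hw))
  refine ⟨ε, hε, hball, a, b, c, d, hR, fun u hu => (hAB u hu _ (Metric.mem_ball_self hε) _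
      (Metric.mem_ball_self hε)).1, fun q hq => ?_⟩
  rw [ball_pi _ hε] at hq
  have hq' : q = ![q 0, q 1, q 2] := by ext i; fin_cases i <;> rfl
  rw [hq']
  exact (hAB _ (hq 0 trivial) _ (hq 1 trivial) _ (hq 2 trivial)).2

theorem analyticOnNhd_zcrA (ℓ : Module.Dual ℂ L) (a b c : L) (s : Set ℂ) :
    AnalyticOnNhd ℂ (fun u => ℓ (zcrA a b c u)) s := fun u _ => by
  simp only [zcrA, map_add, map_smul, smul_eq_mul]
  fun_prop

theorem analyticOnNhd_zcrB (ℓ : Module.Dual ℂ L) (a b c d : L) (s : Set (Fin 3 → ℂ)) :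
    AnalyticOnNhd ℂ (fun q => ℓ (zcrB a b c d q)) s := fun q _ => by
  have h : ∀ i : Fin 3, AnalyticAt ℂ (fun q : Fin 3 → ℂ => q i) q := fun i =>
    (ContinuousLinearMap.proj (R := ℂ) (φ := fun _ : Fin 3 => ℂ) i).analyticAt q
  simp only [zcrB, map_add, map_sub, map_smul, smul_eq_mul]
  have hc : ∀ c : ℂ, AnalyticAt ℂ (fun _ : Fin 3 → ℂ => c) q := fun c => analyticAt_const
  have h2 := ((h 0).pow 2).div (hc 2) two_ne_zero
  have h3 := ((h 0).pow 3).div (hc 3) three_ne_zero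
  have h1 := ((h 1).pow 2).div (hc 2) two_ne_zero
  exact ((((((hc _).add ((h 0).mul (hc _))).add (h2.mul (hc _))).add (h3.mul (hc _))).add
    ((h 2).mul ((hc _).add ((h 0).mul (hc _))))).sub (h1.mul (hc _))).sub ((h 1).mul (hc _))

/-- Elements with the relations `KdVRelations` define a zero-curvature representation. -/
theorem KdVRelations.isZCR {a b c d : L} (H : KdVRelations a b c d) :
    IsZCR 3 kdv Set.univ Set.univ (zcrA a b c) (zcrB a b c d) := by
  refine ⟨fun ℓ _ => analyticOnNhd_zcrA ℓ a b c _, fun ℓ _ => analyticOnNhd_zcrB ℓ a b c d _,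
    fun ℓ _ => zeroCurvature_iff.mpr fun u v w x _ => ?_⟩
  obtain ⟨ac, bc, ad, bd, cd, bbm⟩ := H
  have ca : ⁅c, a⁆ = 0 := by rw [lie_eq_neg_of_lie_eq ac, neg_zero]
  have cb : ⁅c, b⁆ = 0 := by rw [lie_eq_neg_of_lie_eq bc, neg_zero]
  obtain ⟨m, hm⟩ : ∃ m, ⁅a, b⁆ = m := ⟨_, rfl⟩
  have cm : ⁅c, m⁆ = 0 := hm ▸ lie_lie_eq_zero_of_commute ca cb
  have cam : ⁅c, ⁅a, m⁆⁆ = 0 := lie_lie_eq_zero_of_commute ca cm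
  have cbm : ⁅c, ⁅b, m⁆⁆ = 0 := lie_lie_eq_zero_of_commute cb cm
  have ham : ⁅b, ⁅a, m⁆⁆ = ⁅a, ⁅b, m⁆⁆ := by
    rw [leibniz_lie a b m, hm, lie_self, zero_add]
  rw [hm] at bd cd bbm
  have dA : deriv (fun s => ℓ (zcrA a b c s)) u = ℓ (b + u • c) := by
    simp only [zcrA, map_add, map_smul, smul_eq_mul]
    have h := (((hasDerivAt_id u).mul_const (ℓ b)).const_add (ℓ a)).add
      ((((hasDerivAt_id u).pow 2).div_const 2).mul_const (ℓ c))
    refine (h.congr_deriv ?_).deriv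
    simp only [id]; push_cast; ring
  have d0 : deriv (fun s => ℓ (zcrB a b c d ![s, v, w])) u =
      ℓ (⁅a, m⁆ + u • (b + ⁅b, m⁆) + u ^ 2 • c + w • c) := by
    simp only [zcrB, hm, map_add, map_sub, map_smul, smul_eq_mul, Matrix.cons_val_zero,
      Matrix.cons_val_one, Matrix.cons_val]
    have h := ((((((hasDerivAt_id u).mul_const (ℓ ⁅a, m⁆)).const_add (ℓ d)).add
      ((((hasDerivAt_id u).pow 2).div_const 2).mul_const (ℓ b + ℓ ⁅b, m⁆))).add
      ((((hasDerivAt_id u).pow 3).div_const 3).mul_const (ℓ c))).add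
      ((((hasDerivAt_id u).mul_const (ℓ c)).const_add (ℓ b)).const_mul w)).sub_const
      (v ^ 2 / 2 * ℓ c) |>.sub_const (v * ℓ m)
    refine (h.congr_deriv ?_).deriv
    simp only [id]; push_cast; ring
  have d1 : deriv (fun s => ℓ (zcrB a b c d ![u, s, w])) v = ℓ (-(v • c) - m) := by
    simp only [zcrB, hm, map_add, map_sub, map_smul, smul_eq_mul, Matrix.cons_val_zero,
      Matrix.cons_val_one, Matrix.cons_val, map_neg]
    have h := (((((hasDerivAt_id v).pow 2).div_const 2).mul_const (ℓ c)).const_sub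
      (ℓ d + u * ℓ ⁅a, m⁆ + u ^ 2 / 2 * (ℓ b + ℓ ⁅b, m⁆) + u ^ 3 / 3 * ℓ c + w * (ℓ b + u * ℓ c))).sub
      ((hasDerivAt_id v).mul_const (ℓ m))
    refine (h.congr_deriv ?_).deriv
    simp only [id]; push_cast; ring
  have d2 : deriv (fun s => ℓ (zcrB a b c d ![u, v, s])) w = ℓ (b + u • c) := by
    simp only [zcrB, hm, map_add, map_sub, map_smul, smul_eq_mul, Matrix.cons_val_zero,
      Matrix.cons_val_one, Matrix.cons_val]
    have h := (((hasDerivAt_id w).mul_const (ℓ b + u * ℓ c)).const_add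
      (ℓ d + u * ℓ ⁅a, m⁆ + u ^ 2 / 2 * (ℓ b + ℓ ⁅b, m⁆) + u ^ 3 / 3 * ℓ c)).sub_const
      (v ^ 2 / 2 * ℓ c) |>.sub_const (v * ℓ m)
    refine (h.congr_deriv ?_).deriv
    ring
  rw [dA, d0, d1, d2]
  simp only [← smul_eq_mul, ← map_smul, ← map_add, ← map_sub]
  rw [← map_zero ℓ]
  congr 1
  rw [zcrA, zcrB, hm]
  simp only [Matrix.cons_val_zero, Matrix.cons_val_one, Matrix.cons_val, lie_add, lie_sub, add_lie,
    smul_lie, lie_smul, hm, ham, ac, bc, cb, cm, cam, cbm, bbm, ad, bd, cd, lie_self]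
  module

theorem map_zcrA {M : Type*} [LieRing M] [LieAlgebra ℂ M] (φ : L →ₗ⁅ℂ⁆ M) (a b c : L) (u : ℂ) :
    φ (zcrA a b c u) = zcrA (φ a) (φ b) (φ c) u := by
  simp only [zcrA, map_add, map_smul]

theorem map_zcrB {M : Type*} [LieRing M] [LieAlgebra ℂ M] (φ : L →ₗ⁅ℂ⁆ M) (a b c d : L)
    (q : Fin 3 → ℂ) : φ (zcrB a b c d q) = zcrB (φ a) (φ b) (φ c) (φ d) q := by
  simp only [zcrB, map_add, map_sub, map_smul, LieHom.map_lie]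

theorem zcrA_third (a b c : L) (u : ℂ) :
    zcrA a ((1 / 3 : ℂ) • b) ((1 / 3 : ℂ) • c) u = a + (u / 3) • b + (u ^ 2 / 6) • c := by
  rw [zcrA]; module

theorem kdvA_eq : kdvA = zcrA X₁ ((1 / 3 : ℂ) • X₂) ((1 / 3 : ℂ) • X₃) :=
  funext fun u => (zcrA_third X₁ X₂ X₃ u).symm

theorem zcrA_injective {a b c a' b' c' : L} {p : ℂ} {ε : ℝ} (hε : 0 < ε)
    (h : ∀ u ∈ Metric.ball p ε, zcrA a b c u = zcrA a' b' c' u) : a = a' ∧ b = b' ∧ c = c' := by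
  obtain ⟨h0, h1, h2, -⟩ := smul_coeff_eq_zero_of_forall_mem_ball hε (c₀ := a - a') (c₁ := b - b')
    (c₂ := (1 / 2 : ℂ) • (c - c')) (c₃ := 0) (c₄ := 0) (c₅ := 0) fun u hu => by
      have h1 := h u hu
      rw [zcrA, zcrA] at h1
      linear_combination (norm := module) h1
  exact ⟨sub_eq_zero.mp h0, sub_eq_zero.mp h1,
    sub_eq_zero.mp (smul_eq_zero_of_ne (by norm_num) h2)⟩

theorem zcrB_injective {a b c d d' : L} {q : Fin 3 → ℂ}
    (h : zcrB a b c d q = zcrB a b c d' q) : d = d' := by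
  rw [zcrB, zcrB] at h
  linear_combination (norm := module) h

/-- A representation on a connected domain is a polynomial near one point, hence everywhere by the
identity theorem; its coefficients define the homomorphism. -/
theorem isWahlquistEstabrook_kdv : IsWahlquistEstabrook.{w} 3 kdv kdvA
    (zcrB X₁ ((1 / 3 : ℂ) • X₂) ((1 / 3 : ℂ) • X₃) X₀) := by
  refine ⟨kdvA_eq ▸ KdVRelations.model.isZCR, ?_⟩
  intro 𝔤 _ _ Λ hΛ D hD hconn A' B' H
  obtain ⟨p, hp⟩ := hconn.nonempty
  obtain ⟨ε, hε, hball, a, b, c, d, hR, hA, hB⟩ := H.exists_relations hΛ hD hp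
  have hA' : ∀ q ∈ D, A' (q 0) = zcrA a b c (q 0) := fun q hq => eq_of_separating hΛ fun ℓ hℓ => by
    refine (H.analytic_A ℓ hℓ).eqOn_of_preconnected_of_eventuallyEq (analyticOnNhd_zcrA ℓ a b c _)
      (hconn.isPreconnected.image _ (continuous_apply 0).continuousOn) ⟨p, hp, rfl⟩ ?_ ⟨q, hq, rfl⟩
    filter_upwards [Metric.ball_mem_nhds (p 0) hε] with u hu
    rw [hA u hu]
  have hB' : ∀ q ∈ D, B' q = zcrB a b c d q := fun q hq => eq_of_separating hΛ fun ℓ hℓ => by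
    refine (H.analytic_B ℓ hℓ).eqOn_of_preconnected_of_eventuallyEq (analyticOnNhd_zcrB ℓ a b c d _)
      hconn.isPreconnected hp ?_ hq
    filter_upwards [Metric.ball_mem_nhds p hε] with u hu
    rw [hB u hu]
  obtain ⟨φ, h1, h2, h3, h0⟩ := hR.exists_lieHom
  have third : ∀ x : 𝔤, (1 / 3 : ℂ) • (3 : ℂ) • x = x := fun x => by module
  have h2' : φ ((1 / 3 : ℂ) • X₂) = b := by rw [map_smul, h2, third]
  have h3' : φ ((1 / 3 : ℂ) • X₃) = c := by rw [map_smul, h3, third]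
  refine ⟨φ, fun q hq => ⟨?_, ?_⟩, fun ψ hψ => ?_⟩
  · rw [hA' q hq, kdvA_eq, map_zcrA, h1, h2', h3']
  · rw [hB' q hq, map_zcrB, h1, h2', h3', h0]
  · obtain ⟨k1, k2, k3⟩ := zcrA_injective (p := p 0) hε (a := ψ X₁) (b := ψ ((1 / 3 : ℂ) • X₂))
      (c := ψ ((1 / 3 : ℂ) • X₃)) (a' := a) (b' := b) (c' := c) fun u hu => by
        have hq : Function.update p 0 u ∈ D := hball (update_mem_ball hε hu)
        have h := (hψ _ hq).1
        rw [hA' _ hq, kdvA_eq, map_zcrA, Function.update_self] at h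
        exact h.symm
    have k0 : ψ X₀ = d := by
      have h := (hψ p hp).2
      rw [hB' p hp, map_zcrB, k1, k2, k3] at h
      exact (zcrB_injective h).symm
    have inj : ∀ {x y : 𝔤}, (1 / 3 : ℂ) • x = y → x = (3 : ℂ) • y := fun h => by rw [← h]; module
    rw [map_smul] at k2 k3
    exact lieHom_ext (k1.trans h1.symm) ((inj k2).trans h2.symm) ((inj k3).trans h3.symm)
      (k0.trans h0.symm)

end Universal
end KdVMiura

namespace KdVMiura
open Filter Topology
/-! ### Truncated jet spaces -/

section Jets

/-- The space of the truncated jets `(x, t, v₀, …, v_{N-1})`. -/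
abbrev Jet (N : ℕ) : Type := ℂ × ℂ × (Fin N → ℂ)

/-- The coordinate `vⱼ` of a truncated jet, which is zero for `j ≥ N`. -/
noncomputable def Jet.coord (N j : ℕ) : Jet N →L[ℂ] ℂ :=
  if h : j < N then (ContinuousLinearMap.proj (R := ℂ) (φ := fun _ : Fin N => ℂ) ⟨j, h⟩).comp
    ((ContinuousLinearMap.snd ℂ ℂ (Fin N → ℂ)).comp (ContinuousLinearMap.snd ℂ ℂ (ℂ × (Fin N → ℂ))))
  else 0

/-- The coordinate vector `∂/∂vⱼ`, which is zero for `j ≥ N`. -/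
def Jet.basisVec (N j : ℕ) : Jet N := (0, 0, fun i => if (i : ℕ) = j then 1 else 0)

/-- The truncation of an infinite jet. -/
def Jet.trunc (N : ℕ) (x t : ℂ) (v : ℕ → ℂ) : Jet N := (x, t, fun i => v i)

open Jet

variable {N : ℕ}

theorem Jet.coord_of_lt {j : ℕ} (h : j < N) (z : Jet N) : coord N j z = z.2.2 ⟨j, h⟩ := by
  rw [coord, dif_pos h]; rfl

theorem Jet.coord_of_le {j : ℕ} (h : N ≤ j) (z : Jet N) : coord N j z = 0 := by
  rw [coord, dif_neg h.not_gt]; rfl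

theorem Jet.coord_fin (i : Fin N) (z : Jet N) : coord N i z = z.2.2 i := coord_of_lt i.2 z

theorem Jet.basisVec_of_le {j : ℕ} (h : N ≤ j) : basisVec N j = 0 := by
  refine Prod.ext rfl (Prod.ext rfl (funext fun i => if_neg ?_))
  have := i.2
  omega

theorem Jet.coord_basisVec_self {j : ℕ} (h : j < N) : coord N j (basisVec N j) = 1 := by
  rw [coord_of_lt h]; exact if_pos rfl

theorem Jet.coord_basisVec_of_ne {i j : ℕ} (h : i ≠ j) : coord N i (basisVec N j) = 0 := by
  by_cases hi : i < N
  · rw [coord_of_lt hi]; exact if_neg h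
  · exact coord_of_le (not_lt.mp hi) _

theorem Jet.eq_add_sum (z : Jet N) :
    z = ((z.1, z.2.1, 0) : Jet N) + ∑ i : Fin N, z.2.2 i • basisVec N i := by
  refine Prod.ext ?_ (Prod.ext ?_ (funext fun i => ?_))
  · simp [Prod.fst_sum, basisVec]
  · simp [Prod.fst_sum, Prod.snd_sum, basisVec]
  · simp [Prod.snd_sum, basisVec, Finset.sum_apply, Fin.val_inj]

/-- A linear map that kills `∂/∂vⱼ` for `j ≥ K` depends only on the components of its argument
along `∂/∂x`, `∂/∂t` and `∂/∂vⱼ` for `j < K`. -/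
theorem Jet.map_eq_of_forall_lt {F : Type*} [AddCommGroup F] [Module ℂ F] [TopologicalSpace F]
    {T : Jet N →L[ℂ] F} {K : ℕ} (hT : ∀ j, K ≤ j → T (basisVec N j) = 0) {z z' : Jet N}
    (h1 : z.1 = z'.1) (h2 : z.2.1 = z'.2.1) (h : ∀ i : Fin N, (i : ℕ) < K → z.2.2 i = z'.2.2 i) :
    T z = T z' := by
  rw [eq_add_sum z, eq_add_sum z', map_add, map_add, h1, h2, map_sum, map_sum]
  congr 1
  refine Finset.sum_congr rfl fun i _ => ?_
  rw [map_smul, map_smul]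
  by_cases hi : (i : ℕ) < K
  · rw [h i hi]
  · rw [hT i (not_lt.mp hi), smul_zero, smul_zero]

/-- The linear part of the vector field `D_x` on truncated jets. -/
noncomputable def Jet.shift (N : ℕ) : Jet N →L[ℂ] Jet N :=
  (0 : Jet N →L[ℂ] ℂ).prod ((0 : Jet N →L[ℂ] ℂ).prod
    (ContinuousLinearMap.pi fun i : Fin N => coord N (i + 1)))

/-- The vector field `D_x = ∂/∂x + ∑ vᵢ₊₁ ∂/∂vᵢ` on truncated jets; the component along the last
coordinate is set to zero. -/
noncomputable def Jet.fieldX (z : Jet N) : Jet N := (1, 0, 0) + shift N z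

/-- The derivative along the vector field `D_x`. -/
noncomputable def Jet.dX (f : Jet N → ℂ) : Jet N → ℂ := fun z => fderiv ℂ f z (fieldX z)

theorem Jet.shift_apply (z : Jet N) : shift N z = (0, 0, fun i : Fin N => coord N (i + 1) z) := rfl

theorem Jet.fieldX_eq (z : Jet N) : fieldX z = (1, 0, fun i : Fin N => coord N (i + 1) z) := by
  rw [fieldX, shift_apply]
  simp

theorem Jet.shift_basisVec_succ {j : ℕ} (h : j + 1 < N) :
    shift N (basisVec N (j + 1)) = basisVec N j := by
  rw [shift_apply]
  refine Prod.ext rfl (Prod.ext rfl (funext fun i => ?_))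
  show coord N (i + 1) (basisVec N (j + 1)) = if (i : ℕ) = j then 1 else 0
  split_ifs with hi
  · rw [hi, coord_basisVec_self h]
  · exact coord_basisVec_of_ne (by omega)

theorem Jet.hasFDerivAt_fieldX (z : Jet N) : HasFDerivAt fieldX (shift N) z :=
  (shift N).hasFDerivAt.const_add _

theorem Jet.analyticAt_fieldX (z : Jet N) : AnalyticAt ℂ fieldX z :=
  analyticAt_const.add ((shift N).analyticAt z)

/-- The function `f` does not depend on the coordinates `vⱼ`, `j ≥ K`, at the points of `U`. -/
def Jet.Dep (U : Set (Jet N)) (f : Jet N → ℂ) (K : ℕ) : Prop :=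
  ∀ z ∈ U, ∀ j, K ≤ j → fderiv ℂ f z (basisVec N j) = 0

theorem Jet.Dep.mono {U : Set (Jet N)} {f : Jet N → ℂ} {K K' : ℕ} (h : Dep U f K) (hK : K ≤ K') :
    Dep U f K' := fun z hz j hj => h z hz j (hK.trans hj)

theorem analyticAt_fderiv_apply {E E' : Type*} [NormedAddCommGroup E] [NormedSpace ℂ E]
    [NormedAddCommGroup E'] [NormedSpace ℂ E'] {f : E → ℂ} {p : E' → E} {X : E' → E} {z : E'}
    (hf : AnalyticAt ℂ f (p z)) (hX : AnalyticAt ℂ X z)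
    (hp : AnalyticAt ℂ p z := by exact analyticAt_id) :
    AnalyticAt ℂ (fun z => fderiv ℂ f (p z) (X z)) z :=
  ((ContinuousLinearMap.id ℂ (E →L[ℂ] ℂ)).analyticAt_bilinear _).comp₂ (hf.fderiv.comp hp) hX

/-- The derivative of `z ↦ df(X(z))` for a vector field `X`. -/
theorem hasFDerivAt_fderiv_apply {E : Type*} [NormedAddCommGroup E] [NormedSpace ℂ E] {f : E → ℂ}
    {X : E → E} {X' : E →L[ℂ] E} {z : E} (hf : AnalyticAt ℂ f z) (hX : HasFDerivAt X X' z) :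
    HasFDerivAt (fun z => fderiv ℂ f z (X z))
      ((fderiv ℂ f z).comp X' + (fderiv ℂ (fderiv ℂ f) z).flip (X z)) z :=
  hf.fderiv.differentiableAt.hasFDerivAt.clm_apply hX

theorem fderiv_fderiv_symm {E : Type*} [NormedAddCommGroup E] [NormedSpace ℂ E] {f : E → ℂ}
    {z : E} (hf : AnalyticAt ℂ f z) (v w : E) :
    fderiv ℂ (fderiv ℂ f) z v w = fderiv ℂ (fderiv ℂ f) z w v :=
  (hf.contDiffAt (n := ⊤)).isSymmSndFDerivAt (by simp) v w

/-- A derivative of `df(X)` in a direction in which the derivative of `f` vanishes. -/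
theorem fderiv_fderiv_apply_of_eventually_eq_zero {E : Type*} [NormedAddCommGroup E]
    [NormedSpace ℂ E] {f : E → ℂ} {X : E → E} {X' : E →L[ℂ] E} {z v : E} (hf : AnalyticAt ℂ f z)
    (hX : HasFDerivAt X X' z) (hv : ∀ᶠ z' in 𝓝 z, fderiv ℂ f z' v = 0) :
    fderiv ℂ (fun z => fderiv ℂ f z (X z)) z v = fderiv ℂ f z (X' v) := by
  have h0 : fderiv ℂ (fderiv ℂ f) z (X z) v = 0 := by
    have h1 := hf.fderiv.differentiableAt.hasFDerivAt.clm_apply (hasFDerivAt_const v z)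
    have h2 : HasFDerivAt (fun z' => fderiv ℂ f z' v) (0 : E →L[ℂ] ℂ) z :=
      (hasFDerivAt_const (0 : ℂ) z).congr_of_eventuallyEq hv
    have h3 := congrArg (fun T : E →L[ℂ] ℂ => T (X z)) (h1.unique h2)
    simpa using h3
  rw [(hasFDerivAt_fderiv_apply hf hX).fderiv]
  simp [fderiv_fderiv_symm hf v, h0]

variable {U : Set (Jet N)} {f : Jet N → ℂ} {K : ℕ}

theorem Jet.analyticOnNhd_dX (hf : AnalyticOnNhd ℂ f U) : AnalyticOnNhd ℂ (dX f) U :=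
  fun z hz => analyticAt_fderiv_apply (hf z hz) (analyticAt_fieldX z)

theorem Jet.analyticOnNhd_iterate_dX (hf : AnalyticOnNhd ℂ f U) (k : ℕ) :
    AnalyticOnNhd ℂ (dX^[k] f) U := by
  induction k with
  | zero => exact hf
  | succ k ih => rw [Function.iterate_succ_apply']; exact analyticOnNhd_dX ih

/-- `D_x` raises the number of the coordinates by one. -/
theorem Jet.Dep.dX (hU : IsOpen U) (hf : AnalyticOnNhd ℂ f U) (h : Dep U f K) :
    Dep U (dX f) (K + 1) := by
  intro z hz j hj
  obtain ⟨j, rfl⟩ : ∃ i, j = i + 1 := ⟨j - 1, by omega⟩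
  have h1 : ∀ᶠ z' in 𝓝 z, fderiv ℂ f z' (basisVec N (j + 1)) = 0 := by
    filter_upwards [hU.mem_nhds hz] with z' hz' using h z' hz' _ (by omega)
  refine (fderiv_fderiv_apply_of_eventually_eq_zero (hf z hz) (hasFDerivAt_fieldX z) h1).trans ?_
  by_cases hN : j + 1 < N
  · rw [shift_basisVec_succ hN]; exact h z hz j (by omega)
  · rw [basisVec_of_le (not_lt.mp hN), map_zero, map_zero]

/-- The leading derivative of `D_x f` is that of `f`. -/
theorem Jet.Dep.fderiv_dX (hU : IsOpen U) (hf : AnalyticOnNhd ℂ f U) (h : Dep U f (K + 1))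
    (hK : K + 1 < N) {z : Jet N} (hz : z ∈ U) :
    fderiv ℂ (Jet.dX f) z (basisVec N (K + 1)) = fderiv ℂ f z (basisVec N K) := by
  have h1 : ∀ᶠ z' in 𝓝 z, fderiv ℂ f z' (basisVec N (K + 1)) = 0 := by
    filter_upwards [hU.mem_nhds hz] with z' hz' using h z' hz' _ le_rfl
  refine (fderiv_fderiv_apply_of_eventually_eq_zero (hf z hz) (hasFDerivAt_fieldX z) h1).trans ?_
  rw [shift_basisVec_succ hK]

theorem Jet.Dep.iterate_dX (hU : IsOpen U) (hf : AnalyticOnNhd ℂ f U) (h : Dep U f K) (k : ℕ) :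
    Dep U (Jet.dX^[k] f) (K + k) := by
  induction k with
  | zero => exact h
  | succ k ih =>
    rw [Function.iterate_succ_apply']
    exact ih.dX hU (analyticOnNhd_iterate_dX hf k)

/-- The leading derivative of `D_xᵏ f` is that of `f`. -/
theorem Jet.Dep.fderiv_iterate_dX (hU : IsOpen U) (hf : AnalyticOnNhd ℂ f U) (h : Dep U f (K + 1))
    {k : ℕ} (hK : K + k < N) {z : Jet N} (hz : z ∈ U) :
    fderiv ℂ (Jet.dX^[k] f) z (basisVec N (K + k)) = fderiv ℂ f z (basisVec N K) := by
  induction k with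
  | zero => rfl
  | succ k ih =>
    rw [Function.iterate_succ_apply', ← ih (by omega)]
    exact ((h.iterate_dX hU hf k).mono (by omega : K + 1 + k ≤ (K + k) + 1)).fderiv_dX hU
      (analyticOnNhd_iterate_dX hf k) hK hz

/-- The vector field `D_t = ∂/∂t + ∑ D_xⁱ(r) ∂/∂vᵢ` on truncated jets. -/
noncomputable def Jet.fieldT (r : Jet N → ℂ) (z : Jet N) : Jet N := (0, 1, fun i => (dX^[i] r) z)

theorem Jet.hasFDerivAt_fieldT {r : Jet N → ℂ} (hr : AnalyticOnNhd ℂ r U) {z : Jet N} (hz : z ∈ U) :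
    HasFDerivAt (fieldT r) ((0 : Jet N →L[ℂ] ℂ).prod ((0 : Jet N →L[ℂ] ℂ).prod
      (ContinuousLinearMap.pi fun i : Fin N => fderiv ℂ (dX^[i] r) z))) z :=
  (hasFDerivAt_const _ _).prodMk ((hasFDerivAt_const _ _).prodMk (hasFDerivAt_pi.mpr fun i =>
    (analyticOnNhd_iterate_dX hr i z hz).differentiableAt.hasFDerivAt))

/-- The vector fields `D_x` and `D_t` commute on functions that do not depend on the last
coordinates; on the others the truncation of `D_x` destroys the commutation. -/
theorem Jet.dX_dT_comm {r : Jet N → ℂ} (hr : AnalyticOnNhd ℂ r U) {z : Jet N} (hz : z ∈ U)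
    (hf : AnalyticAt ℂ f z) (hK : ∀ j, K ≤ j → fderiv ℂ f z (basisVec N j) = 0) (hKN : K < N) :
    fderiv ℂ (fun z => fderiv ℂ f z (fieldT r z)) z (fieldX z) =
      fderiv ℂ (Jet.dX f) z (fieldT r z) := by
  have h1 := (hasFDerivAt_fderiv_apply hf (hasFDerivAt_fieldT hr hz)).fderiv
  have h2 : fderiv ℂ (Jet.dX f) z = _ := (hasFDerivAt_fderiv_apply hf (hasFDerivAt_fieldX z)).fderiv
  rw [h1, h2]
  simp only [add_apply, ContinuousLinearMap.comp_apply,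
    ContinuousLinearMap.flip_apply]
  rw [fderiv_fderiv_symm hf (fieldX z) (fieldT r z)]
  congr 1
  refine map_eq_of_forall_lt hK rfl rfl fun i hi => ?_
  rw [shift_apply]
  show fderiv ℂ (dX^[i] r) z (fieldX z) = coord N (i + 1) (fieldT r z)
  rw [coord_of_lt (by omega)]
  show _ = (dX^[(i : ℕ) + 1] r) z
  rw [Function.iterate_succ_apply']
  rfl

end Jets
end KdVMiura

namespace KdVMiura
open Filter Topology
open Jet
/-! ### Functions on the jet space that depend on finitely many coordinates -/

section Infinite

variable {N : ℕ} {U : Set (Jet N)} {f : Jet N → ℂ} {F : JetFun}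

theorem Jet.trunc_update (x t : ℂ) (v : ℕ → ℂ) (j : ℕ) (s : ℂ) :
    trunc N x t (Function.update v j s) = trunc N x t v + (s - v j) • basisVec N j := by
  refine Prod.ext ?_ (Prod.ext ?_ (funext fun i => ?_))
  · simp [trunc, basisVec]
  · simp [trunc, basisVec]
  · show Function.update v j s i = v i + (s - v j) * (if (i : ℕ) = j then 1 else 0)
    split_ifs with h
    · rw [h, Function.update_self]; ring
    · rw [Function.update_of_ne h]; ring

/-- A directional derivative as the derivative of a function of one variable that is given by `f`
only where the line stays in `U`. -/
theorem hasDerivAt_of_eq_comp_affine {E : Type*} [NormedAddCommGroup E] [NormedSpace ℂ E]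
    {U : Set E} (hU : IsOpen U) {f : E → ℂ} {z v : E} (hz : z ∈ U) (hf : DifferentiableAt ℂ f z)
    {g : ℂ → ℂ} {c : ℂ} (hg : ∀ s, z + (s - c) • v ∈ U → g s = f (z + (s - c) • v)) :
    HasDerivAt g (fderiv ℂ f z v) c := by
  have h1 : HasDerivAt (fun s : ℂ => z + (s - c) • v) v c := by
    simpa using (((hasDerivAt_id c).sub_const c).smul_const v).const_add z
  have h2 : HasFDerivAt f (fderiv ℂ f z) (z + (c - c) • v) := by
    rw [sub_self, zero_smul, add_zero]; exact hf.hasFDerivAt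
  refine (h2.comp_hasDerivAt c h1).congr_of_eventuallyEq ?_
  have h3 : ∀ᶠ s in 𝓝 c, z + (s - c) • v ∈ U := h1.continuousAt.eventually_mem
    (by rw [sub_self, zero_smul, add_zero]; exact hU.mem_nhds hz)
  filter_upwards [h3] with s hs using hg s hs

variable (hU : IsOpen U) (hf : ∀ z ∈ U, DifferentiableAt ℂ f z)
  (hF : ∀ x t v, trunc N x t v ∈ U → F x t v = f (trunc N x t v))
include hU hf hF

theorem partialV_eq (x t : ℂ) (v : ℕ → ℂ) (h : trunc N x t v ∈ U) (j : ℕ) :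
    partialV j F x t v = fderiv ℂ f (trunc N x t v) (basisVec N j) :=
  (hasDerivAt_of_eq_comp_affine hU h (hf _ h) fun s hs => by
    rw [← trunc_update] at hs ⊢; exact hF _ _ _ hs).deriv

theorem deriv_x_eq (x t : ℂ) (v : ℕ → ℂ) (h : trunc N x t v ∈ U) :
    deriv (fun s => F s t v) x = fderiv ℂ f (trunc N x t v) (1, 0, 0) :=
  (hasDerivAt_of_eq_comp_affine hU h (hf _ h) fun s hs => by
    have h1 : trunc N x t v + (s - x) • ((1, 0, 0) : Jet N) = trunc N s t v := by
      simp [trunc]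
    rw [h1] at hs ⊢; exact hF _ _ _ hs).deriv

theorem deriv_t_eq (x t : ℂ) (v : ℕ → ℂ) (h : trunc N x t v ∈ U) :
    deriv (fun s => F x s v) t = fderiv ℂ f (trunc N x t v) (0, 1, 0) :=
  (hasDerivAt_of_eq_comp_affine hU h (hf _ h) fun s hs => by
    have h1 : trunc N x t v + (s - t) • ((0, 1, 0) : Jet N) = trunc N x s v := by
      simp [trunc]
    rw [h1] at hs ⊢; exact hF _ _ _ hs).deriv

theorem finsum_partialV_eq (x t : ℂ) (v : ℕ → ℂ) (h : trunc N x t v ∈ U) (c : ℕ → ℂ) :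
    ∑ᶠ j : ℕ, c j * partialV j F x t v =
      fderiv ℂ f (trunc N x t v) (0, 0, fun i : Fin N => c i) := by
  have h1 := eq_add_sum ((0, 0, fun i : Fin N => c i) : Jet N)
  have h0 : ((0, 0, 0) : Jet N) = 0 := rfl
  rw [h1]
  simp only [h0, zero_add, map_sum, map_smul, smul_eq_mul, partialV_eq hU hf hF x t v h]
  rw [finsum_eq_sum_of_support_subset (s := Finset.range N), Finset.sum_range]
  intro j hj
  rw [Finset.coe_range, Set.mem_Iio]
  by_contra hN
  exact hj (by simp [basisVec_of_le (not_lt.mp hN)])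

/-- On functions of `v₀, …, v_{K-1}` with `K < N` the total derivative `D_x` is the truncated one.
-/
theorem totalDx_eq {K : ℕ} (hdep : Dep U f K) (hK : K < N) (x t : ℂ) (v : ℕ → ℂ)
    (h : trunc N x t v ∈ U) : totalDx F x t v = dX f (trunc N x t v) := by
  rw [totalDx, deriv_x_eq hU hf hF x t v h, finsum_partialV_eq hU hf hF x t v h fun j => v (j + 1),
    ← map_add]
  refine map_eq_of_forall_lt (hdep _ h) ?_ ?_ fun i hi => ?_
  · simp [fieldX_eq]
  · simp [fieldX_eq]
  · rw [fieldX_eq]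
    show 0 + v (i + 1) = coord N (i + 1) (trunc N x t v)
    rw [coord_of_lt (by omega), zero_add]
    rfl

/-- On functions of `v₀, …, v_{K-1}` the total derivative `D_t` is the truncated one. -/
theorem totalDt_eq {K : ℕ} (hdep : Dep U f K) {R : JetFun} {r : Jet N → ℂ}
    (hR : ∀ i < K, ∀ x t v, trunc N x t v ∈ U → (totalDx^[i] R) x t v = (dX^[i] r) (trunc N x t v))
    (x t : ℂ) (v : ℕ → ℂ) (h : trunc N x t v ∈ U) :
    totalDt R F x t v = fderiv ℂ f (trunc N x t v) (fieldT r (trunc N x t v)) := by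
  rw [totalDt, deriv_t_eq hU hf hF x t v h,
    finsum_partialV_eq hU hf hF x t v h fun j => (totalDx^[j] R) x t v, ← map_add]
  refine map_eq_of_forall_lt (hdep _ h) ?_ ?_ fun i hi => ?_
  · simp [fieldT]
  · simp [fieldT]
  · show 0 + (totalDx^[i] R) x t v = (dX^[i] r) (trunc N x t v)
    rw [zero_add, hR i hi x t v h]

omit hf in
theorem iterate_totalDx_eq (hf : AnalyticOnNhd ℂ f U) {K : ℕ} (hdep : Dep U f K) {k : ℕ}
    (hK : K + k ≤ N) (x t : ℂ) (v : ℕ → ℂ) (h : trunc N x t v ∈ U) :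
    (totalDx^[k] F) x t v = (dX^[k] f) (trunc N x t v) := by
  induction k generalizing x t v with
  | zero => exact hF x t v h
  | succ k ih =>
    rw [Function.iterate_succ_apply', Function.iterate_succ_apply']
    exact totalDx_eq hU (fun z hz => (analyticOnNhd_iterate_dX hf k z hz).differentiableAt)
      (fun x t v h => ih (by omega) x t v h) (hdep.iterate_dX hU hf k) (by omega) x t v h

end Infinite

section Order

variable {N : ℕ}

/-- A substitution `u = s` from `v_t = r` to the KdV equation on truncated jets, of the order
exactly `n` at every point of the domain. -/
structure Jet.IsMiura (U : Set (Jet N)) (n : ℕ) (r s : Jet N → ℂ) : Prop where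
  isOpen : IsOpen U
  analytic_r : AnalyticOnNhd ℂ r U
  analytic_s : AnalyticOnNhd ℂ s U
  dep_s : Dep U s (n + 1)
  lead_ne_zero : ∀ z ∈ U, fderiv ℂ s z (basisVec N n) ≠ 0
  transforms : ∀ z ∈ U, fderiv ℂ s z (fieldT r z) = (dX^[3] s) z + s z * dX s z

/-- The coefficient of `v_{n+K}` in the equation of a substitution of the order `n` gives
`∂r/∂v_K = 0` for `K ≥ 4`. -/
theorem Jet.IsMiura.dep_of_dep_succ {U : Set (Jet N)} {n K : ℕ} {r s : Jet N → ℂ}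
    (H : IsMiura U n r s) (hr : Dep U r (K + 1)) (hK : 4 ≤ K) (hN : K + n < N) : Dep U r K := by
  intro z hz j hj
  rcases hj.eq_or_lt with rfl | hj
  swap
  · exact hr z hz j hj
  have hU := H.isOpen
  have hs1 : Dep U (dX^[1] s) (n + 1 + 1) := H.dep_s.iterate_dX hU H.analytic_s 1
  have hs3 := H.dep_s.iterate_dX hU H.analytic_s 3
  have a1 := (analyticOnNhd_iterate_dX H.analytic_s 1 z hz).differentiableAt
  have a3 := (analyticOnNhd_iterate_dX H.analytic_s 3 z hz).differentiableAt
  have a0 := (H.analytic_s z hz).differentiableAt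
  have e1 : ∀ᶠ z' in 𝓝 z, fderiv ℂ s z' (fieldT r z') = (dX^[3] s) z' + s z' * (dX^[1] s) z' := by
    filter_upwards [hU.mem_nhds hz] with z' hz' using H.transforms z' hz'
  have e2 : ∀ᶠ z' in 𝓝 z, fderiv ℂ s z' (basisVec N (K + n)) = 0 := by
    filter_upwards [hU.mem_nhds hz] with z' hz' using H.dep_s z' hz' _ (by omega)
  have h1 := congrArg (fun T : Jet N →L[ℂ] ℂ => T (basisVec N (K + n)))
    ((hasFDerivAt_fderiv_apply (H.analytic_s z hz)
      (hasFDerivAt_fieldT H.analytic_r hz)).unique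
        ((a3.hasFDerivAt.add (a0.hasFDerivAt.mul a1.hasFDerivAt)).congr_of_eventuallyEq e1))
  have h2 := fderiv_fderiv_apply_of_eventually_eq_zero (H.analytic_s z hz)
    (hasFDerivAt_fieldT H.analytic_r hz) e2
  rw [(hasFDerivAt_fderiv_apply (H.analytic_s z hz)
      (hasFDerivAt_fieldT H.analytic_r hz)).fderiv] at h2
  have h3 := h2.symm.trans h1
  simp only [add_apply, smul_apply, smul_eq_mul] at h3
  rw [hs3 z hz _ (by omega), hs1 z hz _ (by omega), H.dep_s z hz _ (by omega), mul_zero, mul_zero,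
    add_zero, add_zero] at h3
  -- only the component along `∂/∂vₙ` of the derivative of `D_t` contributes
  have h4 : fderiv ℂ s z (((0 : Jet N →L[ℂ] ℂ).prod ((0 : Jet N →L[ℂ] ℂ).prod
      (ContinuousLinearMap.pi fun i : Fin N => fderiv ℂ (dX^[i] r) z))) (basisVec N (K + n))) =
      fderiv ℂ s z (fderiv ℂ r z (basisVec N K) • basisVec N n) := by
    refine map_eq_of_forall_lt (H.dep_s z hz) ?_ ?_ fun i hi => ?_
    · simp [basisVec]
    · simp [basisVec]
    · show fderiv ℂ (dX^[i] r) z (basisVec N (K + n)) =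
        fderiv ℂ r z (basisVec N K) * (if (i : ℕ) = n then 1 else 0)
      split_ifs with h
      · rw [h, mul_one]; exact hr.fderiv_iterate_dX hU H.analytic_r hN hz
      · rw [mul_zero]; exact (hr.iterate_dX hU H.analytic_r i) z hz _ (by omega)
  rw [h4, map_smul, smul_eq_mul] at h3
  exact (mul_eq_zero.mp h3).resolve_right (H.lead_ne_zero z hz)

/-- The equation `v_t = r` has the order at most `3`. -/
theorem Jet.IsMiura.dep_four {U : Set (Jet N)} {n K : ℕ} {r s : Jet N → ℂ} (H : IsMiura U n r s)
    (hr : Dep U r (4 + K)) (hN : 4 + K + n ≤ N) : Dep U r 4 := by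
  induction K with
  | zero => exact hr
  | succ K ih => exact ih (H.dep_of_dep_succ hr (by omega) (by omega)) (by omega)

/-- A Miura type transformation of the order `n` gives a substitution on truncated jets that has the
order exactly `n` everywhere. -/
theorem IsMiuraTransformation.exists_isMiura {m : ℕ} {Ω : Set (ℂ × ℂ × (Fin (m + 1) → ℂ))}
    {R S : ℂ × ℂ × (Fin (m + 1) → ℂ) → ℂ} (H : IsMiuraTransformation kdv Ω R S) {n : ℕ}
    (hn : HasOrder Ω S n) : ∃ (N : ℕ) (U : Set (Jet N)) (r s : Jet N → ℂ),
      n + 4 < N ∧ U.Nonempty ∧ IsMiura U n r s ∧ Dep U r 4 := by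
  -- room for `D_xⁱ R`, `i ≤ n`, for `D_x³ S`, and for `vₙ₊₄`
  obtain ⟨N, hN⟩ : ∃ N, N = m + n + 6 := ⟨_, rfl⟩
  have hlt : ∀ i : Fin (m + 1), (i : ℕ) < N := fun i => by omega
  let π : Jet N →L[ℂ] ℂ × ℂ × (Fin (m + 1) → ℂ) := (ContinuousLinearMap.fst ℂ _ _).prod
    (((ContinuousLinearMap.fst ℂ _ _).comp (ContinuousLinearMap.snd ℂ _ _)).prod
      (ContinuousLinearMap.pi fun i : Fin (m + 1) => coord N i))
  have hπ : ∀ x t v, π (trunc N x t v) = (x, t, fun i : Fin (m + 1) => v i) := fun x t v => by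
    refine Prod.ext rfl (Prod.ext rfl (funext fun i => ?_))
    exact coord_of_lt (hlt i) _
  have hπ0 : ∀ j, m + 1 ≤ j → π (basisVec N j) = 0 := fun j hj => by
    refine Prod.ext rfl (Prod.ext rfl (funext fun i => ?_))
    exact coord_basisVec_of_ne (by omega)
  let V : Set (Jet N) := π ⁻¹' Ω
  have hV : IsOpen V := H.isOpen.preimage π.continuous
  have aR : AnalyticOnNhd ℂ (R ∘ π) V := fun z hz => (H.analytic_R _ hz).comp (π.analyticAt z)
  have aS : AnalyticOnNhd ℂ (S ∘ π) V := fun z hz => (H.analytic_S _ hz).comp (π.analyticAt z)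
  have mem : ∀ x t v, trunc N x t v ∈ V ↔ (x, t, fun i : Fin (m + 1) => v i) ∈ Ω := fun x t v => by
    rw [← hπ]; rfl
  have eR : ∀ x t v, trunc N x t v ∈ V → ofFinite R x t v = (R ∘ π) (trunc N x t v) :=
    fun x t v _ => by rw [Function.comp_apply, hπ]; rfl
  have eS : ∀ x t v, trunc N x t v ∈ V → ofFinite S x t v = (S ∘ π) (trunc N x t v) :=
    fun x t v _ => by rw [Function.comp_apply, hπ]; rfl
  have dep : ∀ T, AnalyticOnNhd ℂ T Ω → Dep V (T ∘ π) (m + 1) := fun T hT z hz j hj => by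
    rw [((hT _ hz).differentiableAt.hasFDerivAt.comp z π.hasFDerivAt).fderiv,
      ContinuousLinearMap.comp_apply, hπ0 j hj, map_zero]
  have surj : ∀ z : Jet N, ∃ x t v, trunc N x t v = z := fun z =>
    ⟨z.1, z.2.1, fun j => coord N j z, Prod.ext rfl (Prod.ext rfl (funext fun i => coord_fin i z))⟩
  have dS : ∀ z ∈ V, DifferentiableAt ℂ (S ∘ π) z := fun z hz => (aS z hz).differentiableAt
  have depS : Dep V (S ∘ π) (n + 1) := fun z hz j hj => by
    obtain ⟨x, t, v, rfl⟩ := surj z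
    by_contra h
    rw [← partialV_eq hV dS eS x t v hz] at h
    have := hn.2 ⟨x, t, v, (mem x t v).mp hz, h⟩
    omega
  -- the order may drop on a closed subset, which is removed
  let U : Set (Jet N) := {z ∈ V | fderiv ℂ (S ∘ π) z (basisVec N n) ≠ 0}
  have hUV : U ⊆ V := fun z hz => hz.1
  have hU : IsOpen U := by
    have hc : ContinuousOn (fun z => fderiv ℂ (S ∘ π) z (basisVec N n)) V := fun z hz =>
      (analyticAt_fderiv_apply (aS z hz) analyticAt_const).continuousAt.continuousWithinAt
    exact hc.isOpen_inter_preimage hV isOpen_compl_singleton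
  have hM : IsMiura U n (R ∘ π) (S ∘ π) := by
    refine ⟨hU, aR.mono hUV, aS.mono hUV, fun z hz => depS z hz.1, fun z hz => hz.2, fun z hz => ?_⟩
    obtain ⟨x, t, v, rfl⟩ := surj z
    have h := H.transforms x t v ((mem x t v).mp hz.1)
    rw [totalDt_eq hV dS eS depS (fun i hi x t v h =>
      iterate_totalDx_eq hV eR aR (dep R H.analytic_R) (by omega) x t v h) x t v hz.1, kdv,
      iterate_totalDx_eq hV eS aS depS (by omega) x t v hz.1,
      iterate_totalDx_eq hV eS aS depS (by omega) x t v hz.1,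
      iterate_totalDx_eq hV eS aS depS (by omega) x t v hz.1] at h
    exact h
  refine ⟨N, U, R ∘ π, S ∘ π, by omega, ?_, hM, hM.dep_four (K := m + 1)
    (fun z hz => ((dep R H.analytic_R).mono (by omega)) z hz.1) (by omega)⟩
  obtain ⟨x, t, v, hΩ, hne⟩ := hn.1
  have hz := (mem x t v).mpr hΩ
  exact ⟨trunc N x t v, hz, by rwa [partialV_eq hV dS eS x t v hz] at hne⟩

end Order
end KdVMiura

namespace KdVMiura
open Filter Topology
open Jet
/-! ### The derivatives of `u` as coordinates -/

section Coordinates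

/-- The inverse function theorem for analytic maps of a finite-dimensional space. -/
theorem exists_analytic_local_inverse {E : Type*} [NormedAddCommGroup E] [NormedSpace ℂ E]
    [FiniteDimensional ℂ E] {θ : E → E} {p : E} (hθ : AnalyticAt ℂ θ p)
    (hinj : ∀ v, fderiv ℂ θ p v = 0 → v = 0) : ∃ ψ : E → E, AnalyticAt ℂ ψ (θ p) ∧ ψ (θ p) = p ∧
      (∀ᶠ y in 𝓝 (θ p), θ (ψ y) = y) ∧ ∀ᶠ x in 𝓝 p, ψ (θ x) = x := by
  have : CompleteSpace E := FiniteDimensional.complete ℂ E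
  let e : E ≃L[ℂ] E := (LinearEquiv.ofInjectiveEndo (fderiv ℂ θ p : E →ₗ[ℂ] E)
    ((injective_iff_map_eq_zero _).mpr hinj)).toContinuousLinearEquiv
  have he : fderiv ℂ θ p = (e : E →L[ℂ] E) := ContinuousLinearMap.ext fun v => rfl
  have hs : HasStrictFDerivAt θ (e : E →L[ℂ] E) p := he ▸ hθ.hasStrictFDerivAt
  let h := hs.toOpenPartialHomeomorph θ
  have hp : p ∈ h.source := hs.mem_toOpenPartialHomeomorph_source
  refine ⟨h.symm, h.analyticAt_symm' hp hθ he, h.left_inv hp, ?_, ?_⟩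
  · filter_upwards [h.open_target.mem_nhds (h.map_source hp)] with y hy using h.right_inv hy
  · filter_upwards [h.open_source.mem_nhds hp] with x hx using h.left_inv hx

variable {N : ℕ}

/-- The truncation of jets. -/
noncomputable def Jet.proj (N n : ℕ) : Jet N →L[ℂ] Jet n :=
  (ContinuousLinearMap.fst ℂ _ _).prod
    (((ContinuousLinearMap.fst ℂ _ _).comp (ContinuousLinearMap.snd ℂ _ _)).prod
      (ContinuousLinearMap.pi fun i : Fin n => coord N i))

/-- The coordinates `v₀, …, v_{n-1}` and, separately, `vₙ, …, v_{n+d-1}` of a jet. -/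
noncomputable def Jet.split (N n d : ℕ) : Jet N →L[ℂ] Jet n × (Fin d → ℂ) :=
  (proj N n).prod (ContinuousLinearMap.pi fun k : Fin d => coord N (n + k))

/-- The jet with given coordinates `v₀, …, v_{n-1}` and `vₙ, …, v_{n+d-1}`; the other coordinates
are zero. -/
noncomputable def Jet.join (N n d : ℕ) : Jet n × (Fin d → ℂ) →L[ℂ] Jet N :=
  ((ContinuousLinearMap.fst ℂ _ _).comp (ContinuousLinearMap.fst ℂ _ _)).prod
    ((((ContinuousLinearMap.fst ℂ _ _).comp (ContinuousLinearMap.snd ℂ _ _)).comp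
      (ContinuousLinearMap.fst ℂ _ _)).prod (ContinuousLinearMap.pi fun i : Fin N =>
        if (i : ℕ) < n then (coord n i).comp (ContinuousLinearMap.fst ℂ _ _)
        else if h' : (i : ℕ) - n < d then
          (ContinuousLinearMap.proj (R := ℂ) (φ := fun _ : Fin d => ℂ) ⟨i - n, h'⟩).comp
            (ContinuousLinearMap.snd ℂ _ _)
        else 0))

variable {n d : ℕ}

theorem Jet.join_apply_of_lt (p : Jet n × (Fin d → ℂ)) {i : Fin N} (h : (i : ℕ) < n) :
    (join N n d p).2.2 i = p.1.2.2 ⟨i, h⟩ := by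
  simp [join, h, coord_of_lt h]

theorem Jet.join_apply_of_eq_add (p : Jet n × (Fin d → ℂ)) {i : Fin N} {k : Fin d}
    (h : (i : ℕ) = n + k) : (join N n d p).2.2 i = p.2 k := by
  have h1 : ¬ (i : ℕ) < n := by omega
  have h2 : (i : ℕ) - n = k := by omega
  simp [join, h1, h2]

theorem Jet.join_apply_of_le (p : Jet n × (Fin d → ℂ)) {i : Fin N} (h : n + d ≤ (i : ℕ)) :
    (join N n d p).2.2 i = 0 := by
  have h1 : ¬ (i : ℕ) < n := by omega
  have h2 : ¬ (i : ℕ) - n < d := by omega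
  simp [join, h1, h2]

theorem Jet.split_join (hN : n + d ≤ N) (p : Jet n × (Fin d → ℂ)) :
    split N n d (join N n d p) = p := by
  refine Prod.ext (Prod.ext rfl (Prod.ext rfl (funext fun i => ?_))) (funext fun k => ?_)
  · have hi : (i : ℕ) < N := by omega
    exact (coord_of_lt hi _).trans (join_apply_of_lt p i.2)
  · have hk : n + (k : ℕ) < N := by omega
    exact (coord_of_lt hk _).trans (join_apply_of_eq_add p rfl)

theorem Jet.join_split_of_lt (z : Jet N) {i : Fin N} (h : (i : ℕ) < n + d) :
    (join N n d (split N n d z)).2.2 i = z.2.2 i := by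
  by_cases hi : (i : ℕ) < n
  · rw [join_apply_of_lt _ hi]; exact coord_of_lt i.2 z
  · have hk : (i : ℕ) = n + ((⟨i - n, by omega⟩ : Fin d) : ℕ) := by simp only []; omega
    rw [join_apply_of_eq_add _ hk]
    refine Eq.trans ?_ (coord_fin i z)
    show coord N (n + (i - n)) z = _
    congr 2
    omega

theorem Jet.norm_join_split_le (z : Jet N) : ‖join N n d (split N n d z)‖ ≤ ‖z‖ := by
  refine max_le (le_max_left _ _) (le_max_of_le_right (max_le (le_max_left _ _)
    (le_max_of_le_right ((pi_norm_le_iff_of_nonneg (norm_nonneg _)).mpr fun i => ?_))))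
  by_cases h : (i : ℕ) < n + d
  · rw [join_split_of_lt z h]; exact norm_le_pi_norm z.2.2 i
  · rw [join_apply_of_le _ (not_lt.mp h), norm_zero]; exact norm_nonneg _

/-- A function that does not depend on `vⱼ`, `j ≥ K`, in a convex domain takes equal values at the
points that differ in these coordinates only. -/
theorem Jet.Dep.eq_of_forall_lt {U : Set (Jet N)} (hU : Convex ℝ U) {f : Jet N → ℂ}
    (hf : ∀ z ∈ U, DifferentiableAt ℂ f z) {K : ℕ} (h : Dep U f K) {z z' : Jet N} (hz : z ∈ U)
    (hz' : z' ∈ U) (h1 : z.1 = z'.1) (h2 : z.2.1 = z'.2.1)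
    (hc : ∀ i : Fin N, (i : ℕ) < K → z.2.2 i = z'.2.2 i) : f z = f z' := by
  let g : ℂ → ℂ := fun c => f (z + c • (z' - z))
  have hg : ∀ c : ℝ, c ∈ Set.Icc (0 : ℝ) 1 → HasDerivAt (fun c : ℝ => g c) 0 c := fun c hc1 => by
    have hmem : z + (c : ℂ) • (z' - z) ∈ U := by
      have h3 := hU.add_smul_sub_mem hz hz' hc1
      rwa [← Complex.coe_smul] at h3
    have h4 : HasDerivAt (fun c : ℂ => z + c • (z' - z)) (z' - z) (c : ℂ) := by
      simpa using ((hasDerivAt_id (c : ℂ)).smul_const (z' - z)).const_add z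
    have h5 := (hf _ hmem).hasFDerivAt.comp_hasDerivAt (c : ℂ) h4
    have h6 : fderiv ℂ f (z + (c : ℂ) • (z' - z)) (z' - z) = 0 := by
      rw [← map_zero (fderiv ℂ f (z + (c : ℂ) • (z' - z)))]
      refine map_eq_of_forall_lt (h _ hmem) ?_ ?_ fun i hi => ?_
      · simp [h1]
      · simp [h2]
      · simp [hc i hi]
    rw [h6] at h5
    exact h5.comp_ofReal
  have h7 := (convex_Icc (0 : ℝ) 1).is_const_of_fderivWithin_eq_zero (𝕜 := ℝ)
    (f := fun c : ℝ => g c) (fun c hc1 => (hg c hc1).differentiableAt.differentiableWithinAt)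
    (fun c hc1 => by
      have h8 : HasFDerivWithinAt (fun c : ℝ => g c) (0 : ℝ →L[ℝ] ℂ) (Set.Icc (0 : ℝ) 1) c := by
        have := (hg c hc1).hasFDerivAt.hasFDerivWithinAt (s := Set.Icc (0 : ℝ) 1)
        simpa using this
      exact h8.fderivWithin (uniqueDiffOn_Icc zero_lt_one c hc1))
    (Set.left_mem_Icc.mpr zero_le_one) (Set.right_mem_Icc.mpr zero_le_one)
  simpa [g] using h7

/-- The map `z ↦ (x, t, v₀, …, v_{n-1}; u, u₁, …, u_{d-1})`, where `u_k = D_xᵏ s`. -/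
noncomputable def Jet.uMap (N n d : ℕ) (s : Jet N → ℂ) (z : Jet N) : Jet n × (Fin d → ℂ) :=
  (proj N n z, fun k => (dX^[k] s) z)

theorem Jet.hasFDerivAt_uMap {s : Jet N → ℂ} {U : Set (Jet N)} (hs : AnalyticOnNhd ℂ s U)
    {z : Jet N} (hz : z ∈ U) : HasFDerivAt (uMap N n d s) ((proj N n).prod
      (ContinuousLinearMap.pi fun k : Fin d => fderiv ℂ (dX^[k] s) z)) z :=
  (proj N n).hasFDerivAt.prodMk (hasFDerivAt_pi.mpr fun k =>
    (analyticOnNhd_iterate_dX hs k z hz).differentiableAt.hasFDerivAt)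

theorem Jet.analyticAt_uMap {s : Jet N → ℂ} {U : Set (Jet N)} (hs : AnalyticOnNhd ℂ s U)
    {z : Jet N} (hz : z ∈ U) : AnalyticAt ℂ (uMap N n d s) z :=
  ((proj N n).analyticAt z).prod (AnalyticAt.pi fun k => analyticOnNhd_iterate_dX hs k z hz)

/-- Near each point, `u, u₁, …, u_{d-1}` can be used as coordinates in place of
`vₙ, …, v_{n+d-1}`, since `u_k = D_xᵏ s` has the order `n + k` with the leading derivative
`∂s/∂vₙ ≠ 0`. The map `Γ` fixes the coordinates `v_{n+d}, …`, so that it recovers only the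
functions independent of them. -/
theorem Jet.IsMiura.exists_uMap_inverse {U : Set (Jet N)} {r s : Jet N → ℂ} (H : IsMiura U n r s)
    (hN : n + d ≤ N) {z₀ : Jet N} (hz₀ : z₀ ∈ U) :
    ∃ Γ : Jet n × (Fin d → ℂ) → Jet N, AnalyticAt ℂ Γ (uMap N n d s z₀) ∧
      Γ (uMap N n d s z₀) = z₀ ∧ (∀ᶠ y in 𝓝 (uMap N n d s z₀), uMap N n d s (Γ y) = y) ∧
      ∀ᶠ z in 𝓝 z₀, ∀ f : Jet N → ℂ, AnalyticOnNhd ℂ f U → Dep U f (n + d) →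
        f (Γ (uMap N n d s z)) = f z := by
  have hU := H.isOpen
  obtain ⟨ε, hε, hball⟩ := Metric.isOpen_iff.mp hU z₀ hz₀
  let σ : Jet n × (Fin d → ℂ) → Jet N := fun p =>
    (z₀ - join N n d (split N n d z₀)) + join N n d p
  have σ_split : ∀ z, σ (split N n d z) = z₀ + join N n d (split N n d (z - z₀)) := fun z => by
    simp only [σ, map_sub]; abel
  have σ0 : σ (split N n d z₀) = z₀ := by simp [σ]
  have hσ : ∀ p, HasFDerivAt σ (join N n d) p := fun p => (join N n d).hasFDerivAt.const_add _
  have aσ : ∀ p, AnalyticAt ℂ σ p := fun p => analyticAt_const.add ((join N n d).analyticAt p)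
  -- replacing the higher coordinates by those of the base point
  have hdep : ∀ f : Jet N → ℂ, AnalyticOnNhd ℂ f U → Dep U f (n + d) → ∀ z ∈ Metric.ball z₀ ε,
      f (σ (split N n d z)) = f z := fun f hf hK z hz => by
    have hmem : σ (split N n d z) ∈ Metric.ball z₀ ε := by
      rw [σ_split, mem_ball_iff_norm, add_sub_cancel_left]
      exact (norm_join_split_le _).trans_lt (mem_ball_iff_norm.mp hz)
    refine Dep.eq_of_forall_lt (convex_ball z₀ ε) (fun z hz => (hf z (hball hz)).differentiableAt)
      (fun z hz => hK z (hball hz)) hmem hz ?_ ?_ fun i hi => ?_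
    · rw [σ_split]; simp [join, split, proj]
    · rw [σ_split]; simp [join, split, proj]
    · rw [σ_split]
      show z₀.2.2 i + (join N n d (split N n d (z - z₀))).2.2 i = z.2.2 i
      rw [join_split_of_lt _ hi]
      show z₀.2.2 i + (z.2.2 i - z₀.2.2 i) = _
      ring
  have hu : ∀ z ∈ Metric.ball z₀ ε, uMap N n d s (σ (split N n d z)) = uMap N n d s z :=
    fun z hz => by
      refine Prod.ext ?_ (funext fun k => hdep _ (analyticOnNhd_iterate_dX H.analytic_s k)
        ((H.dep_s.iterate_dX hU H.analytic_s k).mono (by omega)) z hz)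
      have h1 := congrArg Prod.fst (split_join hN (split N n d (z - z₀)))
      show proj N n (σ (split N n d z)) = proj N n z
      rw [σ_split, map_add]
      have h2 : proj N n (join N n d (split N n d (z - z₀))) = proj N n (z - z₀) := h1
      rw [h2, map_sub]
      abel
  let θ : Jet n × (Fin d → ℂ) → Jet n × (Fin d → ℂ) := fun p => uMap N n d s (σ p)
  have hz₀' : σ (split N n d z₀) ∈ U := by rw [σ0]; exact hz₀
  have hθ0 : θ (split N n d z₀) = uMap N n d s z₀ := by simp only [θ, σ0]
  have aθ : AnalyticAt ℂ θ (split N n d z₀) := (analyticAt_uMap H.analytic_s hz₀').comp (aσ _)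
  have dθ : ∀ v, fderiv ℂ θ (split N n d z₀) v = ((proj N n).prod
      (ContinuousLinearMap.pi fun k : Fin d => fderiv ℂ (dX^[k] s) z₀)) (join N n d v) := fun v => by
    have h1 := ((hasFDerivAt_uMap (n := n) (d := d) H.analytic_s hz₀').comp _ (hσ _)).fderiv
    rw [σ0] at h1
    exact congrArg (fun T => T v) h1
  obtain ⟨ψ, aψ, ψ0, hθψ, hψθ⟩ := exists_analytic_local_inverse aθ fun v hv => by
    rw [dθ] at hv
    have hw : v.1 = 0 := (congrArg Prod.fst (split_join hN v)).symm.trans (congrArg Prod.fst hv)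
    have hq : ∀ k : ℕ, ∀ hk : k < d, v.2 ⟨k, hk⟩ = 0 := by
      intro k
      induction k using Nat.strong_induction_on with
      | _ k ih =>
        intro hk
        have h1 : fderiv ℂ (dX^[k] s) z₀ (join N n d v) = 0 :=
          congrFun (congrArg Prod.snd hv) ⟨k, hk⟩
        have h2 : fderiv ℂ (dX^[k] s) z₀ (join N n d v) =
            fderiv ℂ (dX^[k] s) z₀ (v.2 ⟨k, hk⟩ • basisVec N (n + k)) := by
          refine map_eq_of_forall_lt (H.dep_s.iterate_dX hU H.analytic_s k z₀ hz₀) ?_ ?_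
            fun i hi => ?_
          · simp [join, hw, basisVec]
          · simp [join, hw, basisVec]
          · show _ = v.2 ⟨k, hk⟩ * (if (i : ℕ) = n + k then 1 else 0)
            split_ifs with h
            · rw [join_apply_of_eq_add v (k := ⟨k, hk⟩) h, mul_one]
            · rw [mul_zero]
              by_cases hin : (i : ℕ) < n
              · rw [join_apply_of_lt v hin, hw]; rfl
              · rw [join_apply_of_eq_add v (k := ⟨i - n, by omega⟩) (by simp only []; omega)]
                exact ih _ (by omega) _
        rw [h2, map_smul, H.dep_s.fderiv_iterate_dX hU H.analytic_s (by omega) hz₀, smul_eq_mul] at h1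
        exact (mul_eq_zero.mp h1).resolve_right (H.lead_ne_zero z₀ hz₀)
    exact Prod.ext hw (funext fun k => hq k k.2)
  rw [hθ0] at aψ ψ0 hθψ
  refine ⟨σ ∘ ψ, (aσ _).comp aψ, by rw [Function.comp_apply, ψ0, σ0], hθψ, ?_⟩
  have h1 : ∀ᶠ z in 𝓝 z₀, ψ (θ (split N n d z)) = split N n d z :=
    (split N n d).continuous.continuousAt.eventually hψθ
  filter_upwards [h1, Metric.ball_mem_nhds z₀ hε] with z hz hzb f hf hK
  rw [Function.comp_apply, ← hu z hzb]
  show f (σ (ψ (θ (split N n d z)))) = f z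
  rw [hz, hdep f hf hK z hzb]

end Coordinates
end KdVMiura

namespace KdVMiura
open Filter Topology
open Jet
/-! ### Vector fields as operators on analytic functions -/

section Operators

variable {E : Type*} [NormedAddCommGroup E] [NormedSpace ℂ E]

/-- The space of the analytic functions on an open set `W`, extended by zero outside `W`. -/
def holo (W : TopologicalSpace.Opens E) : Submodule ℂ (E → ℂ) where
  carrier := {f | AnalyticOnNhd ℂ f W ∧ ∀ w ∉ W, f w = 0}
  add_mem' := fun hf hg => ⟨hf.1.add hg.1, fun w hw => by
    rw [Pi.add_apply, hf.2 w hw, hg.2 w hw, add_zero]⟩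
  zero_mem' := ⟨fun _ _ => analyticAt_const, fun _ _ => rfl⟩
  smul_mem' := fun c _ hf => ⟨fun w hw => analyticAt_const.smul (hf.1 w hw), fun w hw => by
    rw [Pi.smul_apply, hf.2 w hw, smul_zero]⟩

variable {W : TopologicalSpace.Opens E}

omit [NormedSpace ℂ E] in
theorem indicator_eventuallyEq {w : E} (hw : w ∈ W) (g : E → ℂ) :
    Set.indicator (W : Set E) g =ᶠ[𝓝 w] g := by
  filter_upwards [W.isOpen.mem_nhds hw] with w' hw' using Set.indicator_of_mem hw' g

/-- The restriction of a function to `W`. -/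
noncomputable def holo.restrict (g : E → ℂ) (hg : AnalyticOnNhd ℂ g W) : holo W :=
  ⟨Set.indicator (W : Set E) g, fun w hw => (hg w hw).congr (indicator_eventuallyEq hw g).symm,
    fun _ hw => Set.indicator_of_notMem hw g⟩

theorem holo.restrict_apply {g : E → ℂ} (hg : AnalyticOnNhd ℂ g W) {w : E} (hw : w ∈ W) :
    (holo.restrict g hg : E → ℂ) w = g w := Set.indicator_of_mem hw g

theorem holo.fderiv_restrict {g : E → ℂ} (hg : AnalyticOnNhd ℂ g W) {w : E} (hw : w ∈ W) :
    fderiv ℂ (holo.restrict g hg : E → ℂ) w = fderiv ℂ g w :=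
  (indicator_eventuallyEq hw g).fderiv_eq

theorem holo.ext {f g : holo W} (h : ∀ w ∈ W, (f : E → ℂ) w = (g : E → ℂ) w) : f = g :=
  Subtype.ext (funext fun w => by
    by_cases hw : w ∈ W
    · exact h w hw
    · rw [f.2.2 w hw, g.2.2 w hw])

theorem holo.analyticOnNhd_fderiv_apply (f : holo W) {X : E → E} (hX : AnalyticOnNhd ℂ X W) :
    AnalyticOnNhd ℂ (fun w => fderiv ℂ (f : E → ℂ) w (X w)) W :=
  fun w hw => analyticAt_fderiv_apply (f.2.1 w hw) (hX w hw)

open Classical in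
/-- The derivative along an analytic vector field on `W` (zero if `X` is not analytic). -/
noncomputable def derivAlong (W : TopologicalSpace.Opens E) (X : E → E) : Module.End ℂ (holo W) :=
  if hX : AnalyticOnNhd ℂ X W then
    { toFun := fun f => holo.restrict _ (holo.analyticOnNhd_fderiv_apply f hX)
      map_add' := fun f g => holo.ext fun w hw => by
        have h := fderiv_add (f.2.1 w hw).differentiableAt (g.2.1 w hw).differentiableAt
        refine (holo.restrict_apply (holo.analyticOnNhd_fderiv_apply (f + g) hX) hw).trans
          ((congrArg (fun T : E →L[ℂ] ℂ => T (X w)) h).trans ?_)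
        exact congrArg₂ (· + ·) (holo.restrict_apply (holo.analyticOnNhd_fderiv_apply f hX) hw).symm
          (holo.restrict_apply (holo.analyticOnNhd_fderiv_apply g hX) hw).symm
      map_smul' := fun c f => holo.ext fun w hw => by
        have h := fderiv_const_smul (f.2.1 w hw).differentiableAt c
        refine (holo.restrict_apply (holo.analyticOnNhd_fderiv_apply (c • f) hX) hw).trans
          ((congrArg (fun T : E →L[ℂ] ℂ => T (X w)) h).trans ?_)
        exact congrArg (c • ·) (holo.restrict_apply (holo.analyticOnNhd_fderiv_apply f hX) hw).symm }
  else 0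

theorem derivAlong_apply {X : E → E} (hX : AnalyticOnNhd ℂ X W) (f : holo W) {w : E} (hw : w ∈ W) :
    (derivAlong W X f : E → ℂ) w = fderiv ℂ (f : E → ℂ) w (X w) := by
  rw [derivAlong, dif_pos hX]
  exact holo.restrict_apply (holo.analyticOnNhd_fderiv_apply f hX) hw

theorem derivAlong_apply_eventuallyEq {X : E → E} (hX : AnalyticOnNhd ℂ X W) (f : holo W) {w : E}
    (hw : w ∈ W) :
    (derivAlong W X f : E → ℂ) =ᶠ[𝓝 w] fun w => fderiv ℂ (f : E → ℂ) w (X w) := by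
  filter_upwards [W.isOpen.mem_nhds hw] with w' hw' using derivAlong_apply hX f hw'

/-- The value of `T f` at the point `w`, as a functional of the operator `T`. -/
def evalAt (f : holo W) (w : E) : Module.Dual ℂ (Module.End ℂ (holo W)) where
  toFun T := (T f : E → ℂ) w
  map_add' _ _ := rfl
  map_smul' _ _ := rfl

/-- The functionals `evalAt f w` for `w ∈ W`. -/
def evaluations (W : TopologicalSpace.Opens E) : Set (Module.Dual ℂ (Module.End ℂ (holo W))) :=
  {ℓ | ∃ f : holo W, ∃ w ∈ W, ℓ = evalAt f w}

theorem eq_zero_of_evaluations (T : Module.End ℂ (holo W)) (h : ∀ ℓ ∈ evaluations W, ℓ T = 0) :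
    T = 0 :=
  LinearMap.ext fun f => holo.ext fun w hw => h _ ⟨f, w, hw, rfl⟩

end Operators

section Representation

variable {N n : ℕ}

/-- Vector fields `X(·, u)` and `Y(·, u, u₁, u₂)` in the coordinates `(x, t, v₀, …, v_{n-1})` that
represent `D_x` and `D_t` after `vₙ, vₙ₊₁, vₙ₊₂` have been expressed through `u, u₁, u₂` by
means of the map `Γ`. -/
structure Jet.IsUChart (U : Set (Jet N)) (r s : Jet N → ℂ) (w₀ : Jet n) (q₀ : Fin 3 → ℂ) (ε : ℝ)
    (X : Jet n × ℂ → Jet n) (Y : Jet n × (Fin 3 → ℂ) → Jet n)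
    (Γ : Jet n × (Fin 3 → ℂ) → Jet N) : Prop where
  pos : 0 < ε
  analytic_X : ∀ w ∈ Metric.ball w₀ ε, ∀ q ∈ Metric.ball q₀ ε, AnalyticAt ℂ X (w, q 0)
  analytic_Y : ∀ w ∈ Metric.ball w₀ ε, ∀ q ∈ Metric.ball q₀ ε, AnalyticAt ℂ Y (w, q)
  mem : ∀ w ∈ Metric.ball w₀ ε, ∀ q ∈ Metric.ball q₀ ε, Γ (w, q) ∈ U
  uMap_eq : ∀ w ∈ Metric.ball w₀ ε, ∀ q ∈ Metric.ball q₀ ε, uMap N n 3 s (Γ (w, q)) = (w, q)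
  X_eq : ∀ w ∈ Metric.ball w₀ ε, ∀ q ∈ Metric.ball q₀ ε, ∀ᶠ z in 𝓝 (Γ (w, q)),
    X (proj N n z, s z) = proj N n (fieldX z)
  Y_eq : ∀ w ∈ Metric.ball w₀ ε, ∀ q ∈ Metric.ball q₀ ε, ∀ᶠ z in 𝓝 (Γ (w, q)),
    Y (uMap N n 3 s z) = proj N n (fieldT r z)

/-- The components of `D_x` on `x, t, v₀, …, v_{n-1}` depend on `v₀, …, vₙ`, and `vₙ` is a
function of `v₀, …, v_{n-1}, u`; as `r` depends on `v₀, …, v₃` only, the components of `D_t`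
depend on `v₀, …, vₙ₊₂`, which are functions of `v₀, …, v_{n-1}, u, u₁, u₂`. -/
theorem Jet.IsMiura.exists_isUChart {U : Set (Jet N)} {r s : Jet N → ℂ} (H : IsMiura U n r s)
    (hr : Dep U r 4) (hN : n + 4 < N) (hU : U.Nonempty) :
    ∃ (w₀ : Jet n) (q₀ : Fin 3 → ℂ) (ε : ℝ) (X : Jet n × ℂ → Jet n)
      (Y : Jet n × (Fin 3 → ℂ) → Jet n) (Γ : Jet n × (Fin 3 → ℂ) → Jet N),
      IsUChart U r s w₀ q₀ ε X Y Γ := by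
  obtain ⟨z₀, hz₀⟩ := hU
  have hU := H.isOpen
  obtain ⟨Γ₁, a1, -, -, d1⟩ := H.exists_uMap_inverse (d := 1) (by omega) hz₀
  obtain ⟨Γ, a3, b3, c3, d3⟩ := H.exists_uMap_inverse (d := 3) (by omega) hz₀
  let y₀ := uMap N n 3 s z₀
  let X : Jet n × ℂ → Jet n := fun p => proj N n (fieldX (Γ₁ (p.1, fun _ => p.2)))
  let Y : Jet n × (Fin 3 → ℂ) → Jet n := fun p => proj N n (fieldT r (Γ p))
  have hcoord : ∀ (z : Jet N) (j : ℕ), fderiv ℂ (coord N j) z = coord N j := fun z j =>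
    (coord N j).fderiv
  -- the fields have the required form near the base point
  have hX : ∀ᶠ z in 𝓝 z₀, X (proj N n z, s z) = proj N n (fieldX z) := by
    filter_upwards [d1] with z hz
    have h1 : ((proj N n z, fun _ => s z) : Jet n × (Fin 1 → ℂ)) = uMap N n 1 s z :=
      Prod.ext rfl (funext fun k => by rw [Subsingleton.elim k 0]; rfl)
    simp only [X, h1]
    refine Prod.ext rfl (Prod.ext ?_ (funext fun i => ?_))
    · simp [proj, fieldX_eq]
    · show coord N i (fieldX _) = coord N i (fieldX z)
      have hi : (i : ℕ) < N := by omega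
      simp only [coord_of_lt hi, fieldX_eq]
      exact hz (coord N (i + 1)) (fun z _ => (coord N (i + 1)).analyticAt z) fun z _ j hj => by
        rw [hcoord]; exact coord_basisVec_of_ne (by omega)
  have hY : ∀ᶠ z in 𝓝 z₀, Y (uMap N n 3 s z) = proj N n (fieldT r z) := by
    filter_upwards [d3] with z hz
    refine Prod.ext rfl (Prod.ext rfl (funext fun i => ?_))
    have hi : (i : ℕ) < N := by omega
    show coord N i (fieldT r _) = coord N i (fieldT r z)
    simp only [coord_of_lt hi]
    exact hz (dX^[i] r) (analyticOnNhd_iterate_dX H.analytic_r i)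
      ((hr.iterate_dX hU H.analytic_r i).mono (by omega))
  have tΓ : Tendsto Γ (𝓝 y₀) (𝓝 z₀) := by
    have := a3.continuousAt.tendsto
    rwa [b3] at this
  have e1 : ∀ᶠ y in 𝓝 y₀, AnalyticAt ℂ X (y.1, y.2 0) := by
    have h1 : AnalyticAt ℂ X (y₀.1, y₀.2 0) := by
      have h2 : AnalyticAt ℂ (fun p : Jet n × ℂ => ((p.1, fun _ => p.2) : Jet n × (Fin 1 → ℂ)))
          (y₀.1, y₀.2 0) := analyticAt_fst.prod (AnalyticAt.pi fun _ => analyticAt_snd)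
      have h3 : ((y₀.1, fun _ => y₀.2 0) : Jet n × (Fin 1 → ℂ)) = uMap N n 1 s z₀ :=
        Prod.ext rfl (funext fun k => by rw [Subsingleton.elim k 0]; rfl)
      have h4 := AnalyticAt.comp_of_eq (g := Γ₁) a1 h2 h3
      exact ((proj N n).analyticAt _).comp ((analyticAt_fieldX _).comp h4)
    have h5 : ContinuousAt (fun y : Jet n × (Fin 3 → ℂ) => (y.1, y.2 0)) y₀ := by fun_prop
    exact h5.eventually h1.eventually_analyticAt
  have e2 : ∀ᶠ y in 𝓝 y₀, AnalyticAt ℂ Y y := by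
    refine AnalyticAt.eventually_analyticAt (((proj N n).analyticAt _).comp ?_)
    exact analyticAt_const.prod (analyticAt_const.prod (AnalyticAt.pi fun i =>
      AnalyticAt.comp_of_eq (analyticOnNhd_iterate_dX H.analytic_r i z₀ hz₀) a3 b3))
  have e3 : ∀ᶠ y in 𝓝 y₀, Γ y ∈ U := tΓ.eventually (hU.mem_nhds hz₀)
  have e4 := tΓ.eventually (eventually_eventually_nhds.mpr hX)
  have e5 := tΓ.eventually (eventually_eventually_nhds.mpr hY)
  obtain ⟨ε, hε, hball⟩ := Metric.eventually_nhds_iff_ball.mp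
    (e1.and (e2.and (e3.and (c3.and (e4.and e5)))))
  have key : ∀ w ∈ Metric.ball y₀.1 ε, ∀ q ∈ Metric.ball y₀.2 ε, (w, q) ∈ Metric.ball y₀ ε :=
    fun w hw q hq => by
      have h : (w, q) ∈ Metric.ball y₀.1 ε ×ˢ Metric.ball y₀.2 ε := ⟨hw, hq⟩
      rwa [ball_prod_same] at h
  exact ⟨y₀.1, y₀.2, ε, X, Y, Γ, hε, fun w hw q hq => (hball _ (key w hw q hq)).1,
    fun w hw q hq => (hball _ (key w hw q hq)).2.1,
    fun w hw q hq => (hball _ (key w hw q hq)).2.2.1,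
    fun w hw q hq => (hball _ (key w hw q hq)).2.2.2.1,
    fun w hw q hq => (hball _ (key w hw q hq)).2.2.2.2.1,
    fun w hw q hq => (hball _ (key w hw q hq)).2.2.2.2.2⟩

variable {U : Set (Jet N)} {r s : Jet N → ℂ} {w₀ : Jet n} {q₀ : Fin 3 → ℂ} {ε : ℝ}
  {X : Jet n × ℂ → Jet n} {Y : Jet n × (Fin 3 → ℂ) → Jet n} {Γ : Jet n × (Fin 3 → ℂ) → Jet N}

/-- The commutation of `D_x` and `D_t` on a function of `x, t, v₀, …, v_{n-1}`, in the coordinates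
`u, u₁, u₂, …`, at one point of the jet space. -/
theorem Jet.IsUChart.commute_at (H : IsMiura U n r s) (hN : n + 4 < N) {f : Jet n → ℂ} {z : Jet N}
    (hz : z ∈ U) (hf : AnalyticAt ℂ f (proj N n z))
    (hX : AnalyticAt ℂ X (proj N n z, s z)) (hY : AnalyticAt ℂ Y (uMap N n 3 s z))
    (eX : ∀ᶠ z in 𝓝 z, X (proj N n z, s z) = proj N n (fieldX z))
    (eY : ∀ᶠ z in 𝓝 z, Y (uMap N n 3 s z) = proj N n (fieldT r z)) :
    fderiv ℂ (fun p : Jet n × (Fin 3 → ℂ) => fderiv ℂ f p.1 (Y p)) (uMap N n 3 s z)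
        (X (proj N n z, s z), fun k => (dX^[(k : ℕ) + 1] s) z) =
      fderiv ℂ (fun p : Jet n × ℂ => fderiv ℂ f p.1 (X p)) (proj N n z, s z)
        (Y (uMap N n 3 s z), (dX^[3] s) z + s z * (dX^[1] s) z) := by
  have hp : ∀ᶠ z' in 𝓝 z, AnalyticAt ℂ f (proj N n z') :=
    (proj N n).continuous.continuousAt.eventually hf.eventually_analyticAt
  have hfp : ∀ᶠ z' in 𝓝 z, ∀ v,
      fderiv ℂ (f ∘ proj N n) z' v = fderiv ℂ f (proj N n z') (proj N n v) := by
    filter_upwards [hp] with z' hz' v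
    rw [(hz'.differentiableAt.hasFDerivAt.comp z' (proj N n).hasFDerivAt).fderiv]
    rfl
  have hfz : AnalyticAt ℂ (f ∘ proj N n) z := hf.comp ((proj N n).analyticAt z)
  have h1 := (analyticAt_fderiv_apply (p := fun p : Jet n × (Fin 3 → ℂ) => p.1) hf hY
    analyticAt_fst).differentiableAt.hasFDerivAt.comp z
      (hasFDerivAt_uMap (n := n) (d := 3) H.analytic_s hz)
  have h1' : (fun z => fderiv ℂ (f ∘ proj N n) z (fieldT r z)) =ᶠ[𝓝 z]
      (fun p : Jet n × (Fin 3 → ℂ) => fderiv ℂ f p.1 (Y p)) ∘ uMap N n 3 s := by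
    filter_upwards [hfp, eY] with z' h2 h3
    rw [h2, ← h3]
    rfl
  have h2 := (analyticAt_fderiv_apply (p := fun p : Jet n × ℂ => p.1) hf hX
    analyticAt_fst).differentiableAt.hasFDerivAt.comp z
      ((proj N n).hasFDerivAt.prodMk (H.analytic_s z hz).differentiableAt.hasFDerivAt)
  have h2' : dX (f ∘ proj N n) =ᶠ[𝓝 z]
      (fun p : Jet n × ℂ => fderiv ℂ f p.1 (X p)) ∘ fun z => (proj N n z, s z) := by
    filter_upwards [hfp, eX] with z' h2 h3
    rw [dX, h2, ← h3]
    rfl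
  have h3 := dX_dT_comm (K := n) H.analytic_r hz hfz (fun j hj => by
    rw [hfp.self_of_nhds]
    have : proj N n (basisVec N j) = 0 := by
      refine Prod.ext rfl (Prod.ext rfl (funext fun i => ?_))
      exact coord_basisVec_of_ne (by omega)
    rw [this, map_zero]) (by omega)
  rw [(h1.congr_of_eventuallyEq h1').fderiv, (h2.congr_of_eventuallyEq h2').fderiv] at h3
  rw [eX.self_of_nhds, eY.self_of_nhds]
  have h4 := H.transforms z hz
  have h5 : ((fun k : Fin 3 => (dX^[(k : ℕ) + 1] s) z) : Fin 3 → ℂ) =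
      fun k : Fin 3 => fderiv ℂ (dX^[k] s) z (fieldX z) := funext fun k => by
    rw [Function.iterate_succ_apply']; rfl
  rw [h5]
  refine h3.trans ?_
  show _ = fderiv ℂ _ _ (_, (dX^[3] s) z + s z * dX s z)
  rw [← h4]
  rfl

end Representation
end KdVMiura

namespace KdVMiura
open Filter Topology
open Jet

/-! ### The zero-curvature representation of a substitution -/

section Curvature

-- the commutator bracket on the endomorphisms
attribute [local instance] LieRing.ofAssociativeRing LieAlgebra.ofAssociativeAlgebra

variable {N n : ℕ} {U : Set (Jet N)} {r s : Jet N → ℂ} {w₀ : Jet n} {q₀ : Fin 3 → ℂ} {ε : ℝ}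
  {X : Jet n × ℂ → Jet n} {Y : Jet n × (Fin 3 → ℂ) → Jet n} {Γ : Jet n × (Fin 3 → ℂ) → Jet N}

/-- The commutation of `D_x` and `D_t` on a function of `x, t, v₀, …, v_{n-1}`, in the coordinates
`u, u₁, u₂, u₃`. The coordinate `u₃ = c 2` takes arbitrary values: the equation is affine in it, and
`u₃` varies with `vₙ₊₃` while the other coordinates are fixed. -/
theorem Jet.IsUChart.commute (C : IsUChart U r s w₀ q₀ ε X Y Γ) (H : IsMiura U n r s)
    (hN : n + 4 < N) {f : Jet n → ℂ} {w : Jet n} (hw : w ∈ Metric.ball w₀ ε) {q : Fin 3 → ℂ}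
    (hq : q ∈ Metric.ball q₀ ε) (hf : AnalyticAt ℂ f w) {c : Fin 3 → ℂ} (h0 : c 0 = q 1)
    (h1 : c 1 = q 2) :
    fderiv ℂ (fun p : Jet n × (Fin 3 → ℂ) => fderiv ℂ f p.1 (Y p)) (w, q) (X (w, q 0), c) =
      fderiv ℂ (fun p : Jet n × ℂ => fderiv ℂ f p.1 (X p)) (w, q 0)
        (Y (w, q), c 2 + q 0 * q 1) := by
  have hU := H.isOpen
  obtain ⟨z, hz⟩ : ∃ z, z = Γ (w, q) := ⟨_, rfl⟩
  have hzU : z ∈ U := hz ▸ C.mem w hw q hq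
  have hu : uMap N n 3 s z = (w, q) := hz ▸ C.uMap_eq w hw q hq
  obtain ⟨T, hT⟩ : ∃ T, T = fderiv ℂ (fun p : Jet n × (Fin 3 → ℂ) => fderiv ℂ f p.1 (Y p)) (w, q) :=
    ⟨_, rfl⟩
  obtain ⟨T', hT'⟩ : ∃ T', T' = fderiv ℂ (fun p : Jet n × ℂ => fderiv ℂ f p.1 (X p)) (w, q 0) :=
    ⟨_, rfl⟩
  rw [← hT, ← hT']
  have at_point : ∀ z' ∈ U, uMap N n 3 s z' = (w, q) →
      (∀ᶠ z in 𝓝 z', X (proj N n z, s z) = proj N n (fieldX z)) →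
      (∀ᶠ z in 𝓝 z', Y (uMap N n 3 s z) = proj N n (fieldT r z)) →
      T (X (w, q 0), ![q 1, q 2, (dX^[3] s) z']) =
        T' (Y (w, q), (dX^[3] s) z' + q 0 * q 1) := fun z' hz' hu' eX eY => by
    have hp : proj N n z' = w := congrArg Prod.fst hu'
    have hs : ∀ k : Fin 3, (dX^[k] s) z' = q k := fun k => congrFun (congrArg Prod.snd hu') k
    have hs0 : s z' = q 0 := hs 0
    have hs1 : (dX^[1] s) z' = q 1 := hs 1
    have hs2 : (dX^[2] s) z' = q 2 := hs 2
    have h := IsUChart.commute_at (X := X) (Y := Y) (f := f) H hN hz' (by rwa [hp])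
      (by rw [hp, hs0]; exact C.analytic_X w hw q hq)
      (by rw [hu']; exact C.analytic_Y w hw q hq) eX eY
    have hv : (fun k : Fin 3 => (dX^[(k : ℕ) + 1] s) z') = ![q 1, q 2, (dX^[3] s) z'] := by
      ext k; fin_cases k
      exacts [hs1, hs2, rfl]
    rw [hv, hu', hp, hs0, hs1, ← hT, ← hT'] at h
    exact h
  -- along the direction of `vₙ₊₃`, only `u₃` varies
  have hline : ∀ᶠ c : ℂ in 𝓝 0,
      T (X (w, q 0), ![q 1, q 2, (dX^[3] s) (z + c • basisVec N (n + 3))]) =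
      T' (Y (w, q), (dX^[3] s) (z + c • basisVec N (n + 3)) + q 0 * q 1) := by
    obtain ⟨δ, hδ, hball⟩ := Metric.isOpen_iff.mp hU z hzU
    have ht : Tendsto (fun c : ℂ => z + c • basisVec N (n + 3)) (𝓝 0) (𝓝 z) := by
      have : Continuous fun c : ℂ => z + c • basisVec N (n + 3) := by fun_prop
      simpa using this.tendsto 0
    have hz0 : ∀ c : ℂ, ∀ i : Fin N, (i : ℕ) < n + 3 →
        (z + c • basisVec N (n + 3)).2.2 i = z.2.2 i := fun c i hi => by
      have hne : (i : ℕ) ≠ n + 3 := hi.ne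
      simp [basisVec, hne]
    have eX := ht.eventually (eventually_eventually_nhds.mpr (hz ▸ C.X_eq w hw q hq))
    have eY := ht.eventually (eventually_eventually_nhds.mpr (hz ▸ C.Y_eq w hw q hq))
    filter_upwards [ht.eventually (Metric.ball_mem_nhds z hδ), eX, eY] with c hc hcX hcY
    refine at_point _ (hball hc) ?_ hcX hcY
    rw [← hu]
    refine Prod.ext (Prod.ext ?_ (Prod.ext ?_ (funext fun i => ?_))) (funext fun k => ?_)
    · simp [uMap, proj, basisVec]
    · simp [uMap, proj, basisVec]
    · have hi : (i : ℕ) < N := by omega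
      show coord N i _ = coord N i _
      rw [coord_of_lt hi, coord_of_lt hi]
      exact hz0 c ⟨i, hi⟩ (by simp only []; omega)
    · refine Dep.eq_of_forall_lt (convex_ball z δ) (fun z' hz' =>
        (analyticOnNhd_iterate_dX H.analytic_s k z' (hball hz')).differentiableAt)
        (fun z' hz' => ((H.dep_s.iterate_dX hU H.analytic_s k).mono
          (by omega : n + 1 + (k : ℕ) ≤ n + 3)) z' (hball hz')) hc (Metric.mem_ball_self hδ) ?_ ?_
        (hz0 c)
      · simp [basisVec]
      · simp [basisVec]
  have split_T : ∀ b : ℂ, T (X (w, q 0), ![q 1, q 2, b]) =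
      T (X (w, q 0), ![q 1, q 2, 0]) + b * T (0, Pi.single 2 1) := fun b => by
    rw [← smul_eq_mul, ← map_smul, ← map_add]
    congr 1
    refine Prod.ext (by simp) (funext fun k => ?_)
    show ![q 1, q 2, b] k = ![q 1, q 2, 0] k + b * (Pi.single 2 1 : Fin 3 → ℂ) k
    fin_cases k <;> simp
  have split_T' : ∀ b : ℂ, T' (Y (w, q), b + q 0 * q 1) =
      T' (Y (w, q), q 0 * q 1) + b * T' (0, 1) := fun b => by
    rw [← smul_eq_mul b (T' (0, 1)), ← map_smul, ← map_add]
    congr 1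
    refine Prod.ext (by simp) ?_
    simp [add_comm]
  replace hline := hline.mono fun c hc => by rwa [split_T, split_T'] at hc
  -- both sides are affine in `u₃` with equal slopes, as `∂u₃/∂vₙ₊₃ = ∂s/∂vₙ ≠ 0`
  have slope : T (0, Pi.single 2 1) = T' (0, 1) := by
    have hd : HasDerivAt (fun c : ℂ => (dX^[3] s) (z + c • basisVec N (n + 3)))
        (fderiv ℂ s z (basisVec N n)) 0 := by
      have h := hasDerivAt_of_eq_comp_affine (g := fun c : ℂ =>
        (dX^[3] s) (z + c • basisVec N (n + 3))) (c := 0) (v := basisVec N (n + 3)) hU hzU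
        (analyticOnNhd_iterate_dX H.analytic_s 3 z hzU).differentiableAt
        (fun c _ => by rw [sub_zero])
      rwa [H.dep_s.fderiv_iterate_dX hU H.analytic_s (by omega) hzU] at h
    have h2 := (hd.mul_const (T (0, Pi.single 2 1))).const_add (T (X (w, q 0), ![q 1, q 2, 0]))
    have h3 := (hd.mul_const (T' (0, 1))).const_add (T' (Y (w, q), q 0 * q 1))
    exact mul_left_cancel₀ (H.lead_ne_zero z hzU)
      ((h2.congr_of_eventuallyEq (hline.mono fun c hc => hc.symm)).unique h3)
  have h3 := hline.self_of_nhds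
  rw [slope] at h3
  have hc : c = ![q 1, q 2, c 2] := by
    ext k; fin_cases k
    exacts [h0, h1, rfl]
  rw [hc, split_T, slope]
  show _ = T' (Y (w, q), c 2 + q 0 * q 1)
  rw [split_T', add_right_cancel h3]

/-- The domain of the vector fields of a chart. -/
def ballOpens (w₀ : Jet n) (ε : ℝ) : TopologicalSpace.Opens (Jet n) :=
  ⟨Metric.ball w₀ ε, Metric.isOpen_ball⟩

theorem Jet.IsUChart.analyticOnNhd_X (C : IsUChart U r s w₀ q₀ ε X Y Γ) {u : ℂ}
    (hu : u ∈ Metric.ball (q₀ 0) ε) :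
    AnalyticOnNhd ℂ (fun w => X (w, u)) (ballOpens w₀ ε) := fun w hw => by
  have hq : Function.update q₀ 0 u ∈ Metric.ball q₀ ε :=
    update_mem_ball C.pos hu
  have h := C.analytic_X w hw _ hq
  rw [Function.update_self] at h
  exact h.comp (f := fun w => (w, u)) (analyticAt_id.prod analyticAt_const)

theorem Jet.IsUChart.analyticOnNhd_Y (C : IsUChart U r s w₀ q₀ ε X Y Γ) {q : Fin 3 → ℂ}
    (hq : q ∈ Metric.ball q₀ ε) :
    AnalyticOnNhd ℂ (fun w => Y (w, q)) (ballOpens w₀ ε) := fun w hw =>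
  (C.analytic_Y w hw q hq).comp (f := fun w => (w, q)) (analyticAt_id.prod analyticAt_const)

/-- The vector fields that represent `D_x` and `D_t` form a zero-curvature representation with
values in the differential operators. -/
theorem Jet.IsUChart.isZCR (C : IsUChart U r s w₀ q₀ ε X Y Γ) (H : IsMiura U n r s)
    (hN : n + 4 < N) : IsZCR 3 kdv (evaluations (ballOpens w₀ ε)) (Metric.ball q₀ ε)
      (fun u => derivAlong (ballOpens w₀ ε) fun w => X (w, u))
      (fun q => derivAlong (ballOpens w₀ ε) fun w => Y (w, q)) := by
  have h0 : ∀ q ∈ Metric.ball q₀ ε, q 0 ∈ Metric.ball (q₀ 0) ε := fun q hq => by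
    rw [ball_pi _ C.pos] at hq; exact hq 0 trivial
  have eA : ∀ (f : holo (ballOpens w₀ ε)), ∀ w ∈ ballOpens w₀ ε, ∀ u ∈ Metric.ball (q₀ 0) ε,
      (fun u => evalAt f w (derivAlong (ballOpens w₀ ε) fun w => X (w, u))) =ᶠ[𝓝 u]
        fun u => fderiv ℂ (f : Jet n → ℂ) w (X (w, u)) := fun f w hw u hu => by
    filter_upwards [Metric.isOpen_ball.mem_nhds hu] with u' hu'
    exact derivAlong_apply (C.analyticOnNhd_X hu') f hw
  have eB : ∀ (f : holo (ballOpens w₀ ε)), ∀ w ∈ ballOpens w₀ ε, ∀ q ∈ Metric.ball q₀ ε,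
      (fun q => evalAt f w (derivAlong (ballOpens w₀ ε) fun w => Y (w, q))) =ᶠ[𝓝 q]
        fun q => fderiv ℂ (f : Jet n → ℂ) w (Y (w, q)) := fun f w hw q hq => by
    filter_upwards [Metric.isOpen_ball.mem_nhds hq] with q' hq'
    exact derivAlong_apply (C.analyticOnNhd_Y hq') f hw
  refine ⟨?_, ?_, ?_⟩
  · rintro _ ⟨f, w, hw, rfl⟩ _ ⟨q, hq, rfl⟩
    refine AnalyticAt.congr ?_ (eA f w hw (q 0) (h0 q hq)).symm
    exact analyticAt_fderiv_apply (p := fun _ => w) (f.2.1 w hw)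
      ((C.analytic_X w hw q hq).comp (f := fun u => (w, u)) (analyticAt_const.prod analyticAt_id))
      analyticAt_const
  · rintro _ ⟨f, w, hw, rfl⟩ q hq
    refine AnalyticAt.congr ?_ (eB f w hw q hq).symm
    exact analyticAt_fderiv_apply (p := fun _ => w) (f.2.1 w hw)
      ((C.analytic_Y w hw q hq).comp (f := fun q => (w, q)) (analyticAt_const.prod analyticAt_id))
      analyticAt_const
  · rintro _ ⟨f, w, hw, rfl⟩ u hu
    obtain ⟨q, hqu⟩ : ∃ q : Fin 3 → ℂ, q = fun i : Fin 3 => u i := ⟨_, rfl⟩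
    have hqi : ∀ i : Fin 3, u i = q i := fun i => by rw [hqu]
    have hq0 : u 0 = q 0 := hqi 0
    have hq1 : u 1 = q 1 := hqi 1
    have hq2 : u 2 = q 2 := hqi 2
    rw [← hqu] at hu ⊢
    have dY := (analyticAt_fderiv_apply (p := fun p : Jet n × (Fin 3 → ℂ) => p.1) (f.2.1 w hw)
      (C.analytic_Y w hw q hu) analyticAt_fst).differentiableAt.hasFDerivAt
    have dX := (analyticAt_fderiv_apply (p := fun p : Jet n × ℂ => p.1) (f.2.1 w hw)
      (C.analytic_X w hw q hu) analyticAt_fst).differentiableAt.hasFDerivAt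
    have key := C.commute H hN (f := f) hw hu (f.2.1 w hw) (c := fun i => u (i + 1)) hq1 hq2
    obtain ⟨T, hT⟩ : ∃ T, T = fderiv ℂ (fun p : Jet n × (Fin 3 → ℂ) =>
      fderiv ℂ (f : Jet n → ℂ) p.1 (Y p)) (w, q) := ⟨_, rfl⟩
    obtain ⟨T', hT'⟩ : ∃ T', T' = fderiv ℂ (fun p : Jet n × ℂ =>
      fderiv ℂ (f : Jet n → ℂ) p.1 (X p)) (w, q 0) := ⟨_, rfl⟩
    rw [← hT] at dY
    rw [← hT'] at dX
    rw [← hT, ← hT'] at key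
    have b1 : ∀ i : Fin 3, deriv (fun c => evalAt f w (derivAlong (ballOpens w₀ ε) fun w =>
        Y (w, Function.update q i c))) (u i) = T (0, Pi.single i 1) := fun i => by
      rw [hqi i]
      have h1 : HasDerivAt (fun c => (w, Function.update q i c)) (0, Pi.single i 1) (q i) :=
        (hasDerivAt_const _ _).prodMk (hasDerivAt_update q i (q i))
      have h2 := HasFDerivAt.comp_hasDerivAt_of_eq (q i) dY h1 (by rw [Function.update_eq_self])
      have h3 : Tendsto (Function.update q i) (𝓝 (q i)) (𝓝 q) := by
        have := (hasDerivAt_update q i (q i)).continuousAt.tendsto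
        rwa [Function.update_eq_self] at this
      exact (h2.congr_of_eventuallyEq (h3.eventually (eB f w hw q hu))).deriv
    have b2 : deriv (fun c => evalAt f w (derivAlong (ballOpens w₀ ε) fun w => X (w, c))) (q 0) =
        T' (0, 1) := by
      have h1 : HasDerivAt (fun c : ℂ => (w, c)) (0, 1) (q 0) :=
        (hasDerivAt_const _ _).prodMk (hasDerivAt_id _)
      exact ((dX.comp_hasDerivAt (q 0) h1).congr_of_eventuallyEq (eA f w hw _ (h0 q hu))).deriv
    have b3 : evalAt f w ⁅derivAlong (ballOpens w₀ ε) (fun w => X (w, q 0)),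
        derivAlong (ballOpens w₀ ε) fun w => Y (w, q)⁆ = T (X (w, q 0), 0) - T' (Y (w, q), 0) := by
      have g1 : HasFDerivAt (fun w => (w, q)) (ContinuousLinearMap.inl ℂ (Jet n) (Fin 3 → ℂ)) w :=
        hasFDerivAt_prodMk_left w q
      have g2 : HasFDerivAt (fun w => (w, q 0)) (ContinuousLinearMap.inl ℂ (Jet n) ℂ) w :=
        hasFDerivAt_prodMk_left w (q 0)
      have k1 := (((dY.comp w g1).congr_of_eventuallyEq
        (derivAlong_apply_eventuallyEq (C.analyticOnNhd_Y hu) f hw))).fderiv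
      have k2 := (((dX.comp w g2).congr_of_eventuallyEq
        (derivAlong_apply_eventuallyEq (C.analyticOnNhd_X (h0 q hu)) f hw))).fderiv
      have l1 := derivAlong_apply (C.analyticOnNhd_X (h0 q hu))
        (derivAlong (ballOpens w₀ ε) (fun w => Y (w, q)) f) hw
      have l2 := derivAlong_apply (C.analyticOnNhd_Y hu)
        (derivAlong (ballOpens w₀ ε) (fun w => X (w, q 0)) f) hw
      rw [k1] at l1
      rw [k2] at l2
      exact congrArg₂ (· - ·) l1 l2
    have b4 : (∑ i : Fin 3, u (i + 1) * T (0, Pi.single i 1)) =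
        T (0, fun i : Fin 3 => u (i + 1)) := by
      simp only [← smul_eq_mul, ← map_smul, ← map_sum]
      congr 1
      refine Prod.ext (by simp [Prod.fst_sum]) (funext fun k => ?_)
      simp [Prod.snd_sum, Pi.single_apply]
    simp only [b1]
    rw [hq0, b2, b3, b4, kdv, hq0, hq1]
    have c1 : T (X (w, q 0), fun i : Fin 3 => u (i + 1)) =
        T (X (w, q 0), 0) + T (0, fun i : Fin 3 => u (i + 1)) := by
      rw [← map_add]; simp
    have c2 : T' (Y (w, q), u 3 + q 0 * q 1) =
        T' (Y (w, q), 0) + (u 3 + q 0 * q 1) * T' (0, 1) := by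
      rw [← smul_eq_mul (u 3 + q 0 * q 1) (T' (0, 1)), ← map_smul, ← map_add]; simp
    rw [c1] at key
    have key' := key.trans c2
    linear_combination key'

end Curvature
end KdVMiura

namespace KdVMiura
open Filter Topology
open Jet
/-! ### The bound on the order -/

section Bound

-- the commutator bracket on the endomorphisms
attribute [local instance] LieRing.ofAssociativeRing LieAlgebra.ofAssociativeAlgebra

variable {N n : ℕ} {U : Set (Jet N)} {r s : Jet N → ℂ} {w₀ : Jet n} {q₀ : Fin 3 → ℂ} {ε : ℝ}
  {X : Jet n × ℂ → Jet n} {Y : Jet n × (Fin 3 → ℂ) → Jet n} {Γ : Jet n × (Fin 3 → ℂ) → Jet N}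

/-- All components of `X(·, u)` but the last one are those of `D_x`. -/
theorem Jet.IsUChart.X_apply (C : IsUChart U r s w₀ q₀ ε X Y Γ) (hN : n < N) {w : Jet n}
    (hw : w ∈ Metric.ball w₀ ε) {u : ℂ} (hu : u ∈ Metric.ball (q₀ 0) ε) :
    (X (w, u)).1 = 1 ∧ (X (w, u)).2.1 = 0 ∧
      ∀ i, i + 1 < n → coord n i (X (w, u)) = coord n (i + 1) w := by
  have hq : Function.update q₀ 0 u ∈ Metric.ball q₀ ε :=
    update_mem_ball C.pos hu
  have h1 := (C.X_eq w hw _ hq).self_of_nhds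
  have h2 := C.uMap_eq w hw _ hq
  have h3 : proj N n (Γ (w, Function.update q₀ 0 u)) = w := congrArg Prod.fst h2
  have h4 : s (Γ (w, Function.update q₀ 0 u)) = u := by
    exact (congrFun (congrArg Prod.snd h2) 0).trans (Function.update_self 0 u q₀)
  rw [h3, h4] at h1
  rw [h1]
  refine ⟨?_, ?_, fun i hi => ?_⟩
  · simp [proj, fieldX_eq]
  · simp [proj, fieldX_eq]
  · have hiN : i < N := by omega
    have hin : i < n := by omega
    rw [coord_of_lt hin, coord_of_lt hi, ← h3]
    show coord N i (fieldX _) = coord N (i + 1) _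
    rw [coord_of_lt hiN, fieldX_eq, h3]

/-- If `n ≥ 4`, the coefficient `b` of the representation kills the functions independent of
`v_{n-1}`, `m = ⁅a, b⁆` kills those independent of `v_{n-1}, v_{n-2}`, and `κ = ⁅a, m⁆` those
independent of `v_{n-1}, v_{n-2}, v_{n-3}`. The relation `⁅a, κ⁆ = -9 ⁅⁅m, κ⁆, κ⁆`, applied to
`v_{n-4}`, gives `b v_{n-1} = 0`, so that `D_x v_{n-1} = vₙ` would not depend on `u`. -/
theorem Jet.IsMiura.order_le_three (H : IsMiura U n r s) (hr : Dep U r 4) (hN : n + 4 < N)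
    (hU : U.Nonempty) : n ≤ 3 := by
  by_contra hn
  obtain ⟨w₀, q₀, ε, X, Y, Γ, C⟩ := H.exists_isUChart hr hN hU
  obtain ⟨k, rfl⟩ : ∃ k, n = k + 4 := ⟨n - 4, by omega⟩
  obtain ⟨W, hW⟩ : ∃ W, W = ballOpens w₀ ε := ⟨_, rfl⟩
  have hZ := C.isZCR H hN
  rw [← hW] at hZ
  obtain ⟨δ, hδ, hball, a, b, c, d, hR, hA, -⟩ := hZ.exists_relations eq_zero_of_evaluations
    Metric.isOpen_ball (Metric.mem_ball_self C.pos)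
  have hδε : ∀ u ∈ Metric.ball (q₀ 0) δ, u ∈ Metric.ball (q₀ 0) ε := fun u hu => by
    have h := hball (update_mem_ball hδ hu)
    rw [ball_pi _ C.pos] at h
    simpa using h 0 trivial
  have hWb : ∀ {w}, w ∈ W → w ∈ Metric.ball w₀ ε := fun hw => by rw [hW] at hw; exact hw
  have hX : ∀ u ∈ Metric.ball (q₀ 0) δ, AnalyticOnNhd ℂ (fun w => X (w, u)) W := fun u hu => by
    rw [hW]; exact C.analyticOnNhd_X (hδε u hu)
  have act : ∀ (f : holo W), ∀ u ∈ Metric.ball (q₀ 0) δ, ∀ w ∈ W,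
      (zcrA a b c u f : Jet (k + 4) → ℂ) w = fderiv ℂ (f : Jet (k + 4) → ℂ) w (X (w, u)) :=
    fun f u hu w hw => by
      rw [← hA u hu]; exact derivAlong_apply (hX u hu) f hw
  have hq0 := Metric.mem_ball_self (x := q₀ 0) hδ
  -- the operators `b` and `c` kill the functions that do not depend on the last coordinate
  have const : ∀ f : holo W, Dep (W : Set (Jet (k + 4))) f (k + 3) → b f = 0 ∧ c f = 0 ∧
      a f = zcrA a b c (q₀ 0) f := fun f hf => by
    obtain ⟨h0, h1, h2, -⟩ := smul_coeff_eq_zero_of_forall_mem_ball hδ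
      (c₀ := a f - zcrA a b c (q₀ 0) f) (c₁ := b f) (c₂ := (1 / 2 : ℂ) • c f) (c₃ := 0) (c₄ := 0)
      (c₅ := 0) fun u hu => by
        have h : zcrA a b c u f = zcrA a b c (q₀ 0) f := holo.ext fun w hw => by
          rw [act f u hu w hw, act f _ hq0 w hw]
          obtain ⟨x1, x2, x3⟩ := C.X_apply (by omega) (hWb hw) (hδε u hu)
          obtain ⟨y1, y2, y3⟩ := C.X_apply (by omega) (hWb hw) (hδε _ hq0)
          refine map_eq_of_forall_lt (hf w hw) (x1.trans y1.symm) (x2.trans y2.symm) fun i hi => ?_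
          rw [← coord_fin, ← coord_fin, x3 i (by omega), y3 i (by omega)]
        have h' : zcrA a b c u f = a f + u • b f + (u ^ 2 / 2) • c f := rfl
        rw [h'] at h
        linear_combination (norm := module) h
    exact ⟨h1, (smul_eq_zero.mp h2).resolve_left (by norm_num), sub_eq_zero.mp h0⟩
  -- the operator `a` raises the number of the coordinates by one
  have raise : ∀ (f : holo W) (j : ℕ), j ≤ k + 3 → Dep (W : Set (Jet (k + 4))) f j →
      Dep (W : Set (Jet (k + 4))) (a f : holo W) (j + 1) := fun f j hj hf w hw i hi => by
    have e1 : (a f : Jet (k + 4) → ℂ) =ᶠ[𝓝 w]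
        fun w => fderiv ℂ (f : Jet (k + 4) → ℂ) w (X (w, q₀ 0)) := by
      filter_upwards [W.isOpen.mem_nhds hw] with w' hw'
      rw [(const f (hf.mono hj)).2.2]
      exact act f _ hq0 w' hw'
    have e2 : ∀ᶠ w' in 𝓝 w, fderiv ℂ (f : Jet (k + 4) → ℂ) w' (basisVec (k + 4) i) = 0 := by
      filter_upwards [W.isOpen.mem_nhds hw] with w' hw' using hf w' hw' i (by omega)
    have dX := (hX _ hq0 w hw).differentiableAt.hasFDerivAt
    rw [e1.fderiv_eq, fderiv_fderiv_apply_of_eventually_eq_zero (f.2.1 w hw) dX e2,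
      ← map_zero (fderiv ℂ (f : Jet (k + 4) → ℂ) w)]
    have eX : ∀ᶠ w' in 𝓝 w, w' ∈ W := W.isOpen.mem_nhds hw
    have comp : ∀ (T T' : Jet (k + 4) →L[ℂ] ℂ) (y : ℂ), (∀ w' ∈ W, T (X (w', q₀ 0)) = T' w' + y) →
        T (fderiv ℂ (fun w => X (w, q₀ 0)) w (basisVec (k + 4) i)) = T' (basisVec (k + 4) i) :=
      fun T T' y h => by
        have h1 := T.hasFDerivAt.comp w dX
        have h2 := (T'.hasFDerivAt (x := w)).add_const y
        exact congrArg (fun T : Jet (k + 4) →L[ℂ] ℂ => T (basisVec (k + 4) i))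
          (h1.unique (h2.congr_of_eventuallyEq (eX.mono h)))
    refine map_eq_of_forall_lt (hf w hw) ?_ ?_ fun l hl => ?_
    · exact comp (ContinuousLinearMap.fst ℂ _ _) 0 1 fun w' hw' => by
        simpa using (C.X_apply (by omega) (hWb hw') (hδε _ hq0)).1
    · exact comp ((ContinuousLinearMap.fst ℂ _ _).comp (ContinuousLinearMap.snd ℂ _ _)) 0 0
        fun w' hw' => by simpa using (C.X_apply (by omega) (hWb hw') (hδε _ hq0)).2.1
    · rw [← coord_fin, comp (coord (k + 4) l) (coord (k + 4) (l + 1)) 0 fun w' hw' => by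
        simpa using (C.X_apply (by omega) (hWb hw') (hδε _ hq0)).2.2 l (by omega)]
      exact coord_basisVec_of_ne (by omega)
  have mul_apply : ∀ (S T : Module.End ℂ (holo W)) (f : holo W), ⁅S, T⁆ f = S (T f) - T (S f) :=
    fun S T f => rfl
  -- the filtration by the coordinates on which the operators act
  have lower : ∀ (T : Module.End ℂ (holo W)) (j : ℕ), j + 1 ≤ k + 3 →
      (∀ f : holo W, Dep (W : Set (Jet (k + 4))) f (j + 1) → T f = 0) →
      ∀ f : holo W, Dep (W : Set (Jet (k + 4))) f j → ⁅a, T⁆ f = 0 := fun T j hj hT f hf => by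
    rw [mul_apply, hT f (hf.mono (by omega)), map_zero, hT _ (raise f j (by omega) hf), sub_zero]
  have hb : ∀ f : holo W, Dep (W : Set (Jet (k + 4))) f (k + 3) → b f = 0 :=
    fun f hf => (const f hf).1
  have hm := lower b (k + 2) le_rfl hb
  have hκ := lower ⁅a, b⁆ (k + 1) (by omega) hm
  -- the coordinate functions
  let x : ℕ → holo W := fun l => holo.restrict (coord (k + 4) l) fun w _ =>
    (coord (k + 4) l).analyticAt w
  have x_apply : ∀ l, ∀ w ∈ W, (x l : Jet (k + 4) → ℂ) w = coord (k + 4) l w := fun l w hw =>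
    holo.restrict_apply _ hw
  have x_fderiv : ∀ l, ∀ w ∈ W, fderiv ℂ (x l : Jet (k + 4) → ℂ) w = coord (k + 4) l :=
    fun l w hw => (holo.fderiv_restrict _ hw).trans (coord (k + 4) l).fderiv
  have x_dep : ∀ l j, l + 1 ≤ j → Dep (W : Set (Jet (k + 4))) (x l) j := fun l j hl w hw i hi => by
    rw [x_fderiv l w hw]; exact coord_basisVec_of_ne (by omega)
  have ax : ∀ l, l + 1 < k + 4 → a (x l) = x (l + 1) := fun l hl => holo.ext fun w hw => by
    rw [(const _ (x_dep l _ (by omega))).2.2, act _ _ hq0 w hw, x_fderiv l w hw, x_apply _ w hw]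
    exact (C.X_apply (by omega) (hWb hw) (hδε _ hq0)).2.2 l hl
  have cx : c (x (k + 3)) = 0 := by
    have h := congrArg (fun T : Module.End ℂ (holo W) => T (x (k + 2))) hR.ac
    have h1 : ⁅a, c⁆ (x (k + 2)) = 0 := h
    rwa [mul_apply, (const _ (x_dep (k + 2) _ le_rfl)).2.1, map_zero, ax _ (by omega), zero_sub,
      neg_eq_zero] at h1
  have mx : ⁅a, b⁆ (x (k + 2)) = -b (x (k + 3)) := by
    rw [mul_apply, hb _ (x_dep (k + 2) _ le_rfl), map_zero, ax _ (by omega), zero_sub]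
  have κx : ⁅a, ⁅a, b⁆⁆ (x (k + 1)) = b (x (k + 3)) := by
    rw [mul_apply, hm _ (x_dep (k + 1) _ le_rfl), map_zero, ax _ (by omega), mx, zero_sub, neg_neg]
  have bx : b (x (k + 3)) = 0 := by
    obtain ⟨-, -, -, -, -, -, -, -, -, -, -, -, -, -, -, hrel⟩ := hR.decomposition
    have h := congrArg (fun T : Module.End ℂ (holo W) => T (x k)) hrel
    have h1 : ⁅a, ⁅a, ⁅a, b⁆⁆⁆ (x k) =
        -((9 : ℂ) • ⁅⁅⁅a, b⁆, ⁅a, ⁅a, b⁆⁆⁆, ⁅a, ⁅a, b⁆⁆⁆ (x k)) := h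
    have hx := x_dep k (k + 1) le_rfl
    have h2 := hκ _ hx
    have h3 := hm _ (hx.mono (by omega))
    have h4 : ⁅⁅a, b⁆, ⁅a, ⁅a, b⁆⁆⁆ (x k) = 0 := by
      rw [mul_apply, h2, h3, map_zero, map_zero, sub_zero]
    rw [mul_apply a, h2, map_zero, ax _ (by omega), κx, mul_apply _ ⁅a, ⁅a, b⁆⁆, h2, h4, map_zero,
      map_zero, sub_zero, smul_zero, neg_zero, zero_sub, neg_eq_zero] at h1
    exact h1
  -- hence the last component of `X` does not depend on `u`, which contradicts its definition
  have hw0 : w₀ ∈ W := by rw [hW]; exact Metric.mem_ball_self C.pos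
  have last : ∀ u ∈ Metric.ball (q₀ 0) δ,
      coord (k + 4) (k + 3) (X (w₀, u)) = (a (x (k + 3)) : Jet (k + 4) → ℂ) w₀ := fun u hu => by
    have h1 := act (x (k + 3)) u hu w₀ hw0
    have h2 : zcrA a b c u (x (k + 3)) =
      a (x (k + 3)) + u • b (x (k + 3)) + (u ^ 2 / 2) • c (x (k + 3)) := rfl
    rw [h2, bx, cx, smul_zero, smul_zero, add_zero, add_zero, x_fderiv _ w₀ hw0] at h1
    exact h1.symm
  have hwb := Metric.mem_ball_self (x := w₀) C.pos
  have hqb := Metric.mem_ball_self (x := q₀) C.pos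
  obtain ⟨z, hz⟩ : ∃ z, z = Γ (w₀, q₀) := ⟨_, rfl⟩
  have hu : uMap N (k + 4) 3 s z = (w₀, q₀) := hz ▸ C.uMap_eq w₀ hwb q₀ hqb
  have hzU : z ∈ U := hz ▸ C.mem w₀ hwb q₀ hqb
  have hs : s z = q₀ 0 := congrFun (congrArg Prod.snd hu) 0
  have e1 : ∀ᶠ z' in 𝓝 z, s z' ∈ Metric.ball (q₀ 0) δ := by
    refine (H.analytic_s z hzU).continuousAt.eventually_mem ?_
    rw [hs]; exact Metric.ball_mem_nhds _ hδ
  have e2 : ∀ᶠ z' in 𝓝 z, X (proj N (k + 4) z', s z') = proj N (k + 4) (fieldX z') :=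
    hz ▸ C.X_eq w₀ hwb q₀ hqb
  have ht : Tendsto (fun c : ℂ => z + c • basisVec N (k + 4)) (𝓝 0) (𝓝 z) := by
    have : Continuous fun c : ℂ => z + c • basisVec N (k + 4) := by fun_prop
    simpa using this.tendsto 0
  have e3 : ∀ᶠ c : ℂ in 𝓝 0, coord N (k + 4) z + c = (a (x (k + 3)) : Jet (k + 4) → ℂ) w₀ := by
    filter_upwards [ht.eventually e1, ht.eventually e2] with c h1 h2
    have hp : proj N (k + 4) (basisVec N (k + 4)) = 0 := by
      refine Prod.ext rfl (Prod.ext rfl (funext fun i => ?_))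
      exact coord_basisVec_of_ne (by omega)
    have h3 : proj N (k + 4) (z + c • basisVec N (k + 4)) = w₀ := by
      rw [map_add, map_smul, hp, smul_zero, add_zero]; exact congrArg Prod.fst hu
    rw [h3] at h2
    rw [← last _ h1, h2]
    have h4 : k + 3 < k + 4 := by omega
    have h5 : k + 3 < N := by omega
    rw [coord_of_lt h4]
    show _ = coord N (k + 3) (fieldX _)
    rw [coord_of_lt h5, fieldX_eq]
    show _ = coord N (k + 3 + 1) _
    rw [map_add, map_smul, coord_basisVec_self (by omega : k + 3 + 1 < N), smul_eq_mul, mul_one]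
  have h1 : HasDerivAt (fun c : ℂ => coord N (k + 4) z + c) 1 0 := (hasDerivAt_id 0).const_add _
  exact one_ne_zero (h1.unique ((hasDerivAt_const 0 _).congr_of_eventuallyEq e3))

/-- A Miura type transformation over the KdV equation has the order at most `3`. -/
theorem IsMiuraTransformation.order_le_three {m : ℕ} {Ω : Set (ℂ × ℂ × (Fin (m + 1) → ℂ))}
    {R S : ℂ × ℂ × (Fin (m + 1) → ℂ) → ℂ} (H : IsMiuraTransformation kdv Ω R S) {n : ℕ}
    (hn : HasOrder Ω S n) : n ≤ 3 := by
  obtain ⟨N, U, r, s, hN, hU, hM, hr⟩ := H.exists_isMiura hn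
  exact hM.order_le_three hr hN hU

end Bound
end KdVMiura

theorem mainTheorem7 :
    (∃ B : (Fin 3 → ℂ) → KdVMiura.KdVAlgebra,
      KdVMiura.IsWahlquistEstabrook.{w} 3 KdVMiura.kdv KdVMiura.kdvA B) ∧
    (KdVMiura.zcrSubalgebra KdVMiura.kdvA 3 : Set KdVMiura.KdVAlgebra) =
      KdVMiura.zcrUnion KdVMiura.kdvA ∧
    (∀ (m : ℕ) (Ω : Set (ℂ × ℂ × (Fin (m + 1) → ℂ)))
      (R S : ℂ × ℂ × (Fin (m + 1) → ℂ) → ℂ),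
      KdVMiura.IsMiuraTransformation KdVMiura.kdv Ω R S →
      ∀ n : ℕ, KdVMiura.HasOrder Ω S n → n ≤ 3) := by
  exact ⟨⟨_, KdVMiura.isWahlquistEstabrook_kdv⟩, KdVMiura.zcrSubalgebra_kdvA_three,
    fun _ _ _ _ H _ hn => H.order_le_three hn⟩
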